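/- **Setting.** Let $k$ be an ordered field. Consider the generators (arity $\to$ coarity) $\mathsf{copy}:1\to2$, $\mathsf{delete}:1\to0$, $\mathsf{scalar}_a:1\to1$ $(a\in k)$, $\mathsf{add}:2\to1$, $\mathsf{zero}:0\to1$; their mirror images $\mathsf{copy}^{op}:2\to1$, $\mathsf{delete}^{op}:0\to1$, $\mathsf{scalar}_a^{op}:1\to1$, $\mathsf{add}^{op}:1\to2$, $\mathsf{zero}^{op}:1\to0$; and $\mathsf{geq}:1\to1$. Let $\mathrm{Circ}^{\geq}$, $\overrightarrow{\mathrm{Circ}}$, $\overleftarrow{\mathrm{Circ}}$ be the props (symmetric strict monoidal categories with objects $\mathbb N$ and $\oplus=+$ on objects) freely generated by all these generators, by the first five, and by the five mirrored ones, respectively. Composition is written $;$ in diagrammatic order, $1$ is the identity wire, $\sigma$ the crossing of two wires. A circuit $c:n\to m$ denotes a relation $[\![c]\!]\subseteq k^n\times k^m$: sequential composition is relational composition, $\oplus$ is the cartesian product, $\mathsf{copy}$ denotes $\{(x,(x,x))\}$, $\mathsf{delete}$ $\{(x,\bullet)\}$, $\mathsf{scalar}_a$ $\{(x,ax)\}$,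 $\mathsf{add}$ $\{((x,y),x+y)\}$, $\mathsf{zero}$ $\{(\bullet,0)\}$, mirrored generators denote the opposite relations, and $\mathsf{geq}$ denotes $\{(x,y)\mid x\ge y\}$. Put $\mathsf{cup}=\mathsf{delete}^{op};\mathsf{copy}$, $\mathsf{cap}=\mathsf{copy}^{op};\mathsf{delete}$, and let $\mathsf{leq}=(1\oplus\mathsf{cup});(1\oplus\mathsf{geq}\oplus1);(\mathsf{cap}\oplus1)$. **The theory.** Let $\subseteq_{\mathbb{IHP}}$ be the smallest precongruence for $;$ and $\oplus$ on the arrows of $\mathrm{Circ}^{\geq}$ that contains the following axioms (an equation means both inclusions), and let $c=_{\mathbb{IHP}}d$ mean $c\subseteq_{\mathbb{IHP}}d$ and $d\subseteq_{\mathbb{IHP}}c$. (1) Interacting Hopf algebras, together with the mirror image of each axiom: $(\mathsf{add},\mathsf{zero})$ is a commutative monoid and $(\mathsf{copy},\mathsf{delete})$ a commutative comonoid; together they form a bimonoid, with $\mathsf{zero};\mathsf{delete}=\mathrm{id}_0$; each $\mathsf{scalar}_a$ commutes with $\mathsf{add},\mathsf{zero},\mathsf{copy},\mathsf{delete}$;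 $\mathsf{scalar}_a;\mathsf{scalar}_b=\mathsf{scalar}_{ab}$; $\mathsf{copy};(\mathsf{scalar}_a\oplus\mathsf{scalar}_b);\mathsf{add}=\mathsf{scalar}_{a+b}$; $\mathsf{scalar}_0=\mathsf{delete};\mathsf{zero}$; $\mathsf{scalar}_a;\mathsf{scalar}_a^{op}=1=\mathsf{scalar}_a^{op};\mathsf{scalar}_a$ for $a\ne0$; the Frobenius laws for $(\mathsf{copy},\mathsf{copy}^{op})$ and for $(\mathsf{add}^{op},\mathsf{add})$; $\mathsf{copy};\mathsf{copy}^{op}=1=\mathsf{add}^{op};\mathsf{add}$; $\mathsf{delete}^{op};\mathsf{delete}=\mathrm{id}_0=\mathsf{zero};\mathsf{zero}^{op}$; $\mathsf{add};\mathsf{zero}^{op}=(\mathsf{scalar}_{-1}\oplus1);\mathsf{cap}$ and $\mathsf{zero};\mathsf{add}^{op}=\mathsf{cup};(\mathsf{scalar}_{-1}\oplus1)$; $\mathsf{zero}^{op}\subseteq\mathsf{delete}$. (2) Axioms for $\geq$: $\mathsf{geq};\mathsf{copy}\subseteq\mathsf{copy};(\mathsf{geq}\oplus\mathsf{geq})$;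 $\mathsf{add};\mathsf{geq}=(\mathsf{geq}\oplus\mathsf{geq});\mathsf{add}$; $\mathsf{geq};\mathsf{delete}=\mathsf{delete}$; $\mathsf{zero}^{op}\subseteq\mathsf{geq};\mathsf{zero}^{op}$; $\mathsf{scalar}_a;\mathsf{geq}=\mathsf{geq};\mathsf{scalar}_a$ for $a>0$; $\mathsf{scalar}_a;\mathsf{geq}=\mathsf{leq};\mathsf{scalar}_a$ for $a<0$; $\mathsf{copy};(\mathsf{geq}\oplus\mathsf{leq});\mathsf{copy}^{op}\subseteq1$; $(\mathsf{geq}\oplus\mathsf{geq});\mathsf{copy}^{op};\mathsf{copy};(\mathsf{geq}\oplus\mathsf{geq})=(\mathsf{copy}\oplus\mathsf{copy});\mathsf{geq}^{\oplus4};(1\oplus\sigma\oplus1);(\mathsf{copy}^{op}\oplus\mathsf{copy}^{op})$; $\mathsf{leq};\mathsf{geq}=\mathsf{delete};\mathsf{delete}^{op}$. **Normal forms.** For $t:n+m\to p$ let $N(t):n\to m$ be the circuit $(\mathrm{id}_n\oplus\mathsf{cup}_m)\,;\,\bigl((t;\mathsf{geq}_p;\mathsf{zero}^{op}_p)\oplus\mathrm{id}_m\bigr)$,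 where indices denote $m$-fold and $p$-fold versions. A circuit $c:n\to m$ is in *polyhedral normal form* if $c=N(A)$ in $\mathrm{Circ}^{\geq}$ for some $p$ and some $A:n+m\to p$ in $\overrightarrow{\mathrm{Circ}}$, and in *finitely generated normal form* if $c=N(V)$ for some $p$ and some $V:n+m\to p$ in $\overleftarrow{\mathrm{Circ}}$. **Polar.** The polar operator $c\mapsto c^\circ$ is the prop morphism $\mathrm{Circ}^{\geq}\to\mathrm{Circ}^{\geq}$ (so $(c;d)^\circ=c^\circ;d^\circ$ and $(c\oplus d)^\circ=c^\circ\oplus d^\circ$) that exchanges $\mathsf{copy}\leftrightarrow\mathsf{add}^{op}$, $\mathsf{delete}\leftrightarrow\mathsf{zero}^{op}$, $\mathsf{scalar}_a\leftrightarrow\mathsf{scalar}_a^{op}$, $\mathsf{add}\leftrightarrow\mathsf{copy}^{op}$, $\mathsf{zero}\leftrightarrow\mathsf{delete}^{op}$, and sends $\mathsf{geq}$ to $\mathsf{copy};((\mathsf{geq};\mathsf{zero}^{op})\oplus1)$. **Theorem (Second Normal Form).** 1. For every arrow $c:n\to m$ of $\mathrm{Circ}^{\geq}$ there is an arrow $d:n\to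 m$ of $\mathrm{Circ}^{\geq}$ in finitely generated normal form such that $c=_{\mathbb{IHP}}d$. 2. For every $V:n+m\to p$ in $\overleftarrow{\mathrm{Circ}}$ there is an $(n+m)\times p$ matrix $M$ over $k$ with $[\![V]\!]=\{(u,z)\mid u=Mz\}$, and every circuit $c:n\to m$ with $c=_{\mathbb{IHP}}N(V)$ denotes the cone generated by $M$: $(x,y)\in[\![c]\!]$ if and only if $\binom{x}{y}\in\mathrm{cone}(M)=\{Mz\mid z\in k^p,\ z\ge0\}$. 3. For every $c:n\to m$ there is a circuit $P$ in polyhedral normal form with $c^\circ=_{\mathbb{IHP}}P$; and for every such $P$ there is a circuit $d$ in finitely generated normal form with $P^\circ=_{\mathbb{IHP}}d=_{\mathbb{IHP}}c$. 4. (Weyl–Minkowski) Every circuit in polyhedral normal form is $\mathbb{IHP}$-equal to one in finitely generated normal form, and conversely. Hence, for every $N$, a set $S\subseteq k^N$ is of the form $\{x\mid Ax\ge0\}$ for some $p\times N$ matrix $A$ if and only if it is of the form $\mathrm{cone}(V)$ for some $N\times p'$ matrix $V$. -/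

import Mathlib

/-! Free props over a monoidal signature, the circuits with a generator for `≥`, the theory of
polyhedral cones, the polar operator, and the two normal forms. -/

universe u

/-- Terms over a monoidal signature `S`, where `S n m` is the type of generators of arity `n` and
coarity `m`.  Terms are built from generators, identities and symmetries by sequential composition
and monoidal product.  Arrows of the free prop on `S` are terms up to `Term.SSMEq`. -/
inductive Term (S : ℕ → ℕ → Type u) : ℕ → ℕ → Type u
  | gen {n m : ℕ} (g : S n m) : Term S n m
  | id (n : ℕ) : Term S n n
  | sym (n m : ℕ) : Term S (n + m) (m + n)
  | seq {n m l : ℕ} (s : Term S n m) (t : Term S m l) : Term S n l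
  | tensor {n m n' m' : ℕ} (s : Term S n m) (t : Term S n' m') : Term S (n + n') (m + m')

infixl:60 " ⨾ " => Term.seq
infixl:70 " ⊞ " => Term.tensor

namespace Term

/-- Transport along equalities of arity and coarity (the monoidal product is strict). -/
def cast {S : ℕ → ℕ → Type u} {n n' m m' : ℕ} (hn : n = n') (hm : m = m') (t : Term S n m) :
    Term S n' m' :=
  match n', m', hn, hm with
  | _, _, rfl, rfl => t

/-- The prop morphism induced by a map of signatures. -/
def map {S T : ℕ → ℕ → Type u} (f : ∀ {n m : ℕ}, S n m → T n m) :
    ∀ {n m : ℕ}, Term S n m → Term T n m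
  | _, _, gen g => gen (f g)
  | _, _, id n => id n
  | _, _, sym n m => sym n m
  | _, _, seq s t => seq (map f s) (map f t)
  | _, _, tensor s t => tensor (map f s) (map f t)

/-- Equality of arrows in the free prop: the smallest congruence containing the laws of symmetric
strict monoidal categories. -/
inductive SSMEq {S : ℕ → ℕ → Type u} : ∀ {n m : ℕ}, Term S n m → Term S n m → Prop
  | refl {n m : ℕ} (t : Term S n m) : SSMEq t t
  | symm {n m : ℕ} {s t : Term S n m} : SSMEq s t → SSMEq t s
  | trans {n m : ℕ} {r s t : Term S n m} : SSMEq r s → SSMEq s t → SSMEq r t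
  | seq_congr {n m l : ℕ} {s s' : Term S n m} {t t' : Term S m l} :
      SSMEq s s' → SSMEq t t' → SSMEq (s ⨾ t) (s' ⨾ t')
  | tensor_congr {n m n' m' : ℕ} {s s' : Term S n m} {t t' : Term S n' m'} :
      SSMEq s s' → SSMEq t t' → SSMEq (s ⊞ t) (s' ⊞ t')
  | id_seq {n m : ℕ} (t : Term S n m) : SSMEq (id n ⨾ t) t
  | seq_id {n m : ℕ} (t : Term S n m) : SSMEq (t ⨾ id m) t
  | seq_assoc {n m l o : ℕ} (r : Term S n m) (s : Term S m l) (t : Term S l o) :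
      SSMEq ((r ⨾ s) ⨾ t) (r ⨾ (s ⨾ t))
  | id_tensor {n m : ℕ} (t : Term S n m) :
      SSMEq ((id 0 ⊞ t).cast (Nat.zero_add n) (Nat.zero_add m)) t
  | tensor_id {n m : ℕ} (t : Term S n m) :
      SSMEq ((t ⊞ id 0).cast (Nat.add_zero n) (Nat.add_zero m)) t
  | tensor_assoc {n m n' m' n'' m'' : ℕ}
      (r : Term S n m) (s : Term S n' m') (t : Term S n'' m'') :
      SSMEq (((r ⊞ s) ⊞ t).cast (Nat.add_assoc n n' n'') (Nat.add_assoc m m' m''))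
        (r ⊞ (s ⊞ t))
  | id_tensor_id (n m : ℕ) : SSMEq (id n ⊞ id m) (id (n + m))
  | interchange {n m l n' m' l' : ℕ} (s : Term S n m) (t : Term S m l)
      (s' : Term S n' m') (t' : Term S m' l') :
      SSMEq ((s ⨾ t) ⊞ (s' ⨾ t')) ((s ⊞ s') ⨾ (t ⊞ t'))
  | sym_natural {n m n' m' : ℕ} (s : Term S n m) (t : Term S n' m') :
      SSMEq ((s ⊞ t) ⨾ sym m m') (sym n n' ⨾ (t ⊞ s))
  | sym_sym (n m : ℕ) : SSMEq (sym n m ⨾ sym m n) (id (n + m))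
  | sym_zero (n : ℕ) :
      SSMEq ((sym n 0).cast (Nat.add_zero n) (Nat.zero_add n)) (id n)
  | sym_add (n m l : ℕ) :
      SSMEq (sym n (m + l))
        ((sym n m ⊞ id l).cast (Nat.add_assoc n m l) (Nat.add_assoc m n l) ⨾
          (id m ⊞ sym n l).cast rfl (Nat.add_assoc m l n).symm)

end Term

/-- The generators of matrix circuits. -/
inductive RightGen (k : Type u) : ℕ → ℕ → Type u
  | copy : RightGen k 1 2
  | delete : RightGen k 1 0
  | scalar (a : k) : RightGen k 1 1
  | add : RightGen k 2 1
  | zero : RightGen k 0 1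

/-- The mirror images of the generators of matrix circuits. -/
inductive LeftGen (k : Type u) : ℕ → ℕ → Type u
  | cocopy : LeftGen k 2 1
  | codelete : LeftGen k 0 1
  | coscalar (a : k) : LeftGen k 1 1
  | coadd : LeftGen k 1 2
  | cozero : LeftGen k 1 0

/-- All generators: the above together with `≥`. -/
inductive GeqGen (k : Type u) : ℕ → ℕ → Type u
  | right {n m : ℕ} (g : RightGen k n m) : GeqGen k n m
  | left {n m : ℕ} (g : LeftGen k n m) : GeqGen k n m
  | geq : GeqGen k 1 1

/-- Circuits over the generators of matrix circuits only. -/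
abbrev CircRight (k : Type u) : ℕ → ℕ → Type u := Term (RightGen k)

/-- Circuits over the mirrored generators only. -/
abbrev CircLeft (k : Type u) : ℕ → ℕ → Type u := Term (LeftGen k)

/-- Circuits with the generator `≥`. -/
abbrev CircGeq (k : Type u) : ℕ → ℕ → Type u := Term (GeqGen k)

/-- The inclusion of right circuits. -/
def CircRight.incl {k : Type u} {n m : ℕ} (c : CircRight k n m) : CircGeq k n m :=
  Term.map GeqGen.right c

/-- The inclusion of left circuits. -/
def CircLeft.incl {k : Type u} {n m : ℕ} (c : CircLeft k n m) : CircGeq k n m :=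
  Term.map GeqGen.left c

namespace CircGeq

section generators

variable {k : Type u}

def copy : CircGeq k 1 2 := .gen (.right .copy)
def delete : CircGeq k 1 0 := .gen (.right .delete)
def scalar (a : k) : CircGeq k 1 1 := .gen (.right (.scalar a))
def add : CircGeq k 2 1 := .gen (.right .add)
def zero : CircGeq k 0 1 := .gen (.right .zero)
def cocopy : CircGeq k 2 1 := .gen (.left .cocopy)
def codelete : CircGeq k 0 1 := .gen (.left .codelete)
def coscalar (a : k) : CircGeq k 1 1 := .gen (.left (.coscalar a))
def coadd : CircGeq k 1 2 := .gen (.left .coadd)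
def cozero : CircGeq k 1 0 := .gen (.left .cozero)
def geq : CircGeq k 1 1 := .gen .geq

/-- The wire `1 → 1`. -/
def wire : CircGeq k 1 1 := .id 1

/-- The crossing of two wires. -/
def swap : CircGeq k 2 2 := .sym 1 1

/-- The empty diagram. -/
def empty : CircGeq k 0 0 := .id 0

/-- `cup : 0 → 2` and `cap : 2 → 0` force two ports to carry the same value. -/
def cup : CircGeq k 0 2 := codelete ⨾ copy
def cap : CircGeq k 2 0 := cocopy ⨾ delete

/-- The opposite of `≥`, obtained by bending its two wires. -/
def leq : CircGeq k 1 1 := (wire ⊞ cup) ⨾ (wire ⊞ (geq ⊞ wire)) ⨾ (cap ⊞ wire)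

/-- The `n`-fold versions of some of the generators. -/
def copyN : ∀ n : ℕ, CircGeq k n (n + n)
  | 0 => .id 0
  | n + 1 =>
    (copyN n ⊞ copy).cast rfl (by omega : n + n + 2 = n + (n + 1 + 1)) ⨾
      (Term.id n ⊞ (Term.sym n 1 ⊞ Term.id 1)).cast rfl
        (by omega : n + (1 + n + 1) = (n + 1) + (n + 1))

def codeleteN : ∀ n : ℕ, CircGeq k 0 n
  | 0 => .id 0
  | n + 1 => codeleteN n ⊞ codelete

def cozeroN : ∀ n : ℕ, CircGeq k n 0
  | 0 => .id 0
  | n + 1 => cozeroN n ⊞ cozero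

def geqN : ∀ n : ℕ, CircGeq k n n
  | 0 => .id 0
  | n + 1 => geqN n ⊞ geq

/-- The `n`-fold cup, which forces two bundles of `n` ports to carry the same vector. -/
def cupN (n : ℕ) : CircGeq k 0 (n + n) := codeleteN n ⨾ copyN n

end generators

/-- The opposite circuit of a generator. -/
def genOp {k : Type u} : ∀ {n m : ℕ}, GeqGen k n m → CircGeq k m n
  | _, _, .right .copy => cocopy
  | _, _, .right .delete => codelete
  | _, _, .right (.scalar a) => coscalar a
  | _, _, .right .add => coadd
  | _, _, .right .zero => cozero
  | _, _, .left .cocopy => copy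
  | _, _, .left .codelete => delete
  | _, _, .left (.coscalar a) => scalar a
  | _, _, .left .coadd => add
  | _, _, .left .cozero => zero
  | _, _, .geq => leq

/-- The opposite (mirror image) of a circuit. -/
def op {k : Type u} : ∀ {n m : ℕ}, CircGeq k n m → CircGeq k m n
  | _, _, .gen g => genOp g
  | _, _, .id n => .id n
  | _, _, .sym n m => .sym m n
  | _, _, .seq c d => op d ⨾ op c
  | _, _, .tensor c d => op c ⊞ op d

/-- The polar of a generator. -/
def genPolar {k : Type u} : ∀ {n m : ℕ}, GeqGen k n m → CircGeq k n m
  | _, _, .right .copy => coadd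
  | _, _, .right .delete => cozero
  | _, _, .right (.scalar a) => coscalar a
  | _, _, .right .add => cocopy
  | _, _, .right .zero => codelete
  | _, _, .left .cocopy => add
  | _, _, .left .codelete => zero
  | _, _, .left (.coscalar a) => scalar a
  | _, _, .left .coadd => copy
  | _, _, .left .cozero => delete
  | _, _, .geq => copy ⨾ ((geq ⨾ cozero) ⊞ wire)

/-- The polar operator: the prop morphism extending `genPolar`. -/
def polar {k : Type u} : ∀ {n m : ℕ}, CircGeq k n m → CircGeq k n m
  | _, _, .gen g => genPolar g
  | _, _, .id n => .id n
  | _, _, .sym n m => .sym n m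
  | _, _, .seq c d => polar c ⨾ polar d
  | _, _, .tensor c d => polar c ⊞ polar d

/-- The relation denoted by a generator. -/
def genSem {k : Type u} [Field k] [LinearOrder k] :
    ∀ {n m : ℕ}, GeqGen k n m → (Fin n → k) → (Fin m → k) → Prop
  | _, _, .right .copy, x, y => y = ![x 0, x 0]
  | _, _, .right .delete, _, _ => True
  | _, _, .right (.scalar a), x, y => y 0 = a * x 0
  | _, _, .right .add, x, y => y 0 = x 0 + x 1
  | _, _, .right .zero, _, y => y 0 = 0
  | _, _, .left .cocopy, x, y => x = ![y 0, y 0]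
  | _, _, .left .codelete, _, _ => True
  | _, _, .left (.coscalar a), x, y => x 0 = a * y 0
  | _, _, .left .coadd, x, y => x 0 = y 0 + y 1
  | _, _, .left .cozero, x, _ => x 0 = 0
  | _, _, .geq, x, y => x 0 ≥ y 0

/-- The relation between `kⁿ` and `kᵐ` denoted by a circuit `n → m`. -/
def sem {k : Type u} [Field k] [LinearOrder k] :
    ∀ {n m : ℕ}, CircGeq k n m → (Fin n → k) → (Fin m → k) → Prop
  | _, _, .gen g, x, y => genSem g x y
  | _, _, .id _, x, y => x = y
  | _, _, .sym n m, x, y =>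
    y = Fin.append (fun i : Fin m => x (Fin.natAdd n i)) (fun i : Fin n => x (Fin.castAdd m i))
  | _, _, .seq c d, x, z => ∃ y, sem c x y ∧ sem d y z
  | _, _, .tensor (n := n) (m := m) (n' := n') (m' := m') c d, x, y =>
    sem c (fun i => x (Fin.castAdd n' i)) (fun i => y (Fin.castAdd m' i)) ∧
      sem d (fun i => x (Fin.natAdd n i)) (fun i => y (Fin.natAdd m i))

/-- The equations of Interacting Hopf Algebras (without their mirror images). -/
inductive IHEquation {k : Type u} [Field k] :
    ∀ {n m : ℕ}, CircGeq k n m → CircGeq k n m → Prop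
  -- `add` and `zero` form a commutative monoid
  | add_assoc : IHEquation ((add ⊞ wire) ⨾ add) ((wire ⊞ add) ⨾ add :)
  | add_comm : IHEquation (swap ⨾ add) add
  | zero_add : IHEquation ((zero ⊞ wire) ⨾ add) wire
  -- `copy` and `delete` form a commutative comonoid
  | copy_coassoc : IHEquation (copy ⨾ (copy ⊞ wire)) (copy ⨾ (wire ⊞ copy) :)
  | copy_cocomm : IHEquation (copy ⨾ swap) copy
  | copy_counit : IHEquation (copy ⨾ (delete ⊞ wire)) wire
  -- together they form a bimonoid
  | bimonoid : IHEquation (add ⨾ copy)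
      ((copy ⊞ copy) ⨾ (wire ⊞ (swap ⊞ wire) :) ⨾ (add ⊞ add :) :)
  | zero_copy : IHEquation (zero ⨾ copy) (zero ⊞ zero)
  | add_delete : IHEquation (add ⨾ delete) (delete ⊞ delete)
  | zero_delete : IHEquation (zero ⨾ delete) empty
  -- scalars
  | scalar_add (a : k) : IHEquation (add ⨾ scalar a) ((scalar a ⊞ scalar a) ⨾ add)
  | scalar_zero (a : k) : IHEquation (zero ⨾ scalar a) zero
  | scalar_copy (a : k) : IHEquation (scalar a ⨾ copy) (copy ⨾ (scalar a ⊞ scalar a))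
  | scalar_delete (a : k) : IHEquation (scalar a ⨾ delete) delete
  | mul_scalar (a b : k) : IHEquation (scalar a ⨾ scalar b) (scalar (a * b))
  | add_scalar (a b : k) : IHEquation (copy ⨾ (scalar a ⊞ scalar b) ⨾ add) (scalar (a + b))
  | zero_scalar : IHEquation (scalar 0) (delete ⨾ zero)
  | scalar_coscalar (a : k) : a ≠ 0 → IHEquation (scalar a ⨾ coscalar a) wire
  | coscalar_scalar (a : k) : a ≠ 0 → IHEquation wire (coscalar a ⨾ scalar a)
  -- `copy`, `delete`, `cocopy`, `codelete` form an extraspecial Frobenius monoid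
  | copy_frobenius_left : IHEquation ((copy ⊞ wire) ⨾ (wire ⊞ cocopy :)) (cocopy ⨾ copy :)
  | copy_frobenius_right : IHEquation (cocopy ⨾ copy) ((wire ⊞ copy) ⨾ (cocopy ⊞ wire :) :)
  | copy_special : IHEquation (copy ⨾ cocopy) wire
  | copy_bone : IHEquation (codelete ⨾ delete) empty
  -- `add`, `zero`, `coadd`, `cozero` form an extraspecial Frobenius monoid
  | add_frobenius_left : IHEquation ((coadd ⊞ wire) ⨾ (wire ⊞ add :)) (add ⨾ coadd :)
  | add_frobenius_right : IHEquation (add ⨾ coadd) ((wire ⊞ coadd) ⨾ (add ⊞ wire :) :)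
  | add_special : IHEquation (coadd ⨾ add) wire
  | add_bone : IHEquation (zero ⨾ cozero) empty
  -- the two compact closed structures agree up to a sign
  | cap_eq : IHEquation (add ⨾ cozero) ((scalar (-1) ⊞ wire) ⨾ cap)
  | cup_eq : IHEquation (zero ⨾ coadd) (cup ⨾ (scalar (-1) ⊞ wire))

/-- The axioms of Interacting Hopf Algebras, as inequations (without their mirror images). -/
inductive IHAxiom {k : Type u} [Field k] :
    ∀ {n m : ℕ}, CircGeq k n m → CircGeq k n m → Prop
  | eq {n m : ℕ} {c d : CircGeq k n m} : IHEquation c d → IHAxiom c d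
  | eq_symm {n m : ℕ} {c d : CircGeq k n m} : IHEquation c d → IHAxiom d c
  | cozero_le_delete : IHAxiom cozero delete

/-- The equations for `≥`. -/
inductive GeqEquation {k : Type u} [Field k] [LinearOrder k] :
    ∀ {n m : ℕ}, CircGeq k n m → CircGeq k n m → Prop
  | add_geq : GeqEquation (add ⨾ geq) ((geq ⊞ geq) ⨾ add)
  | geq_delete : GeqEquation (geq ⨾ delete) delete
  | pos_scalar (a : k) : 0 < a → GeqEquation (scalar a ⨾ geq) (geq ⨾ scalar a)
  | neg_scalar (a : k) : a < 0 → GeqEquation (scalar a ⨾ geq) (leq ⨾ scalar a)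
  | spider : GeqEquation
      ((geq ⊞ geq) ⨾ cocopy ⨾ copy ⨾ (geq ⊞ geq))
      ((copy ⊞ copy) ⨾ ((geq ⊞ geq) ⊞ (geq ⊞ geq)) ⨾ (wire ⊞ (swap ⊞ wire) :) ⨾
        (cocopy ⊞ cocopy :) :)
  | direction : GeqEquation (leq ⨾ geq) (delete ⨾ codelete)

/-- The inequations for `≥`. -/
inductive GeqInequation {k : Type u} :
    ∀ {n m : ℕ}, CircGeq k n m → CircGeq k n m → Prop
  | geq_copy : GeqInequation (geq ⨾ copy) (copy ⨾ (geq ⊞ geq))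
  | cozero_geq : GeqInequation cozero (geq ⨾ cozero)
  | antisymm : GeqInequation (copy ⨾ (geq ⊞ leq) ⨾ cocopy) wire

/-- Provable inclusion of circuits in the theory of polyhedral cones: the smallest precongruence on
arrows of the free prop that contains the axioms of Interacting Hopf Algebras, their mirror images,
and the axioms for `≥`. -/
inductive IHPLe {k : Type u} [Field k] [LinearOrder k] :
    ∀ {n m : ℕ}, CircGeq k n m → CircGeq k n m → Prop
  | ssm {n m : ℕ} {c d : CircGeq k n m} : Term.SSMEq c d → IHPLe c d
  | trans {n m : ℕ} {c d e : CircGeq k n m} : IHPLe c d → IHPLe d e → IHPLe c e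
  | seq {n m l : ℕ} {c c' : CircGeq k n m} {d d' : CircGeq k m l} :
      IHPLe c c' → IHPLe d d' → IHPLe (c ⨾ d) (c' ⨾ d')
  | tensor {n m n' m' : ℕ} {c c' : CircGeq k n m} {d d' : CircGeq k n' m'} :
      IHPLe c c' → IHPLe d d' → IHPLe (c ⊞ d) (c' ⊞ d')
  | ih {n m : ℕ} {c d : CircGeq k n m} : IHAxiom c d → IHPLe c d
  | ih_op {n m : ℕ} {c d : CircGeq k n m} : IHAxiom c d → IHPLe (op c) (op d)
  | geq_eq {n m : ℕ} {c d : CircGeq k n m} : GeqEquation c d → IHPLe c d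
  | geq_eq_symm {n m : ℕ} {c d : CircGeq k n m} : GeqEquation c d → IHPLe d c
  | geq_ineq {n m : ℕ} {c d : CircGeq k n m} : GeqInequation c d → IHPLe c d

/-- Provable equality of circuits in the theory of polyhedral cones. -/
def IHPEq {k : Type u} [Field k] [LinearOrder k] {n m : ℕ} (c d : CircGeq k n m) : Prop :=
  IHPLe c d ∧ IHPLe d c

/-- The circuit `n → m` obtained from `t : n + m → p` by bending its last `m` inputs to the right
with a cup and constraining its `p` outputs to be nonnegative. -/
def conic {k : Type u} {n m p : ℕ} (t : CircGeq k (n + m) p) : CircGeq k n m :=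
  (Term.id n ⊞ cupN m).cast (Nat.add_zero n) (Nat.add_assoc n m m).symm ⨾
    ((t ⨾ geqN p ⨾ cozeroN p) ⊞ Term.id m).cast rfl (Nat.zero_add m)

/-- Polyhedral normal form (first normal form). -/
def IsPolyhedralNF {k : Type u} {n m : ℕ} (c : CircGeq k n m) : Prop :=
  ∃ (p : ℕ) (A : CircRight k (n + m) p), Term.SSMEq c (conic A.incl)

/-- Finitely generated normal form (second normal form). -/
def IsFinGenNF {k : Type u} {n m : ℕ} (c : CircGeq k n m) : Prop :=
  ∃ (p : ℕ) (V : CircLeft k (n + m) p), Term.SSMEq c (conic V.incl)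

end CircGeq

/-- The polyhedral cone `{x | A x ≥ 0}`. -/
def polyhedralCone {k : Type u} [Field k] [LinearOrder k] {N p : ℕ}
    (A : Matrix (Fin p) (Fin N) k) : Set (Fin N → k) :=
  {x | ∀ i, 0 ≤ A.mulVec x i}

/-- The finitely generated cone `cone(V) = {V z | z ≥ 0}`. -/
def finGenCone {k : Type u} [Field k] [LinearOrder k] {N p : ℕ}
    (V : Matrix (Fin N) (Fin p) k) : Set (Fin N → k) :=
  {v | ∃ z : Fin p → k, (∀ i, 0 ≤ z i) ∧ v = V.mulVec z}

/-! Circuits modulo provable equality are the arrows of a symmetric strict monoidal category whose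
hom-sets are ordered by provable inclusion. The core of the proof is Fourier–Motzkin elimination
carried out inside this ordered category.

A circuit over the first five generators equals a matrix (`mk_incl_eq_mat`), so "a matrix followed
by a nonnegativity test" is a system of homogeneous linear inequalities, `Phi L`. Nonnegativity is
preserved by sums and by nonnegative scalars, hence `Phi L ≤ Phi L'` is derivable whenever every row
of `L'` is a nonnegative combination of rows of `L` (`Phi_mono`). Precomposing with `codelete`
quantifies a variable existentially (`ex`). Eliminating that variable requires a value between
finitely many lower and upper bounds, given that they are pairwise compatible. The axioms supply
this only for two lower bounds alone (`direction`) and for two against two (`spider`).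
`Interpolates.cons` bootstraps these cases to arbitrary finite lists, and `exists_ex_Phi_eq`
follows.

Every generator can then be absorbed into a system: `cozero` is a pair of opposite inequalities,
`codelete` is an elimination, and `cocopy` and `geq` become tests on differences once their output
is bent back. By induction every circuit is a bent system, which is the polyhedral normal form
(`exists_eq_bend`).

Soundness (`sem_of_ihpLe`) turns elimination into a statement about vectors. Elimination also
records that its rows are nonnegative combinations of the old ones, and this certificate gives
Farkas' lemma (`inCone_of_forall`). Farkas' lemma and `Phi_mono` together give completeness
(`ihpLe_iff`). Weyl's theorem is a projection, and Minkowski's follows from it by duality and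
Farkas' lemma. For the finitely generated form, the cone of the polyhedral form is rewritten by
generators, the generator matrix is realised as a left circuit, and completeness provides the
derivation. Completeness also reduces antitonicity of the polar to a semantic check of each axiom;
with `polar_polar`, this yields the statement on polars. -/

open CategoryTheory MonoidalCategory

set_option linter.unusedSectionVars false

/-! ### The ordered symmetric monoidal category of circuits modulo provable equality -/

namespace CircGeq

section order

variable {k : Type u} [Field k] [LinearOrder k] {n m : ℕ}

theorem IHPLe.refl (c : CircGeq k n m) : IHPLe c c := .ssm (.refl c)

theorem IHPEq.refl (c : CircGeq k n m) : IHPEq c c := ⟨.refl c, .refl c⟩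

theorem IHPEq.symm {c d : CircGeq k n m} (h : IHPEq c d) : IHPEq d c := ⟨h.2, h.1⟩

theorem IHPEq.trans {c d e : CircGeq k n m} (h : IHPEq c d) (h' : IHPEq d e) : IHPEq c e :=
  ⟨h.1.trans h'.1, h'.2.trans h.2⟩

theorem IHPEq.of_ssm {c d : CircGeq k n m} (h : Term.SSMEq c d) : IHPEq c d :=
  ⟨.ssm h, .ssm h.symm⟩

variable (k n m) in
/-- Provable equality as a setoid. -/
def setoid : Setoid (CircGeq k n m) where
  r := IHPEq
  iseqv := ⟨IHPEq.refl, IHPEq.symm, IHPEq.trans⟩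

end order

/-- The objects of the category of circuits modulo provable equality. -/
@[ext]
structure Ob (k : Type u) : Type where
  /-- The number of wires. -/
  len : ℕ

section category

variable {k : Type u} [Field k] [LinearOrder k]

/-- Circuits modulo provable equality. -/
def ObHom (X Y : Ob k) : Type u := Quotient (setoid k X.len Y.len)

/-- The class of a circuit modulo provable equality. -/
def toHom {n m : ℕ} (c : CircGeq k n m) : ObHom (k := k) ⟨n⟩ ⟨m⟩ := Quotient.mk _ c

theorem toHom_eq {n m : ℕ} {c d : CircGeq k n m} : toHom c = toHom d ↔ IHPEq c d :=
  Quotient.eq (r := setoid k n m)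

instance (X Y : Ob k) : PartialOrder (ObHom X Y) where
  le f g := Quotient.liftOn₂ f g IHPLe fun _ _ _ _ h h' =>
    propext ⟨fun l => (h.2.trans l).trans h'.1, fun l => (h.1.trans l).trans h'.2⟩
  le_refl f := Quotient.inductionOn f IHPLe.refl
  le_trans f g h := Quotient.inductionOn₃ f g h fun _ _ _ => IHPLe.trans
  le_antisymm f g := Quotient.inductionOn₂ f g fun _ _ h h' => Quotient.sound ⟨h, h'⟩

theorem toHom_surj {X Y : Ob k} (f : ObHom X Y) : ∃ c : CircGeq k X.len Y.len, toHom c = f :=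
  Quotient.exists_rep f

/-- Composition of circuits modulo provable equality. -/
def ObHom.comp {X Y Z : Ob k} (f : ObHom X Y) (g : ObHom Y Z) : ObHom X Z :=
  Quotient.map₂ (fun c d => Term.seq c d)
    (fun _ _ (h : IHPEq _ _) _ _ (h' : IHPEq _ _) =>
      (⟨IHPLe.seq h.1 h'.1, IHPLe.seq h.2 h'.2⟩ : IHPEq _ _)) f g

/-- The monoidal product of circuits modulo provable equality. -/
def ObHom.prod {X Y X' Y' : Ob k} (f : ObHom X Y) (g : ObHom X' Y') :
    ObHom (k := k) ⟨X.len + X'.len⟩ ⟨Y.len + Y'.len⟩ :=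
  Quotient.map₂ (fun c d => Term.tensor c d)
    (fun _ _ (h : IHPEq _ _) _ _ (h' : IHPEq _ _) =>
      (⟨IHPLe.tensor h.1 h'.1, IHPLe.tensor h.2 h'.2⟩ : IHPEq _ _)) f g

theorem toHom_ssm {n m : ℕ} {c d : CircGeq k n m} (h : Term.SSMEq c d) : toHom c = toHom d :=
  toHom_eq.2 (.of_ssm h)

instance : Category.{u} (Ob k) where
  Hom := ObHom
  id X := toHom (Term.id X.len)
  comp := ObHom.comp
  id_comp f := by
    obtain ⟨c, rfl⟩ := toHom_surj f
    exact toHom_ssm (.id_seq c)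
  comp_id f := by
    obtain ⟨c, rfl⟩ := toHom_surj f
    exact toHom_ssm (.seq_id c)
  assoc f g h := by
    obtain ⟨c, rfl⟩ := toHom_surj f
    obtain ⟨d, rfl⟩ := toHom_surj g
    obtain ⟨e, rfl⟩ := toHom_surj h
    exact toHom_ssm (.seq_assoc c d e)

instance (X Y : Ob k) : PartialOrder (X ⟶ Y) := inferInstanceAs (PartialOrder (ObHom X Y))

/-- The class of a circuit, as an arrow. -/
def mk {n m : ℕ} (c : CircGeq k n m) : (⟨n⟩ : Ob k) ⟶ ⟨m⟩ := toHom c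

theorem mk_le {n m : ℕ} {c d : CircGeq k n m} : mk c ≤ mk d ↔ IHPLe c d := Iff.rfl

theorem mk_eq {n m : ℕ} {c d : CircGeq k n m} : mk c = mk d ↔ IHPEq c d := toHom_eq

theorem mk_ssm {n m : ℕ} {c d : CircGeq k n m} (h : Term.SSMEq c d) : mk c = mk d :=
  toHom_ssm h

theorem mk_surj {X Y : Ob k} (f : X ⟶ Y) : ∃ c : CircGeq k X.len Y.len, mk c = f :=
  toHom_surj f

theorem mk_seq {n m l : ℕ} (c : CircGeq k n m) (d : CircGeq k m l) :
    mk (c ⨾ d) = mk c ≫ mk d := rfl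

theorem comp_mono {X Y Z : Ob k} {f f' : X ⟶ Y} {g g' : Y ⟶ Z} (h : f ≤ f') (h' : g ≤ g') :
    f ≫ g ≤ f' ≫ g' := by
  obtain ⟨c, rfl⟩ := mk_surj f
  obtain ⟨c', rfl⟩ := mk_surj f'
  obtain ⟨d, rfl⟩ := mk_surj g
  obtain ⟨d', rfl⟩ := mk_surj g'
  exact IHPLe.seq (mk_le.1 h) (mk_le.1 h')

/-- Casts become composites with `eqToHom`, which is how the strict structure of the prop is matched
with associators and unitors. -/
theorem mk_cast {n n' m m' : ℕ} (hn : n = n') (hm : m = m') (c : CircGeq k n m) :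
    mk (c.cast hn hm) =
      eqToHom (congrArg Ob.mk hn.symm) ≫ mk c ≫ eqToHom (congrArg Ob.mk hm) := by
  subst hn hm
  simp [Term.cast]

theorem mk_eq_of_cast {n n' m m' : ℕ} {hn : n = n'} {hm : m = m'} {c : CircGeq k n m}
    {d : CircGeq k n' m'} (h : Term.SSMEq (c.cast hn hm) d) :
    mk c ≫ eqToHom (congrArg Ob.mk hm) = eqToHom (congrArg Ob.mk hn) ≫ mk d := by
  subst hn hm
  rw [eqToHom_refl, eqToHom_refl, Category.comp_id, Category.id_comp]
  exact mk_ssm h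

/-- All structure isomorphisms come from equalities between numbers of wires. Those along `n + 0 =
n`, or between closed numerals, are identities by computation; many later steps compose with such
identities. -/
instance : MonoidalCategoryStruct (Ob k) where
  tensorObj X Y := ⟨X.len + Y.len⟩
  whiskerLeft X _ _ f := ObHom.prod (𝟙 X : X ⟶ X) f
  whiskerRight f Y := ObHom.prod f (𝟙 Y : Y ⟶ Y)
  tensorHom f g := ObHom.prod f g
  tensorUnit := ⟨0⟩
  associator X Y Z := eqToIso (congrArg Ob.mk (Nat.add_assoc X.len Y.len Z.len))
  leftUnitor X := eqToIso (congrArg Ob.mk (Nat.zero_add X.len))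
  rightUnitor X := eqToIso (congrArg Ob.mk (Nat.add_zero X.len))

theorem id_tensorHom_id' (X Y : Ob k) : (𝟙 X ⊗ₘ 𝟙 Y) = 𝟙 (X ⊗ Y) :=
  mk_ssm (.id_tensor_id X.len Y.len)

theorem eqToHom_tensorHom {X X' : Ob k} (h : X = X') (Y : Ob k) :
    (eqToHom h ⊗ₘ 𝟙 Y) = eqToHom (congrArg (· ⊗ Y) h) := by
  subst h
  exact id_tensorHom_id' _ _

theorem tensorHom_eqToHom {Y Y' : Ob k} (X : Ob k) (h : Y = Y') :
    (𝟙 X ⊗ₘ eqToHom h) = eqToHom (congrArg (X ⊗ ·) h) := by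
  subst h
  exact id_tensorHom_id' _ _

theorem tensor_assoc_eq (X Y Z : Ob k) : (X ⊗ Y) ⊗ Z = X ⊗ (Y ⊗ Z) :=
  congrArg Ob.mk (Nat.add_assoc X.len Y.len Z.len)

theorem unit_tensor_eq (X : Ob k) : 𝟙_ (Ob k) ⊗ X = X :=
  congrArg Ob.mk (Nat.zero_add X.len)

theorem tensor_unit_eq (X : Ob k) : X ⊗ 𝟙_ (Ob k) = X := rfl

instance : MonoidalCategory (Ob k) := MonoidalCategory.ofTensorHom
  (id_tensorHom_id := id_tensorHom_id')
  (id_tensorHom := fun _ _ _ _ => rfl)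
  (tensorHom_id := fun _ _ => rfl)
  (tensorHom_comp_tensorHom := fun f g f' g' => by
    obtain ⟨c, rfl⟩ := mk_surj f
    obtain ⟨d, rfl⟩ := mk_surj g
    obtain ⟨c', rfl⟩ := mk_surj f'
    obtain ⟨d', rfl⟩ := mk_surj g'
    exact mk_ssm (Term.SSMEq.interchange c c' d d').symm)
  (associator_naturality := fun f g h => by
    obtain ⟨c, rfl⟩ := mk_surj f
    obtain ⟨d, rfl⟩ := mk_surj g
    obtain ⟨e, rfl⟩ := mk_surj h
    exact mk_eq_of_cast (.tensor_assoc c d e))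
  (leftUnitor_naturality := fun f => by
    obtain ⟨c, rfl⟩ := mk_surj f
    exact mk_eq_of_cast (.id_tensor c))
  (rightUnitor_naturality := fun f => by
    obtain ⟨c, rfl⟩ := mk_surj f
    exact mk_eq_of_cast (.tensor_id c))
  (pentagon := fun W X Y Z => by
    change (eqToHom (tensor_assoc_eq W X Y) ⊗ₘ 𝟙 Z) ≫ eqToHom (tensor_assoc_eq W (X ⊗ Y) Z) ≫
      (𝟙 W ⊗ₘ eqToHom (tensor_assoc_eq X Y Z)) =
      eqToHom (tensor_assoc_eq (W ⊗ X) Y Z) ≫ eqToHom (tensor_assoc_eq W X (Y ⊗ Z))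
    simp only [eqToHom_tensorHom, tensorHom_eqToHom, eqToHom_trans])
  (triangle := fun X Y => by
    change eqToHom (tensor_assoc_eq X (𝟙_ _) Y) ≫ (𝟙 X ⊗ₘ eqToHom (unit_tensor_eq Y)) =
      (eqToHom (tensor_unit_eq X) ⊗ₘ 𝟙 Y)
    simp only [eqToHom_tensorHom, tensorHom_eqToHom, eqToHom_trans])

theorem tensor_mono {X Y X' Y' : Ob k} {f f' : X ⟶ Y} {g g' : X' ⟶ Y'} (h : f ≤ f')
    (h' : g ≤ g') : f ⊗ₘ g ≤ f' ⊗ₘ g' := by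
  obtain ⟨c, rfl⟩ := mk_surj f
  obtain ⟨c', rfl⟩ := mk_surj f'
  obtain ⟨d, rfl⟩ := mk_surj g
  obtain ⟨d', rfl⟩ := mk_surj g'
  exact IHPLe.tensor (mk_le.1 h) (mk_le.1 h')

theorem whiskerRight_mono (Z : Ob k) {X Y : Ob k} {f f' : X ⟶ Y} (h : f ≤ f') :
    f ▷ Z ≤ f' ▷ Z := by
  simpa using tensor_mono h (le_refl (𝟙 Z))

theorem sym_natural {X X' Y Y' : Ob k} (f : X ⟶ Y) (g : X' ⟶ Y') :
    (f ⊗ₘ g) ≫ mk (Term.sym Y.len Y'.len) = mk (Term.sym X.len X'.len) ≫ (g ⊗ₘ f) := by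
  obtain ⟨c, rfl⟩ := mk_surj f
  obtain ⟨d, rfl⟩ := mk_surj g
  exact mk_ssm (.sym_natural c d)

/-- The law `sym_add` is the hexagon identity once its casts are written with `eqToHom`. -/
theorem sym_hexagon_aux (n m l : ℕ) :
    eqToHom (congrArg (Ob.mk (k := k)) (Nat.add_assoc n m l)) ≫ mk (Term.sym n (m + l)) ≫
        eqToHom (congrArg (Ob.mk (k := k)) (Nat.add_assoc m l n)) =
      mk (Term.sym n m ⊞ Term.id l) ≫
        eqToHom (congrArg (Ob.mk (k := k)) (Nat.add_assoc m n l)) ≫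
          mk (Term.id m ⊞ Term.sym n l) := by
  have h := mk_ssm (k := k) (.sym_add n m l)
  rw [mk_seq, mk_cast, mk_cast] at h
  rw [h]
  simp only [Category.assoc, eqToHom_refl, Category.id_comp, eqToHom_trans, eqToHom_trans_assoc,
    Category.comp_id]

/-- The symmetry as an isomorphism. -/
def symIso (X Y : Ob k) : X ⊗ Y ≅ Y ⊗ X where
  hom := mk (Term.sym X.len Y.len)
  inv := mk (Term.sym Y.len X.len)
  hom_inv_id := mk_ssm (.sym_sym X.len Y.len)
  inv_hom_id := mk_ssm (.sym_sym Y.len X.len)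

theorem sym_hexagon (X Y Z : Ob k) :
    (α_ X Y Z).hom ≫ (symIso X (Y ⊗ Z)).hom ≫ (α_ Y Z X).hom =
      (symIso X Y).hom ▷ Z ≫ (α_ Y X Z).hom ≫ Y ◁ (symIso X Z).hom :=
  sym_hexagon_aux X.len Y.len Z.len

theorem symIso_inv (X Y : Ob k) : (symIso X Y).inv = (symIso Y X).hom := rfl

instance : SymmetricCategory (Ob k) where
  braiding := symIso
  braiding_naturality_right X _ _ f := sym_natural (𝟙 X) f
  braiding_naturality_left f Z := sym_natural f (𝟙 Z)
  hexagon_forward := sym_hexagon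
  hexagon_reverse X Y Z := by
    have h := congrArg Iso.inv (show (α_ Z X Y) ≪≫ symIso Z (X ⊗ Y) ≪≫ α_ X Y Z =
      whiskerRightIso (symIso Z X) Y ≪≫ α_ X Z Y ≪≫ whiskerLeftIso X (symIso Z Y) from
        Iso.ext (sym_hexagon Z X Y))
    simpa [symIso_inv] using h
  symmetry X Y := (symIso X Y).hom_inv_id

end category

end CircGeq

/-! ### Matrix circuits: every right circuit is a matrix -/

namespace CircGeq

section matrices

variable {k : Type u} [Field k] [LinearOrder k]

variable (k) in
/-- The object with one wire. -/
abbrev W : Ob k := ⟨1⟩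

def gcopy : W k ⟶ W k ⊗ W k := mk copy
def gdelete : W k ⟶ 𝟙_ (Ob k) := mk delete
def gscalar (a : k) : W k ⟶ W k := mk (scalar a)
def gadd : W k ⊗ W k ⟶ W k := mk add
def gzero : 𝟙_ (Ob k) ⟶ W k := mk zero
def gcocopy : W k ⊗ W k ⟶ W k := mk cocopy
def gcodelete : 𝟙_ (Ob k) ⟶ W k := mk codelete
def gcoscalar (a : k) : W k ⟶ W k := mk (coscalar a)
def gcoadd : W k ⟶ W k ⊗ W k := mk coadd
def gcozero : W k ⟶ 𝟙_ (Ob k) := mk cozero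
def ggeq : W k ⟶ W k := mk geq
def gleq : W k ⟶ W k := mk leq
def gcup : 𝟙_ (Ob k) ⟶ W k ⊗ W k := gcodelete ≫ gcopy
def gcap : W k ⊗ W k ⟶ 𝟙_ (Ob k) := gcocopy ≫ gdelete

theorem mk_ih {n m : ℕ} {c d : CircGeq k n m} (h : IHEquation c d) : mk c = mk d :=
  mk_eq.2 ⟨.ih (.eq h), .ih (.eq_symm h)⟩

theorem mk_ih_op {n m : ℕ} {c d : CircGeq k n m} (h : IHEquation c d) : mk (op c) = mk (op d) :=
  mk_eq.2 ⟨.ih_op (.eq h), .ih_op (.eq_symm h)⟩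

theorem mk_geq {n m : ℕ} {c d : CircGeq k n m} (h : GeqEquation c d) : mk c = mk d :=
  mk_eq.2 ⟨.geq_eq h, .geq_eq_symm h⟩

theorem gcopy_braid : gcopy (k := k) ≫ (β_ (W k) (W k)).hom = gcopy :=
  mk_ih (k := k) .copy_cocomm

theorem gcopy_counit : gcopy (k := k) ≫ gdelete ▷ W k = (λ_ (W k)).inv :=
  mk_ih (k := k) .copy_counit

/-- Only one counit law is an axiom; the other follows from cocommutativity. -/
instance comonW : ComonObj (W k) where
  counit := gdelete
  comul := gcopy
  counit_comul := gcopy_counit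
  comul_counit := by
    rw [← gcopy_braid, Category.assoc, ← BraidedCategory.braiding_naturality_left,
      reassoc_of% gcopy_counit]
    simp
  comul_assoc := by
    rw [← Category.assoc]
    exact (mk_ih (k := k) .copy_coassoc).symm.trans (Category.comp_id _).symm

instance : IsCommComonObj (W k) where
  comul_comm := gcopy_braid

attribute [local instance] ComonObj.instTensorUnit

/-- The comonoid structure on any number of wires. -/
def comon : ∀ n : ℕ, ComonObj (⟨n⟩ : Ob k)
  | 0 => inferInstanceAs (ComonObj (𝟙_ (Ob k)))
  | n + 1 =>
    letI := comon n
    inferInstanceAs (ComonObj ((⟨n⟩ : Ob k) ⊗ W k))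

theorem comon_comm : ∀ n : ℕ, @IsCommComonObj (Ob k) _ _ _ ⟨n⟩ (comon n)
  | 0 => inferInstanceAs (IsCommComonObj (𝟙_ (Ob k)))
  | n + 1 =>
    letI := comon (k := k) n
    haveI := comon_comm n
    inferInstanceAs (IsCommComonObj ((⟨n⟩ : Ob k) ⊗ W k))

/-- Copying a bundle of wires. -/
def dup (X : Ob k) : X ⟶ X ⊗ X := (comon X.len).comul

/-- Deleting a bundle of wires. -/
def del (X : Ob k) : X ⟶ 𝟙_ (Ob k) := (comon X.len).counit

theorem dup_unit : dup (𝟙_ (Ob k)) = (λ_ _).inv := rfl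

theorem del_succ (X : Ob k) : del (X ⊗ W k) = (del X ⊗ₘ gdelete) ≫ (λ_ _).hom := rfl

theorem dup_succ (X : Ob k) : dup (X ⊗ W k) = (dup X ⊗ₘ gcopy) ≫ tensorμ X X (W k) (W k) :=
  letI := comon (k := k) X.len
  Comon.tensorObj_comul X (W k)

theorem dup_braid (X : Ob k) : dup X ≫ (β_ X X).hom = dup X :=
  letI := comon (k := k) X.len
  haveI := comon_comm (k := k) X.len
  IsCommComonObj.comul_comm X

theorem dup_assoc (X : Ob k) : dup X ≫ X ◁ dup X = dup X ≫ dup X ▷ X ≫ (α_ X X X).hom :=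
  letI := comon (k := k) X.len
  ComonObj.comul_assoc X

theorem dup_del (X : Ob k) : dup X ≫ X ◁ del X = (ρ_ X).inv :=
  letI := comon (k := k) X.len
  ComonObj.comul_counit X

theorem del_dup (X : Ob k) : dup X ≫ del X ▷ X = (λ_ X).inv :=
  letI := comon (k := k) X.len
  ComonObj.counit_comul X

/-- The arrow with the given components. -/
def tuple {X : Ob k} : ∀ {n : ℕ}, (Fin n → (X ⟶ W k)) → (X ⟶ ⟨n⟩)
  | 0, _ => del X
  | n + 1, r => (dup X ≫ (tuple (fun i : Fin n => r i.castSucc) ⊗ₘ r (Fin.last n)) :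
      X ⟶ (⟨n⟩ : Ob k) ⊗ W k)

/-- The linear form with the given coefficients. -/
def row : ∀ {n : ℕ}, (Fin n → k) → ((⟨n⟩ : Ob k) ⟶ W k)
  | 0, _ => gzero
  | n + 1, v => ((row (fun i : Fin n => v i.castSucc) ⊗ₘ gscalar (v (Fin.last n))) ≫ gadd :
      (⟨n⟩ : Ob k) ⊗ W k ⟶ W k)

theorem tuple_zero {X : Ob k} (r : Fin 0 → (X ⟶ W k)) : tuple r = del X := rfl

theorem tuple_succ {X : Ob k} {n : ℕ} (r : Fin (n + 1) → (X ⟶ W k)) :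
    tuple r = (dup X ≫ (tuple (fun i : Fin n => r i.castSucc) ⊗ₘ r (Fin.last n)) :
      X ⟶ (⟨n⟩ : Ob k) ⊗ W k) := rfl

theorem row_succ {n : ℕ} (v : Fin (n + 1) → k) :
    row v = ((row (fun i : Fin n => v i.castSucc) ⊗ₘ gscalar (v (Fin.last n))) ≫ gadd :
      (⟨n⟩ : Ob k) ⊗ W k ⟶ W k) := rfl

theorem comp_dup_tensor {X A B C : Ob k} (f : X ⟶ A) (g : X ⟶ B) (h : X ⟶ C) :
    dup X ≫ (f ⊗ₘ (dup X ≫ (g ⊗ₘ h))) =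
      dup X ≫ ((dup X ≫ (f ⊗ₘ g)) ⊗ₘ h) ≫ (α_ A B C).hom := by
  have h1 : (f ⊗ₘ (dup X ≫ (g ⊗ₘ h))) = X ◁ dup X ≫ (f ⊗ₘ (g ⊗ₘ h)) := by
    rw [← id_tensorHom, tensorHom_comp_tensorHom, Category.id_comp]
  have h2 : ((dup X ≫ (f ⊗ₘ g)) ⊗ₘ h) = dup X ▷ X ≫ ((f ⊗ₘ g) ⊗ₘ h) := by
    rw [← tensorHom_id, tensorHom_comp_tensorHom, Category.id_comp]
  rw [h1, h2, reassoc_of% dup_assoc X, Category.assoc, associator_naturality]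

theorem dup_tensor_del {X A : Ob k} (f : X ⟶ A) :
    dup X ≫ (f ⊗ₘ del X) = f ≫ (ρ_ A).inv := by
  rw [tensorHom_def', reassoc_of% dup_del X, rightUnitor_inv_naturality]

theorem del_tensor_dup {X A : Ob k} (f : X ⟶ A) :
    dup X ≫ (del X ⊗ₘ f) = f ≫ (λ_ A).inv := by
  rw [MonoidalCategory.tensorHom_def, reassoc_of% del_dup X, leftUnitor_inv_naturality]

theorem tuple_append {X : Ob k} {n m : ℕ} (r : Fin n → (X ⟶ W k)) (s : Fin m → (X ⟶ W k)) :
    dup X ≫ (tuple r ⊗ₘ tuple s) = (tuple (Fin.append r s) : X ⟶ (⟨n + m⟩ : Ob k)) := by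
  induction m with
  | zero =>
    rw [tuple_zero, dup_tensor_del]
    refine (Category.comp_id _).trans ?_
    congr
    funext i
    exact (Fin.append_left r s i).symm
  | succ m ih =>
    rw [tuple_succ s, comp_dup_tensor, ih, ← Category.assoc]
    refine (Category.comp_id _).trans ?_
    have h := tuple_succ (n := n + m) (Fin.append r s : Fin (n + (m + 1)) → (X ⟶ W k))
    refine Eq.trans ?_ h.symm
    congr 2
    · congr 1
      funext i
      refine Fin.addCases (fun i => ?_) (fun i => ?_) i
      · rw [Fin.append_left]
        exact (Fin.append_left r s i).symm
      · rw [Fin.append_right]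
        exact (Fin.append_right r s i.castSucc).symm
    · exact (Fin.append_right r s (Fin.last m)).symm

/-- Copying the sum of two bundles. -/
theorem dup_succ_tensor {X A B C D : Ob k} (f : X ⟶ A) (g : W k ⟶ B) (f' : X ⟶ C)
    (g' : W k ⟶ D) :
    dup (X ⊗ W k) ≫ ((f ⊗ₘ g) ⊗ₘ (f' ⊗ₘ g')) =
      ((dup X ≫ (f ⊗ₘ f')) ⊗ₘ (gcopy ≫ (g ⊗ₘ g'))) ≫ tensorμ A C B D := by
  rw [dup_succ, Category.assoc, ← tensorμ_natural, ← Category.assoc, tensorHom_comp_tensorHom]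

theorem gscalar_copy (a : k) : gscalar a ≫ gcopy = gcopy ≫ (gscalar a ⊗ₘ gscalar a) :=
  mk_ih (.scalar_copy a)

theorem gscalar_delete (a : k) : gscalar a ≫ gdelete = gdelete :=
  mk_ih (.scalar_delete a)

theorem gzero_scalar (a : k) : gzero ≫ gscalar a = gzero :=
  mk_ih (.scalar_zero a)

theorem gadd_scalar (a : k) : gadd ≫ gscalar a = (gscalar a ⊗ₘ gscalar a) ≫ gadd :=
  mk_ih (.scalar_add a)

theorem gscalar_gscalar (a b : k) : gscalar a ≫ gscalar b = gscalar (a * b) :=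
  mk_ih (.mul_scalar a b)

theorem gcopy_scalar_add (a b : k) : gcopy ≫ (gscalar a ⊗ₘ gscalar b) ≫ gadd = gscalar (a + b) := by
  rw [← Category.assoc]
  exact mk_ih (.add_scalar a b)

theorem gscalar_zero : gscalar (0 : k) = gdelete ≫ gzero := mk_ih .zero_scalar

theorem gadd_delete : gadd (k := k) ≫ gdelete = (gdelete ⊗ₘ gdelete) ≫ (λ_ _).hom :=
  (mk_ih .add_delete).trans (Category.comp_id _).symm

theorem gzero_delete : gzero (k := k) ≫ gdelete = 𝟙 _ := mk_ih .zero_delete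

theorem gzero_copy : gzero (k := k) ≫ gcopy = (λ_ _).inv ≫ (gzero ⊗ₘ gzero) :=
  (mk_ih .zero_copy).trans (Category.id_comp _).symm

theorem gzero_add : gzero (k := k) ▷ W k ≫ gadd = (λ_ _).hom := mk_ih .zero_add

theorem braid_gadd : (β_ (W k) (W k)).hom ≫ gadd = gadd := mk_ih .add_comm

theorem add_gzero : W k ◁ gzero (k := k) ≫ gadd = (ρ_ _).hom := by
  rw [← braid_gadd, BraidedCategory.braiding_naturality_right_assoc, gzero_add]
  simp

theorem gadd_assoc : gadd ▷ W k ≫ gadd = (α_ (W k) (W k) (W k)).hom ≫ W k ◁ gadd ≫ gadd :=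
  (mk_ih .add_assoc).trans (Category.id_comp _).symm

/-- On single wires the associators inside `tensorμ` are identities by computation, so only the
middle crossing remains, in the shape used by the bimonoid and spider axioms. -/
theorem tensorμ_W : tensorμ (W k) (W k) (W k) (W k) =
    (W k ◁ (β_ (W k) (W k)).hom ▷ W k : (W k ⊗ W k) ⊗ (W k ⊗ W k) ⟶ (W k ⊗ W k) ⊗ (W k ⊗ W k)) := by
  have e1 : W k ◁ (α_ (W k) (W k) (W k)).inv = 𝟙 (W k ⊗ (W k ⊗ (W k ⊗ W k))) :=
    (whiskerLeft_id _ _)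
  have e2 : W k ◁ (α_ (W k) (W k) (W k)).hom = 𝟙 (W k ⊗ ((W k ⊗ W k) ⊗ W k)) :=
    (whiskerLeft_id _ _)
  unfold tensorμ
  rw [e1, e2]
  refine (Category.id_comp _).trans ((Category.id_comp _).trans ?_)
  rw [Category.id_comp]
  exact Category.comp_id _

theorem gadd_copy : gadd (k := k) ≫ gcopy =
    (gcopy ⊗ₘ gcopy) ≫ tensorμ (W k) (W k) (W k) (W k) ≫ (gadd ⊗ₘ gadd) := by
  have h := mk_ih (k := k) .bimonoid
  refine h.trans ?_
  rw [tensorμ_W]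
  exact Category.assoc (gcopy ⊗ₘ gcopy : W k ⊗ W k ⟶ (W k ⊗ W k) ⊗ (W k ⊗ W k))
    (W k ◁ (β_ (W k) (W k)).hom ▷ W k :
      (W k ⊗ W k) ⊗ (W k ⊗ W k) ⟶ (W k ⊗ W k) ⊗ (W k ⊗ W k))
    (gadd ⊗ₘ gadd : (W k ⊗ W k) ⊗ (W k ⊗ W k) ⟶ W k ⊗ W k)

/-- `scalar 1` is idempotent and has a one-sided inverse, hence it is the identity. -/
theorem gscalar_one : gscalar (1 : k) = 𝟙 _ := by
  have h := mk_ih (.scalar_coscalar (1 : k) one_ne_zero)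
  have h1 : gscalar (1 : k) ≫ gscalar (1 : k) = gscalar 1 := by simp [gscalar_gscalar]
  have h2 : gscalar (1 : k) ≫ gcoscalar 1 = 𝟙 _ := h
  calc gscalar (1 : k) = gscalar 1 ≫ 𝟙 _ := (Category.comp_id _).symm
    _ = (gscalar 1 ≫ gscalar 1) ≫ gcoscalar 1 := by rw [Category.assoc, h2]
    _ = 𝟙 _ := by rw [h1, h2]

instance : MonObj (W k) where
  one := gzero
  mul := gadd
  one_mul := gzero_add
  mul_one := add_gzero
  mul_assoc := gadd_assoc

instance : IsCommMonObj (W k) where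
  mul_comm := braid_gadd

theorem tensorμ_gadd : tensorμ (W k) (W k) (W k) (W k) ≫ (gadd ⊗ₘ gadd) ≫ gadd =
    (gadd ⊗ₘ gadd) ≫ gadd :=
  MonObj.mul_mul_mul_comm (M := W k)

theorem row_add {n : ℕ} (u v : Fin n → k) :
    dup ⟨n⟩ ≫ (row u ⊗ₘ row v) ≫ gadd = row (u + v) := by
  induction n with
  | zero =>
    change dup (𝟙_ (Ob k)) ≫ (gzero ⊗ₘ gzero) ≫ gadd = gzero
    rw [dup_unit, MonoidalCategory.tensorHom_def', Category.assoc, gzero_add]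
    simp
  | succ n ih =>
    rw [row_succ u, row_succ v, row_succ (u + v)]
    change dup ((⟨n⟩ : Ob k) ⊗ W k) ≫ _ = _
    rw [← tensorHom_comp_tensorHom, Category.assoc, reassoc_of% dup_succ_tensor, tensorμ_gadd,
      tensorHom_comp_tensorHom_assoc, Category.assoc, Category.assoc, ih, gcopy_scalar_add]
    rfl

theorem row_scalar {n : ℕ} (u : Fin n → k) (a : k) : row u ≫ gscalar a = row (a • u) := by
  induction n with
  | zero => exact gzero_scalar a
  | succ n ih =>
    rw [row_succ u, row_succ (a • u), Category.assoc, gadd_scalar, tensorHom_comp_tensorHom_assoc,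
      ih, gscalar_gscalar]
    congr 3
    exact mul_comm _ _

/-- Induction with the bimonoid law. Linear forms are natural for copying, as they are for deleting,
which makes matrices compose like tuples. -/
theorem row_copy {n : ℕ} (u : Fin n → k) :
    row u ≫ gcopy = dup (⟨n⟩ : Ob k) ≫ (row u ⊗ₘ row u) := by
  induction n with
  | zero => exact gzero_copy (k := k)
  | succ n ih =>
    rw [row_succ u]
    change _ = dup ((⟨n⟩ : Ob k) ⊗ W k) ≫ _
    rw [← tensorHom_comp_tensorHom, Category.assoc, gadd_copy, reassoc_of% dup_succ_tensor,
      ← gscalar_copy, ← ih, tensorHom_comp_tensorHom_assoc]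

theorem row_delete {n : ℕ} (u : Fin n → k) : row u ≫ gdelete = del (⟨n⟩ : Ob k) := by
  induction n with
  | zero => exact gzero_delete
  | succ n ih =>
    rw [row_succ u]
    change _ = del ((⟨n⟩ : Ob k) ⊗ W k)
    rw [Category.assoc, gadd_delete, tensorHom_comp_tensorHom_assoc, ih, gscalar_delete, del_succ]

theorem row_zero (n : ℕ) : row (0 : Fin n → k) = del ⟨n⟩ ≫ gzero := by
  induction n with
  | zero => exact (Category.id_comp _).symm
  | succ n ih =>
    change _ = del ((⟨n⟩ : Ob k) ⊗ W k) ≫ _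
    have h : row (fun i : Fin n => (0 : Fin (n + 1) → k) i.castSucc) = del ⟨n⟩ ≫ gzero := ih
    rw [row_succ, h, del_succ]
    change ((_ ≫ _) ⊗ₘ gscalar 0) ≫ _ = _
    rw [gscalar_zero, ← tensorHom_comp_tensorHom, Category.assoc, MonoidalCategory.tensorHom_def'
      gzero gzero, Category.assoc, gzero_add, Category.assoc, leftUnitor_naturality]

theorem row_snoc_zero {n : ℕ} (v : Fin (n + 1) → k) (h : v (Fin.last n) = 0) :
    row v = ((row (fun i : Fin n => v i.castSucc) ⊗ₘ gdelete) ≫ (ρ_ _).hom :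
      (⟨n⟩ : Ob k) ⊗ W k ⟶ W k) := by
  have e : (row (fun i : Fin n => v i.castSucc) ⊗ₘ gdelete ≫ gzero) =
      (row (fun i : Fin n => v i.castSucc) ⊗ₘ gdelete) ≫ W k ◁ gzero := by
    rw [← id_tensorHom, tensorHom_comp_tensorHom, Category.comp_id]
  rw [row_succ, h, gscalar_zero, e, Category.assoc, add_gzero]

theorem row_snoc_one {n : ℕ} (v : Fin (n + 1) → k) (h : v (Fin.last n) = 1)
    (h0 : (fun i : Fin n => v i.castSucc) = 0) :
    row v = ((del ⟨n⟩ ⊗ₘ 𝟙 (W k)) ≫ (λ_ _).hom : (⟨n⟩ : Ob k) ⊗ W k ⟶ W k) := by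
  have e : (del (⟨n⟩ : Ob k) ≫ gzero ⊗ₘ 𝟙 (W k)) = (del ⟨n⟩ ⊗ₘ 𝟙 (W k)) ≫ gzero ▷ W k := by
    rw [← tensorHom_id gzero, tensorHom_comp_tensorHom, Category.comp_id]
  rw [row_succ, h, h0, row_zero, gscalar_one, e, Category.assoc, gzero_add]

/-- The arrow denoted by a matrix. -/
def mat {n p : ℕ} (A : Fin p → Fin n → k) : (⟨n⟩ : Ob k) ⟶ ⟨p⟩ :=
  tuple fun i => row (A i)

theorem tuple_tensor_delete {X : Ob k} {n : ℕ} (r : Fin n → (X ⟶ W k)) :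
    tuple (fun i => (r i ⊗ₘ gdelete) ≫ (ρ_ (W k)).hom) =
      (tuple r ⊗ₘ gdelete) ≫ (ρ_ (⟨n⟩ : Ob k)).hom := by
  induction n with
  | zero => 
    change del (X ⊗ W k) = (del X ⊗ₘ gdelete) ≫ (ρ_ (𝟙_ (Ob k))).hom
    rw [del_succ, unitors_equal]
  | succ n ih =>
    have e : gcopy (k := k) ≫ (gdelete ⊗ₘ gdelete) = gdelete ≫ (λ_ (𝟙_ (Ob k))).inv := by
      rw [MonoidalCategory.tensorHom_def, reassoc_of% gcopy_counit, leftUnitor_inv_naturality]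
    rw [tuple_succ, ih, tuple_succ, ← tensorHom_comp_tensorHom, reassoc_of% dup_succ_tensor, e]
    have e' : ((dup X ≫ (tuple (fun i : Fin n => r i.castSucc) ⊗ₘ r (Fin.last n))) ⊗ₘ
        gdelete ≫ (λ_ (𝟙_ (Ob k))).inv) =
        ((dup X ≫ (tuple (fun i : Fin n => r i.castSucc) ⊗ₘ r (Fin.last n))) ⊗ₘ gdelete) ≫
          ((⟨n⟩ : Ob k) ⊗ W k) ◁ (λ_ (𝟙_ (Ob k))).inv := by
      rw [← id_tensorHom, tensorHom_comp_tensorHom, Category.comp_id]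
    rw [e', Category.assoc, ← tensor_right_unitality]
    rfl

/-- The coordinate forms are projections because `scalar 0` deletes its input and emits `zero`; the
counit laws then assemble the projections into the identity. -/
theorem mat_one (n : ℕ) : mat (fun i : Fin n => (Pi.single i 1 : Fin n → k)) = 𝟙 _ := by
  induction n with
  | zero => rfl
  | succ n ih =>
    have h1 : (tuple fun i : Fin n => row (Pi.single i.castSucc 1 : Fin (n + 1) → k)) =
        ((𝟙 (⟨n⟩ : Ob k) ⊗ₘ gdelete) ≫ (ρ_ (⟨n⟩ : Ob k)).hom :
          (⟨n⟩ : Ob k) ⊗ W k ⟶ ⟨n⟩) := by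
      rw [← ih, mat, ← tuple_tensor_delete]
      congr
      funext i
      rw [row_snoc_zero _ (by simp [Fin.ext_iff, i.2.ne'])]
      congr
      funext j
      simp [Pi.single_apply, Fin.ext_iff]
    have h2 := row_snoc_one (Pi.single (Fin.last n) 1 : Fin (n + 1) → k) (by simp)
      (by funext j; simp [Fin.ext_iff, j.2.ne])
    rw [mat, tuple_succ, h1, h2]
    change dup ((⟨n⟩ : Ob k) ⊗ W k) ≫ _ = 𝟙 ((⟨n⟩ : Ob k) ⊗ W k)
    have e : gcopy (k := k) ≫ (gdelete ⊗ₘ 𝟙 (W k)) = (λ_ (W k)).inv := by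
      rw [tensorHom_id, gcopy_counit]
    rw [← tensorHom_comp_tensorHom, reassoc_of% dup_succ_tensor, e, dup_tensor_del,
      Category.id_comp]
    rw [tensorμ, braiding_tensorUnit_left]
    monoidal

section eval

variable {V : Type*} [AddCommGroup V] [Module k V]

/-- The linear map denoted by a generator of matrix circuits. -/
def genEval : ∀ {n m : ℕ}, RightGen k n m → (Fin n → V) → Fin m → V
  | _, _, .copy, v => ![v 0, v 0]
  | _, _, .delete, _ => ![]
  | _, _, .scalar a, v => ![a • v 0]
  | _, _, .add, v => ![v 0 + v 1]
  | _, _, .zero, _ => ![0]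

/-- The linear map denoted by a matrix circuit. -/
def eval : ∀ {n m : ℕ}, CircRight k n m → (Fin n → V) → Fin m → V
  | _, _, .gen g, v => genEval g v
  | _, _, .id _, v => v
  | _, _, .sym n m, v => Fin.append (fun i : Fin m => v (Fin.natAdd n i))
      (fun i : Fin n => v (Fin.castAdd m i))
  | _, _, .seq c d, v => eval d (eval c v)
  | _, _, .tensor (n := n) (n' := n') c d, v =>
      Fin.append (eval c fun i => v (Fin.castAdd n' i)) (eval d fun i => v (Fin.natAdd n i))

end eval

theorem mat_succ {n p : ℕ} (A : Fin (p + 1) → Fin n → k) :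
    mat A = (dup ⟨n⟩ ≫ (mat (fun i : Fin p => A i.castSucc) ⊗ₘ row (A (Fin.last p))) :
      (⟨n⟩ : Ob k) ⟶ (⟨p⟩ : Ob k) ⊗ W k) := rfl

theorem mat_append {n p q : ℕ} (A : Fin p → Fin n → k) (B : Fin q → Fin n → k) :
    dup ⟨n⟩ ≫ (mat A ⊗ₘ mat B) =
      (mat (Fin.append A B : Fin (p + q) → Fin n → k) : (⟨n⟩ : Ob k) ⟶ ⟨p + q⟩) := by
  unfold mat
  rw [tuple_append]
  congr
  funext i
  refine Fin.addCases (fun i => ?_) (fun i => ?_) i <;> simp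

theorem mat_fin_one {n : ℕ} (A : Fin 1 → Fin n → k) : mat A = row (A 0) := by
  rw [mat_succ]
  refine (del_tensor_dup (row (A 0))).trans ?_
  exact Category.comp_id _

theorem mat_fin_two {n : ℕ} (A : Fin 2 → Fin n → k) :
    mat A = (dup ⟨n⟩ ≫ (row (A 0) ⊗ₘ row (A 1)) : (⟨n⟩ : Ob k) ⟶ W k ⊗ W k) := by
  rw [mat_succ, mat_fin_one]
  rfl

theorem append_castAdd_natAdd {α : Type*} {p q : ℕ} (v : Fin (p + q) → α) :
    Fin.append (fun i => v (Fin.castAdd q i)) (fun i => v (Fin.natAdd p i)) = v := by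
  funext i
  refine Fin.addCases (fun i => ?_) (fun i => ?_) i <;> simp

/-- A generator acts on a tuple of linear forms by operating on their coefficient rows. Hence `eval`
is taken with values in the space of rows. -/
theorem mat_gen {N n m : ℕ} (g : RightGen k n m) (v : Fin n → Fin N → k) :
    mat v ≫ mk (CircRight.incl (.gen g)) = mat (genEval (V := Fin N → k) g v) := by
  cases g with
  | copy =>
    rw [mat_fin_one, mat_fin_two]
    exact row_copy (v 0)
  | delete =>
    rw [mat_fin_one]
    exact row_delete (v 0)
  | scalar a =>
    rw [mat_fin_one, mat_fin_one]
    exact row_scalar (v 0) a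
  | add =>
    rw [mat_fin_two, mat_fin_one]
    exact (Category.assoc _ _ _).trans (row_add (v 0) (v 1))
  | zero =>
    rw [mat_fin_one]
    exact (row_zero N).symm

theorem mat_comp_incl {N n m : ℕ} (c : CircRight k n m) (v : Fin n → Fin N → k) :
    mat v ≫ mk c.incl = mat (eval (V := Fin N → k) c v) := by
  induction c with
  | gen g => exact mat_gen g v
  | id n => exact Category.comp_id _
  | sym n m =>
    have e := mat_append (fun i : Fin n => v (Fin.castAdd m i)) (fun i => v (Fin.natAdd n i))
    rw [append_castAdd_natAdd] at e
    refine (congrArg (· ≫ _) e.symm).trans ?_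
    refine Eq.trans ?_ (mat_append _ _)
    have h := BraidedCategory.braiding_naturality (mat fun i : Fin n => v (Fin.castAdd m i))
      (mat fun i : Fin m => v (Fin.natAdd n i))
    refine (Category.assoc _ _ _).trans ((congrArg (dup ⟨N⟩ ≫ ·) h).trans ?_)
    rw [reassoc_of% dup_braid]
  | seq c d ihc ihd =>
    exact (Category.assoc _ _ _).symm.trans ((congrArg (· ≫ _) (ihc v)).trans (ihd _))
  | @tensor n m n' m' c d ihc ihd =>
    have e := mat_append (fun i : Fin n => v (Fin.castAdd n' i)) (fun i => v (Fin.natAdd n i))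
    rw [append_castAdd_natAdd] at e
    refine (congrArg (· ≫ _) e.symm).trans ?_
    refine Eq.trans ?_ (mat_append _ _)
    refine (Category.assoc _ _ _).trans (congrArg (dup ⟨N⟩ ≫ ·) ?_)
    rw [← ihc, ← ihd]
    exact tensorHom_comp_tensorHom (mat fun i : Fin n => v (Fin.castAdd n' i))
      (mat fun i : Fin n' => v (Fin.natAdd n i)) (mk (CircRight.incl c)) (mk (CircRight.incl d))

/-- The coordinate forms tuple to the identity, so a right circuit is determined by its action on
them. -/
theorem mk_incl_eq_mat {n m : ℕ} (c : CircRight k n m) :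
    mk c.incl = mat (eval c fun i : Fin n => (Pi.single i 1 : Fin n → k)) := by
  rw [← mat_comp_incl, mat_one, Category.id_comp]

/-- The arrow is denoted by a matrix circuit. -/
def IsRight {X Y : Ob k} (f : X ⟶ Y) : Prop :=
  ∃ c : CircRight k X.len Y.len, mk c.incl = f

theorem isRight_eqToHom {X Y : Ob k} (h : X = Y) : IsRight (eqToHom h) := by
  subst h
  exact ⟨.id _, rfl⟩

theorem IsRight.comp {X Y Z : Ob k} {f : X ⟶ Y} {g : Y ⟶ Z} (hf : IsRight f) (hg : IsRight g) :
    IsRight (f ≫ g) := by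
  obtain ⟨c, rfl⟩ := hf
  obtain ⟨d, rfl⟩ := hg
  exact ⟨.seq c d, rfl⟩

theorem IsRight.tensor {X Y X' Y' : Ob k} {f : X ⟶ Y} {g : X' ⟶ Y'} (hf : IsRight f)
    (hg : IsRight g) : IsRight (f ⊗ₘ g) := by
  obtain ⟨c, rfl⟩ := hf
  obtain ⟨d, rfl⟩ := hg
  exact ⟨.tensor c d, rfl⟩

theorem isRight_id (X : Ob k) : IsRight (𝟙 X) := ⟨.id _, rfl⟩

theorem isRight_braid (X Y : Ob k) : IsRight (β_ X Y).hom := ⟨.sym _ _, rfl⟩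

theorem IsRight.whiskerLeft (X : Ob k) {Y Y' : Ob k} {f : Y ⟶ Y'} (hf : IsRight f) :
    IsRight (X ◁ f) := by
  simpa using (isRight_id X).tensor hf

theorem IsRight.whiskerRight (X : Ob k) {Y Y' : Ob k} {f : Y ⟶ Y'} (hf : IsRight f) :
    IsRight (f ▷ X) := by
  simpa using hf.tensor (isRight_id X)

theorem isRight_assoc (X Y Z : Ob k) : IsRight (α_ X Y Z).hom :=
  isRight_eqToHom (tensor_assoc_eq X Y Z)

theorem isRight_assoc_inv (X Y Z : Ob k) : IsRight (α_ X Y Z).inv :=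
  isRight_eqToHom (tensor_assoc_eq X Y Z).symm

theorem isRight_leftUnitor (X : Ob k) : IsRight (λ_ X).hom :=
  isRight_eqToHom (unit_tensor_eq X)

theorem isRight_tensorμ (X Y X' Y' : Ob k) : IsRight (tensorμ X Y X' Y') :=
  (isRight_assoc _ _ _).comp (((isRight_assoc_inv _ _ _).whiskerLeft _).comp
    ((((isRight_braid _ _).whiskerRight _).whiskerLeft _).comp
      (((isRight_assoc _ _ _).whiskerLeft _).comp (isRight_assoc_inv _ _ _))))

theorem isRight_dup_del (n : ℕ) : IsRight (dup (⟨n⟩ : Ob k)) ∧ IsRight (del (⟨n⟩ : Ob k)) := by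
  induction n with
  | zero => exact ⟨⟨.id 0, rfl⟩, ⟨.id 0, rfl⟩⟩
  | succ n ih =>
    have h1 : IsRight (gcopy (k := k)) := ⟨.gen .copy, rfl⟩
    have h2 : IsRight (gdelete (k := k)) := ⟨.gen .delete, rfl⟩
    constructor
    · change IsRight (dup ((⟨n⟩ : Ob k) ⊗ W k))
      rw [dup_succ]
      exact (ih.1.tensor h1).comp (isRight_tensorμ _ _ _ _)
    · exact (ih.2.tensor h2).comp (isRight_leftUnitor _)

theorem isRight_row {n : ℕ} (v : Fin n → k) : IsRight (row v) := by
  induction n with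
  | zero => exact ⟨.gen .zero, rfl⟩
  | succ n ih =>
    exact ((ih fun i => v i.castSucc).tensor ⟨.gen (.scalar (v (Fin.last n))), rfl⟩).comp
      (Z := W k) ⟨.gen .add, rfl⟩

theorem isRight_mat {n p : ℕ} (A : Fin p → Fin n → k) : IsRight (mat A) := by
  induction p with
  | zero => exact (isRight_dup_del n).2
  | succ p ih =>
    rw [mat_succ]
    exact (isRight_dup_del n).1.comp ((ih _).tensor (isRight_row _))

theorem mat_comp_row {n p : ℕ} (A : Fin p → Fin n → k) (b : Fin p → k) :
    mat A ≫ row b = row (∑ j, b j • A j) := by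
  induction p with
  | zero => exact (row_zero n).symm.trans (congrArg row (Fin.sum_univ_zero _).symm)
  | succ p ih =>
    rw [mat_succ, row_succ]
    refine (Category.assoc _ _ _).trans ?_
    rw [tensorHom_comp_tensorHom_assoc, ih, row_scalar, row_add, Fin.sum_univ_castSucc]

theorem dup_dup_aux (X : Ob k) :
    dup X ≫ (dup X ⊗ₘ dup X) ≫ (α_ X X (X ⊗ X)).hom ≫ X ◁ (α_ X X X).inv =
      dup X ≫ X ◁ (dup X ≫ dup X ▷ X) := by
  have h : dup X ≫ X ◁ dup X ≫ (α_ X X X).inv = dup X ≫ dup X ▷ X := by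
    rw [reassoc_of% dup_assoc X, Iso.hom_inv_id, Category.comp_id]
  rw [MonoidalCategory.tensorHom_def, Category.assoc, associator_naturality_right_assoc,
    ← Category.assoc (dup X ▷ X), ← Category.assoc (dup X), ← dup_assoc, Category.assoc,
    ← whiskerLeft_comp, ← whiskerLeft_comp, h]

/-- Coassociativity brings the two middle wires out of a single copy, where cocommutativity absorbs
their crossing. -/
theorem dup_dup (X : Ob k) :
    dup X ≫ (dup X ⊗ₘ dup X) ≫ tensorμ X X X X = dup X ≫ (dup X ⊗ₘ dup X) := by
  have h := dup_dup_aux X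
  have h' : (dup X ≫ dup X ▷ X) ≫ (β_ X X).hom ▷ X = dup X ≫ dup X ▷ X := by
    rw [Category.assoc, ← comp_whiskerRight, dup_braid]
  have h2 : dup X ≫ (dup X ⊗ₘ dup X) ≫ (α_ X X (X ⊗ X)).hom ≫ X ◁ (α_ X X X).inv ≫
      X ◁ (β_ X X).hom ▷ X =
      dup X ≫ (dup X ⊗ₘ dup X) ≫ (α_ X X (X ⊗ X)).hom ≫ X ◁ (α_ X X X).inv := by
    rw [reassoc_of% h, h, ← whiskerLeft_comp, h']
  unfold tensorμ
  rw [reassoc_of% h2]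
  simp

theorem mat_comp_dup {n p : ℕ} (A : Fin p → Fin n → k) :
    mat A ≫ dup ⟨p⟩ = dup ⟨n⟩ ≫ (mat A ⊗ₘ mat A) := by
  induction p with
  | zero =>
    change del _ ≫ dup (𝟙_ (Ob k)) = dup ⟨n⟩ ≫ (del ⟨n⟩ ⊗ₘ del ⟨n⟩)
    rw [dup_tensor_del, dup_unit, unitors_inv_equal]
  | succ p ih =>
    rw [mat_succ]
    change _ ≫ dup ((⟨p⟩ : Ob k) ⊗ W k) = _
    rw [dup_succ, Category.assoc, tensorHom_comp_tensorHom_assoc, ih, row_copy,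
      ← tensorHom_comp_tensorHom, Category.assoc, tensorμ_natural, reassoc_of% dup_dup,
      tensorHom_comp_tensorHom]

theorem mat_comp_del {n p : ℕ} (A : Fin p → Fin n → k) : mat A ≫ del ⟨p⟩ = del ⟨n⟩ := by
  induction p with
  | zero => exact Category.comp_id _
  | succ p ih =>
    rw [mat_succ]
    change _ ≫ del ((⟨p⟩ : Ob k) ⊗ W k) = _
    rw [del_succ, Category.assoc, tensorHom_comp_tensorHom_assoc, ih, row_delete,
      ← Category.assoc, dup_tensor_del, Category.assoc, unitors_equal, Iso.inv_hom_id,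
      Category.comp_id]

theorem mat_comp_mat {n p q : ℕ} (A : Fin p → Fin n → k) (B : Fin q → Fin p → k) :
    mat A ≫ mat B = mat (fun i => ∑ j, B i j • A j) := by
  induction q with
  | zero => exact mat_comp_del A
  | succ q ih =>
    rw [mat_succ]
    refine (Category.assoc _ _ _).symm.trans ?_
    rw [mat_comp_dup, Category.assoc, tensorHom_comp_tensorHom, ih, mat_comp_row]
    rfl

/-- With the identity written as a pairing of two projections, products of matrices reduce to
composites and pairings. -/
theorem id_tensor_eq_dup (n m : ℕ) : 𝟙 ((⟨n⟩ : Ob k) ⊗ ⟨m⟩) = dup (⟨n + m⟩ : Ob k) ≫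
    (mat (fun i : Fin n => (Pi.single (Fin.castAdd m i) 1 : Fin (n + m) → k)) ⊗ₘ
      mat (fun i : Fin m => (Pi.single (Fin.natAdd n i) 1 : Fin (n + m) → k))) := by
  rw [mat_append]
  refine (mat_one (n + m)).symm.trans (congrArg mat ?_)
  funext i
  refine Fin.addCases (fun i => ?_) (fun i => ?_) i <;> simp

theorem sum_smul_single {p n : ℕ} (a : Fin n → k) (f : Fin n → Fin p) (hf : f.Injective)
    (i : Fin n) : (∑ j, a j • (Pi.single (f j) 1 : Fin p → k)) (f i) = a i := by
  simp [Finset.sum_apply, Pi.single_apply, hf.eq_iff]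

theorem sum_smul_single_of_ne {p n : ℕ} (a : Fin n → k) (f : Fin n → Fin p) (l : Fin p)
    (hl : ∀ i, f i ≠ l) : (∑ j, a j • (Pi.single (f j) 1 : Fin p → k)) l = 0 := by
  simp [Finset.sum_apply, fun i => (hl i).symm]

theorem mat_tensor_mat {n p n' p' : ℕ} (A : Fin p → Fin n → k) (B : Fin p' → Fin n' → k) :
    (mat A ⊗ₘ mat B : (⟨n⟩ : Ob k) ⊗ ⟨n'⟩ ⟶ ⟨p⟩ ⊗ ⟨p'⟩) =
      mat (n := n + n') (p := p + p') (Fin.append (fun i => Fin.append (A i) 0)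
        (fun i => Fin.append 0 (B i))) := by
  rw [← Category.id_comp (mat A ⊗ₘ mat B), id_tensor_eq_dup, Category.assoc,
    tensorHom_comp_tensorHom, mat_comp_mat, mat_comp_mat, mat_append]
  congr 2
  · funext i j
    refine Fin.addCases (fun j => ?_) (fun j => ?_) j
    · rw [sum_smul_single _ _ (Fin.castAdd_injective n n'), Fin.append_left]
    · rw [sum_smul_single_of_ne, Fin.append_right]
      · rfl
      · intro i
        simp [Fin.ext_iff]
        omega
  · funext i j
    refine Fin.addCases (fun j => ?_) (fun j => ?_) j
    · rw [sum_smul_single_of_ne, Fin.append_left]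
      · rfl
      · intro i
        simp [Fin.ext_iff]
        omega
    · rw [sum_smul_single _ _ (Fin.natAdd_injective n' n), Fin.append_right]

end matrices

end CircGeq

/-! ### Tests for zero and for nonnegativity -/

namespace CircGeq

section coherence

variable {C : Type*} [Category* C] [MonoidalCategory C]

theorem tensorμ_tensorUnit [SymmetricCategory C] :
    tensorμ (𝟙_ C) (𝟙_ C) (𝟙_ C) (𝟙_ C) = 𝟙 _ := by
  rw [tensorμ, braiding_tensorUnit_left]
  monoidal

theorem tensorHom_unit_assoc {X Y Z : C} (f : X ⟶ 𝟙_ C) (g : Y ⟶ 𝟙_ C) (h : Z ⟶ 𝟙_ C) :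
    (f ⊗ₘ (g ⊗ₘ h) ≫ (λ_ _).hom) ≫ (λ_ _).hom =
      (α_ X Y Z).inv ≫ ((f ⊗ₘ g) ≫ (λ_ _).hom ⊗ₘ h) ≫ (λ_ _).hom := by
  simp only [MonoidalCategory.tensorHom_def]
  monoidal

theorem tensor_states_cap {X : C} (f : 𝟙_ C ⟶ X) (g : X ⟶ 𝟙_ C) (e : X ⊗ X ⟶ 𝟙_ C)
    (h : f ▷ X ≫ e = (λ_ X).hom ≫ g) :
    ((λ_ (𝟙_ C)).inv ≫ (f ⊗ₘ f)) ▷ X ≫ (α_ X X X).hom ≫ X ◁ e =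
      (λ_ X).hom ≫ g ≫ f ≫ (ρ_ X).inv := by
  have h1 : ((λ_ (𝟙_ C)).inv ≫ (f ⊗ₘ f)) ▷ X ≫ (α_ X X X).hom ≫ X ◁ e =
      𝟙 _ ⊗≫ f ▷ (𝟙_ C ⊗ X) ≫ X ◁ (f ▷ X ≫ e) := by
    rw [MonoidalCategory.tensorHom_def]
    monoidal
  rw [h1, h]
  have h2 : 𝟙 (𝟙_ C ⊗ X) ⊗≫ f ▷ (𝟙_ C ⊗ X) ≫ X ◁ ((λ_ X).hom ≫ g) =
    𝟙 _ ⊗≫ (f ▷ X ≫ X ◁ g) ⊗≫ 𝟙 _ := by monoidal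
  rw [h2, ← whisker_exchange]
  monoidal

end coherence

section positivity

variable {k : Type u} [Field k] [LinearOrder k]

theorem gcocopy_cozero : gcocopy (k := k) ≫ gcozero = (gcozero ⊗ₘ gcozero) ≫ (λ_ _).hom :=
  (mk_ih_op (k := k) .zero_copy).trans (Category.comp_id _).symm

theorem gcopy_cocopy : gcopy (k := k) ≫ gcocopy = 𝟙 _ := mk_ih (k := k) .copy_special

theorem gcozero_copy : gcozero (k := k) = gcopy ≫ (gcozero ⊗ₘ gcozero) ≫ (λ_ _).hom := by
  rw [← gcocopy_cozero, reassoc_of% gcopy_cocopy]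

theorem gzero_cozero : gzero (k := k) ≫ gcozero = 𝟙 _ := mk_ih (k := k) .add_bone

theorem gcoscalar_cozero (a : k) : gcoscalar a ≫ gcozero = gcozero := mk_ih_op (.scalar_zero a)

theorem gscalar_gcoscalar {a : k} (h : a ≠ 0) : gscalar a ≫ gcoscalar a = 𝟙 _ :=
  mk_ih (.scalar_coscalar a h)

theorem gcoscalar_gscalar {a : k} (h : a ≠ 0) : gcoscalar a ≫ gscalar a = 𝟙 _ :=
  (mk_ih (.coscalar_scalar a h)).symm

/-- The mirrored axiom concerns `coscalar a`, which is inverse to `scalar a`. -/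
theorem gscalar_cozero {a : k} (h : a ≠ 0) : gscalar a ≫ gcozero = gcozero := by
  conv_lhs => rw [← gcoscalar_cozero a, ← Category.assoc, gscalar_gcoscalar h, Category.id_comp]

theorem gcodelete_scalar {a : k} (h : a ≠ 0) : gcodelete ≫ gscalar a = gcodelete := by
  have h1 : gcodelete ≫ gcoscalar a = gcodelete := mk_ih_op (.scalar_delete a)
  conv_lhs => rw [← h1, Category.assoc, gcoscalar_gscalar h, Category.comp_id]

theorem gcozero_le_delete : gcozero (k := k) ≤ gdelete := IHPLe.ih .cozero_le_delete

theorem gzero_le_codelete : gzero (k := k) ≤ gcodelete := IHPLe.ih_op .cozero_le_delete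

theorem gcodelete_delete : gcodelete (k := k) ≫ gdelete = 𝟙 _ := mk_ih (k := k) .copy_bone

theorem gcodelete_cocopy : gcodelete (k := k) ▷ W k ≫ gcocopy = (λ_ _).hom :=
  mk_ih_op (k := k) .copy_counit

theorem copy_frobenius : gcopy (k := k) ▷ W k ≫ (α_ (W k) (W k) (W k)).hom ≫ W k ◁ gcocopy =
    gcocopy ≫ gcopy := by
  refine Eq.trans ?_ (mk_ih (k := k) .copy_frobenius_left)
  exact congrArg (gcopy (k := k) ▷ W k ≫ ·) (Category.id_comp _)

theorem copy_cap : gcopy (k := k) ▷ W k ≫ (α_ (W k) (W k) (W k)).hom ≫ W k ◁ gcap =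
    gcocopy ≫ (ρ_ _).inv := by
  have h := ComonObj.comul_counit (W k)
  change gcopy ≫ W k ◁ gdelete = _ at h
  rw [gcap, whiskerLeft_comp, ← Category.assoc (α_ _ _ _).hom, ← Category.assoc, copy_frobenius,
    Category.assoc, h]

theorem gscalar_cap : gscalar (-1 : k) ▷ W k ≫ gcap = gadd ≫ gcozero :=
  (mk_ih (k := k) .cap_eq).symm

theorem gzero_cap : gzero ▷ W k ≫ gcap = (λ_ _).hom ≫ gcozero := by
  rw [← gzero_scalar (-1 : k), comp_whiskerRight, Category.assoc, gscalar_cap,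
    reassoc_of% gzero_add]

/-- By the Frobenius law, `cocopy` is "copy one input and cap a copy with the other". A copied
`zero` is two separate zeros, one of which is consumed by the cap. -/
theorem gzero_cocopy : gzero ▷ W k ≫ gcocopy = (λ_ (W k)).hom ≫ gcozero ≫ gzero := by
  rw [← cancel_mono (ρ_ (W k)).inv, Category.assoc, ← copy_cap, ← comp_whiskerRight_assoc,
    gzero_copy]
  refine (tensor_states_cap _ _ _ gzero_cap).trans ?_
  simp only [Category.assoc]

/-- Both sides are `cocopy` with its first input plugged, by `zero` on the left and by the larger
`codelete` on the right. -/
theorem gcozero_zero_le : gcozero ≫ gzero ≤ 𝟙 (W k) := by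
  have h : gcozero ≫ gzero = (λ_ (W k)).inv ≫ gzero ▷ W k ≫ gcocopy := by
    rw [gzero_cocopy, Iso.inv_hom_id_assoc]
  have h' : 𝟙 (W k) = (λ_ (W k)).inv ≫ gcodelete ▷ W k ≫ gcocopy := by
    rw [gcodelete_cocopy, Iso.inv_hom_id]
  rw [h, h']
  exact comp_mono le_rfl (comp_mono (whiskerRight_mono _ gzero_le_codelete) le_rfl)

/-- Two tests for zero may each re-emit a zero, to be added and tested again. Each `cozero ; zero`
is then weakened to a wire. -/
theorem gcozero_add : (gcozero ⊗ₘ gcozero) ≫ (λ_ _).hom ≤ gadd (k := k) ≫ gcozero := by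
  have h : (gcozero (k := k) ⊗ₘ gcozero) ≫ (λ_ _).hom =
      ((gcozero ≫ gzero) ⊗ₘ (gcozero ≫ gzero)) ≫ gadd ≫ gcozero := by
    rw [← tensorHom_comp_tensorHom, Category.assoc, MonoidalCategory.tensorHom_def' gzero gzero,
      Category.assoc, reassoc_of% gzero_add, leftUnitor_naturality_assoc, gzero_cozero,
      Category.comp_id]
  rw [h]
  refine (comp_mono (tensor_mono gcozero_zero_le gcozero_zero_le) le_rfl).trans ?_
  rw [id_tensorHom_id, Category.id_comp]

/-- The predicate of being nonnegative. -/
def gpos : W k ⟶ 𝟙_ (Ob k) := ggeq ≫ gcozero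

theorem gcozero_le_gpos : gcozero (k := k) ≤ gpos := IHPLe.geq_ineq .cozero_geq

theorem gpos_copy : gpos (k := k) ≤ gcopy ≫ (gpos ⊗ₘ gpos) ≫ (λ_ _).hom := by
  have h : ggeq (k := k) ≫ gcopy ≤ gcopy ≫ (ggeq ⊗ₘ ggeq) := IHPLe.geq_ineq .geq_copy
  have e : gpos (k := k) = (ggeq ≫ gcopy) ≫ (gcozero ⊗ₘ gcozero) ≫ (λ_ _).hom := by
    rw [Category.assoc, ← gcozero_copy]
    rfl
  have e' : (gpos (k := k) ⊗ₘ gpos) = (ggeq ⊗ₘ ggeq) ≫ (gcozero ⊗ₘ gcozero) := by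
    rw [tensorHom_comp_tensorHom]
    rfl
  rw [e', Category.assoc, ← Category.assoc gcopy]
  refine e.le.trans ?_
  exact comp_mono h le_rfl

theorem gadd_geq : gadd (k := k) ≫ ggeq = (ggeq ⊗ₘ ggeq) ≫ gadd := mk_geq .add_geq

theorem gpos_add : (gpos (k := k) ⊗ₘ gpos) ≫ (λ_ _).hom ≤ gadd ≫ gpos := by
  have e' : (gpos (k := k) ⊗ₘ gpos) = (ggeq ⊗ₘ ggeq) ≫ (gcozero ⊗ₘ gcozero) := by
    rw [tensorHom_comp_tensorHom]
    rfl
  have e : gadd (k := k) ≫ gpos = (ggeq ⊗ₘ ggeq) ≫ gadd ≫ gcozero := by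
    rw [gpos, reassoc_of% gadd_geq]
  rw [e', e, Category.assoc]
  exact comp_mono le_rfl gcozero_add

theorem gpos_delete : gpos (k := k) ≤ gdelete := by
  have h : ggeq (k := k) ≫ gdelete = gdelete := mk_geq .geq_delete
  rw [← h]
  exact comp_mono le_rfl gcozero_le_delete

theorem gpos_zero : 𝟙 (𝟙_ (Ob k)) ≤ gzero ≫ gpos := by
  rw [← gzero_cozero]
  exact comp_mono le_rfl gcozero_le_gpos

/-- For `a = 0` the input is discarded and `zero` passes the test; for `a > 0` the scalar slides
through `geq`. -/
theorem gpos_scalar {a : k} (h : 0 ≤ a) : gpos ≤ gscalar a ≫ gpos := by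
  rcases h.eq_or_lt with rfl | h
  · rw [gscalar_zero, Category.assoc]
    calc gpos ≤ gdelete ≫ 𝟙 _ := by rw [Category.comp_id]; exact gpos_delete
      _ ≤ _ := comp_mono le_rfl gpos_zero
  · have e : gscalar a ≫ ggeq = ggeq ≫ gscalar a := mk_geq (.pos_scalar a h)
    rw [gpos, reassoc_of% e, gscalar_cozero h.ne']

/-- The predicate of being a nonnegative vector. -/
def posN : ∀ n : ℕ, (⟨n⟩ : Ob k) ⟶ 𝟙_ (Ob k)
  | 0 => 𝟙 _
  | n + 1 => ((posN n ⊗ₘ gpos) ≫ (λ_ _).hom : (⟨n⟩ : Ob k) ⊗ W k ⟶ 𝟙_ (Ob k))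

theorem posN_succ (n : ℕ) : posN (n + 1) =
    ((posN n ⊗ₘ gpos) ≫ (λ_ _).hom : (⟨n⟩ : Ob k) ⊗ W k ⟶ 𝟙_ (Ob k)) := rfl

/-- The conjunction of two predicates. -/
def conj {X : Ob k} (f g : X ⟶ 𝟙_ (Ob k)) : X ⟶ 𝟙_ (Ob k) := dup X ≫ (f ⊗ₘ g) ≫ (λ_ _).hom

theorem conj_mono {X : Ob k} {f f' g g' : X ⟶ 𝟙_ (Ob k)} (h : f ≤ f') (h' : g ≤ g') :
    conj f g ≤ conj f' g' :=
  comp_mono le_rfl (comp_mono (tensor_mono h h') le_rfl)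

theorem posN_le_conj (n : ℕ) : posN (k := k) n ≤ conj (posN n) (posN n) := by
  induction n with
  | zero =>
    refine le_of_eq ?_
    change 𝟙 _ = dup (𝟙_ (Ob k)) ≫ (𝟙 _ ⊗ₘ 𝟙 _) ≫ (λ_ _).hom
    rw [id_tensorHom_id, Category.id_comp, dup_unit, Iso.inv_hom_id]
  | succ n ih =>
    change _ ≤ dup ((⟨n⟩ : Ob k) ⊗ W k) ≫ _
    rw [posN_succ, ← tensorHom_comp_tensorHom, Category.assoc, reassoc_of% dup_succ_tensor,
      tensorμ_tensorUnit, Category.id_comp, tensorHom_comp_tensorHom_assoc, Category.assoc,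
      Category.assoc]
    exact comp_mono (tensor_mono ih gpos_copy) le_rfl

theorem posN_le_del (n : ℕ) : posN (k := k) n ≤ del ⟨n⟩ := by
  induction n with
  | zero => exact le_rfl
  | succ n ih => exact comp_mono (tensor_mono ih gpos_delete) le_rfl

theorem posN_le_row {n : ℕ} (v : Fin n → k) (h : ∀ i, 0 ≤ v i) : posN n ≤ row v ≫ gpos := by
  induction n with
  | zero => exact gpos_zero
  | succ n ih =>
    rw [posN_succ, row_succ, Category.assoc]
    refine le_trans ?_ (comp_mono le_rfl gpos_add)
    rw [tensorHom_comp_tensorHom_assoc]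
    exact comp_mono (tensor_mono (ih _ fun i => h _) (gpos_scalar (h _))) le_rfl

theorem posN_le_mat {n p : ℕ} (A : Fin p → Fin n → k) (h : ∀ i j, 0 ≤ A i j) :
    posN n ≤ mat A ≫ posN p := by
  induction p with
  | zero => exact (posN_le_del n).trans_eq (Category.comp_id _).symm
  | succ p ih =>
    rw [mat_succ, posN_succ]
    refine (posN_le_conj n).trans ?_
    rw [Category.assoc, tensorHom_comp_tensorHom_assoc]
    exact comp_mono le_rfl (comp_mono (tensor_mono (ih _ fun i j => h _ _)
      (posN_le_row _ fun j => h _ _)) le_rfl)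

theorem posN_add (p q : ℕ) : posN (p + q) =
    ((posN p ⊗ₘ posN q) ≫ (λ_ _).hom : (⟨p⟩ : Ob k) ⊗ ⟨q⟩ ⟶ 𝟙_ (Ob k)) := by
  induction q with
  | zero =>
    change posN p = ((posN p ⊗ₘ 𝟙 (𝟙_ (Ob k))) ≫ (λ_ (𝟙_ (Ob k))).hom :
      (⟨p⟩ : Ob k) ⊗ 𝟙_ (Ob k) ⟶ 𝟙_ (Ob k))
    rw [tensorHom_id, unitors_equal, rightUnitor_naturality]
    exact (Category.id_comp _).symm
  | succ q ih =>
    have h : ((posN p ⊗ₘ posN (q + 1)) ≫ (λ_ _).hom : (⟨p⟩ : Ob k) ⊗ ⟨q + 1⟩ ⟶ 𝟙_ (Ob k)) =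
      (α_ (⟨p⟩ : Ob k) ⟨q⟩ (W k)).inv ≫
        (((posN p ⊗ₘ posN q) ≫ (λ_ _).hom) ⊗ₘ gpos) ≫ (λ_ _).hom := by
      rw [posN_succ]
      exact tensorHom_unit_assoc _ _ _
    rw [h, ← ih]
    exact (Category.id_comp _).symm

/-- The predicate on vectors which satisfy a system of homogeneous linear inequalities. -/
def phi {n p : ℕ} (A : Fin p → Fin n → k) : (⟨n⟩ : Ob k) ⟶ 𝟙_ (Ob k) := mat A ≫ posN p

theorem conj_phi {n p q : ℕ} (A : Fin p → Fin n → k) (B : Fin q → Fin n → k) :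
    conj (phi A) (phi B) = phi (Fin.append A B) := by
  have h : phi (Fin.append A B) = (dup ⟨n⟩ ≫ (mat A ⊗ₘ mat B)) ≫ (posN p ⊗ₘ posN q) ≫ (λ_ _).hom := by
    rw [← posN_add, mat_append]
    rfl
  rw [h, Category.assoc, tensorHom_comp_tensorHom_assoc]
  rfl

theorem mat_comp_phi {n p q : ℕ} (S : Fin p → Fin n → k) (A : Fin q → Fin p → k) :
    mat S ≫ phi A = phi fun i => ∑ j, A i j • S j := by
  rw [phi, ← Category.assoc, mat_comp_mat, phi]

end positivity

/-- Membership in the convex cone generated by a set. -/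
inductive InCone {k : Type*} {V : Type*} [Field k] [LinearOrder k] [AddCommGroup V] [Module k V]
    (s : Set V) : V → Prop
  | zero : InCone s 0
  | mem {v : V} : v ∈ s → InCone s v
  | add {v w : V} : InCone s v → InCone s w → InCone s (v + w)
  | smul {a : k} {v : V} : 0 ≤ a → InCone s v → InCone s (a • v)

theorem InCone.exists_coeff {k V : Type*} [Field k] [LinearOrder k] [IsStrictOrderedRing k]
    [AddCommGroup V] [Module k V] {p : ℕ} {A : Fin p → V} {v : V}
    (hv : InCone (k := k) (Set.range A) v) :
    ∃ a : Fin p → k, (∀ i, 0 ≤ a i) ∧ v = ∑ i, a i • A i := by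
  induction hv with
  | zero => exact ⟨0, fun _ => le_rfl, by simp⟩
  | mem hv =>
    obtain ⟨i, rfl⟩ := hv
    refine ⟨Pi.single i 1, fun j => ?_, by simp [Pi.single_apply]⟩
    by_cases h : j = i
    · subst h; simp
    · simp [h]
  | add _ _ h h' =>
    obtain ⟨a, ha, rfl⟩ := h
    obtain ⟨b, hb, rfl⟩ := h'
    exact ⟨a + b, fun i => add_nonneg (ha i) (hb i), by simp [add_smul, Finset.sum_add_distrib]⟩
  | @smul c _ hc _ h =>
    obtain ⟨a, ha, rfl⟩ := h
    exact ⟨c • a, fun i => mul_nonneg hc (ha i), by simp [Finset.smul_sum, mul_smul]⟩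

/-! ### Systems of homogeneous linear inequalities -/

section elimination

variable {k : Type u} [Field k] [LinearOrder k] [IsStrictOrderedRing k]

/-- If `B = Λ A` with `Λ ≥ 0` entrywise, the system for `B` inserts into the one for `A` a map that
preserves nonnegative vectors. Farkas' lemma will show that this criterion loses nothing. -/
theorem phi_mono {n p q : ℕ} {A : Fin p → Fin n → k} {B : Fin q → Fin n → k}
    (h : ∀ i, InCone (k := k) (Set.range A) (B i)) : phi A ≤ phi B := by
  choose Λ h0 h1 using fun i => (h i).exists_coeff
  have e : B = fun i => ∑ j, Λ i j • A j := funext h1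
  rw [e, ← mat_comp_phi]
  exact comp_mono le_rfl (posN_le_mat Λ h0)

/-- The predicate given by a list of homogeneous linear inequalities. -/
def Phi {n : ℕ} (L : List (Fin n → k)) : (⟨n⟩ : Ob k) ⟶ 𝟙_ (Ob k) := phi L.get

theorem Phi_mono {n : ℕ} {L L' : List (Fin n → k)}
    (h : ∀ r ∈ L', InCone (k := k) {r | r ∈ L} r) : Phi L ≤ Phi L' := by
  refine phi_mono fun i => ?_
  rw [Set.range_list_get]
  exact h _ (L'.get_mem i)

theorem Phi_congr {n : ℕ} {L L' : List (Fin n → k)} (h : ∀ r, r ∈ L ↔ r ∈ L') : Phi L = Phi L' :=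
  le_antisymm (Phi_mono fun r hr => .mem ((h r).2 hr)) (Phi_mono fun r hr => .mem ((h r).1 hr))

theorem phi_eq_Phi {n p : ℕ} {A : Fin p → Fin n → k} {L : List (Fin n → k)}
    (h : ∀ r, (∃ i, A i = r) ↔ r ∈ L) : phi A = Phi L := by
  apply le_antisymm <;> refine phi_mono fun i => .mem ?_
  · exact (h _).2 (L.get_mem i)
  · rw [Set.range_list_get]
    exact (h _).1 ⟨i, rfl⟩

theorem mat_comp_Phi {n p : ℕ} (S : Fin p → Fin n → k) (L : List (Fin p → k)) :
    mat S ≫ Phi L = Phi (L.map fun r => ∑ j, r j • S j) := by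
  rw [Phi, mat_comp_phi]
  refine phi_eq_Phi fun r => ?_
  rw [List.mem_map]
  simp only [List.mem_iff_get, exists_exists_eq_and]

theorem conj_Phi {n : ℕ} (L L' : List (Fin n → k)) : conj (Phi L) (Phi L') = Phi (L ++ L') := by
  rw [Phi, Phi, conj_phi]
  refine phi_eq_Phi fun r => ?_
  rw [List.mem_append, List.mem_iff_get, List.mem_iff_get]
  constructor
  · rintro ⟨i, rfl⟩
    refine Fin.addCases (fun i => ?_) (fun i => ?_) i
    · exact .inl ⟨i, by simp⟩
    · exact .inr ⟨i, by simp⟩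
  · rintro (⟨i, rfl⟩ | ⟨i, rfl⟩)
    · exact ⟨Fin.castAdd _ i, by simp⟩
    · exact ⟨Fin.natAdd _ i, by simp⟩

end elimination

end CircGeq

/-! ### Existential quantification and interpolation between bounds -/

namespace CircGeq

section coherence

variable {C : Type*} [Category* C] [MonoidalCategory C] [SymmetricCategory C]

theorem tensorμ_weaken {X Y : C} (d : X ⟶ X ⊗ X) :
    (d ⊗ₘ (λ_ Y).inv) ≫ tensorμ X X (𝟙_ C) Y ≫ ((ρ_ X).hom ⊗ₘ 𝟙 (X ⊗ Y)) =
      d ▷ Y ≫ (α_ X X Y).hom := by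
  rw [tensorμ, braiding_tensorUnit_right]
  monoidal

theorem whiskerRight_states {X Y : C} (c : 𝟙_ C ⟶ Y) (d : X ⟶ X ⊗ X) (f : X ⟶ 𝟙_ C)
    (g : X ⊗ Y ⟶ 𝟙_ C) :
    (ρ_ X).inv ≫ X ◁ c ≫ d ▷ Y ≫ (α_ X X Y).hom ≫ (f ⊗ₘ g) ≫ (λ_ _).hom =
      d ≫ (f ⊗ₘ ((ρ_ X).inv ≫ X ◁ c ≫ g)) ≫ (λ_ _).hom := by
  rw [whisker_exchange_assoc]
  simp only [MonoidalCategory.tensorHom_def']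
  monoidal

end coherence

theorem InCone.of_mem {k V : Type*} [Field k] [LinearOrder k] [AddCommGroup V] [Module k V]
    {L : List V} {v : V} (h : v ∈ L) : InCone (k := k) {r | r ∈ L} v := .mem h

section elimination

variable {k : Type u} [Field k] [LinearOrder k]

/-- Existential quantification over the last variable. -/
def ex {n : ℕ} (f : (⟨n⟩ : Ob k) ⊗ W k ⟶ 𝟙_ (Ob k)) : (⟨n⟩ : Ob k) ⟶ 𝟙_ (Ob k) :=
  (ρ_ (⟨n⟩ : Ob k)).inv ≫ (⟨n⟩ : Ob k) ◁ gcodelete ≫ f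

/-- Weakening by one more variable. -/
def wk (n : ℕ) : (⟨n⟩ : Ob k) ⊗ W k ⟶ ⟨n⟩ := (⟨n⟩ : Ob k) ◁ gdelete ≫ (ρ_ (⟨n⟩ : Ob k)).hom

theorem ex_mono {n : ℕ} {f g : (⟨n⟩ : Ob k) ⊗ W k ⟶ 𝟙_ (Ob k)} (h : f ≤ g) : ex f ≤ ex g :=
  comp_mono le_rfl (comp_mono le_rfl h)

/-- An unused variable can be quantified away since `codelete ; delete` is empty. -/
theorem ex_wk {n : ℕ} (f : (⟨n⟩ : Ob k) ⟶ 𝟙_ (Ob k)) : ex (wk n ≫ f) = f := by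
  rw [ex, wk, Category.assoc, ← MonoidalCategory.whiskerLeft_comp_assoc, gcodelete_delete,
    whiskerLeft_id, Category.id_comp, Iso.inv_hom_id_assoc]

theorem comp_ex {n m : ℕ} (f : (⟨n⟩ : Ob k) ⟶ ⟨m⟩) (g : (⟨m⟩ : Ob k) ⊗ W k ⟶ 𝟙_ (Ob k)) :
    f ≫ ex g = ex (f ▷ W k ≫ g) := by
  rw [ex, ex, rightUnitor_inv_naturality_assoc, whisker_exchange_assoc]

theorem dup_wk (n : ℕ) : dup ((⟨n⟩ : Ob k) ⊗ W k) ≫ (wk n ⊗ₘ 𝟙 ((⟨n⟩ : Ob k) ⊗ W k)) =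
    dup (⟨n⟩ : Ob k) ▷ W k ≫ (α_ _ _ _).hom := by
  have h : (wk n ⊗ₘ 𝟙 ((⟨n⟩ : Ob k) ⊗ W k)) =
      ((𝟙 (⟨n⟩ : Ob k) ⊗ₘ gdelete) ⊗ₘ (𝟙 (⟨n⟩ : Ob k) ⊗ₘ 𝟙 (W k))) ≫
        ((ρ_ (⟨n⟩ : Ob k)).hom ⊗ₘ 𝟙 ((⟨n⟩ : Ob k) ⊗ W k)) := by
    rw [tensorHom_comp_tensorHom, id_tensorHom, id_tensorHom_id, Category.comp_id]
    rfl
  have e : gcopy (k := k) ≫ (gdelete ⊗ₘ 𝟙 (W k)) = (λ_ (W k)).inv := by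
    rw [tensorHom_id, gcopy_counit]
  rw [h, reassoc_of% dup_succ_tensor, e, id_tensorHom_id, Category.comp_id, tensorμ_weaken]

/-- The predicate `f` does not see the quantified variable, so naturality moves the quantifier
outside. -/
theorem conj_ex {n : ℕ} (f : (⟨n⟩ : Ob k) ⟶ 𝟙_ (Ob k)) (g : (⟨n⟩ : Ob k) ⊗ W k ⟶ 𝟙_ (Ob k)) :
    conj f (ex g) = ex (conj (wk n ≫ f) g) := by
  have h : ((wk n ≫ f) ⊗ₘ g) = (wk n ⊗ₘ 𝟙 ((⟨n⟩ : Ob k) ⊗ W k)) ≫ (f ⊗ₘ g) := by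
    rw [tensorHom_comp_tensorHom, Category.id_comp]
  have e : conj (wk n ≫ f) g =
      dup (⟨n⟩ : Ob k) ▷ W k ≫ (α_ _ _ _).hom ≫ (f ⊗ₘ g) ≫ (λ_ _).hom := by
    rw [conj, h, Category.assoc, reassoc_of% dup_wk]
  rw [e, conj, ex, ex, whiskerRight_states]

/-- Appending a coefficient to a row. -/
def ext {n : ℕ} (u : Fin n → k) (t : k) : Fin (n + 1) → k := Fin.snoc (α := fun _ => k) u t

@[simp]
theorem ext_castSucc {n : ℕ} (u : Fin n → k) (t : k) (i : Fin n) : ext u t i.castSucc = u i := by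
  simp [ext]

@[simp]
theorem ext_last {n : ℕ} (u : Fin n → k) (t : k) : ext u t (Fin.last n) = t := by
  simp [ext]

theorem ext_self {n : ℕ} (r : Fin (n + 1) → k) :
    ext (fun i => r i.castSucc) (r (Fin.last n)) = r := by
  funext i
  refine Fin.lastCases ?_ (fun i => ?_) i <;> simp

theorem ext_add {n : ℕ} (u v : Fin n → k) (s t : k) : ext u s + ext v t = ext (u + v) (s + t) := by
  funext i
  refine Fin.lastCases ?_ (fun i => ?_) i <;> simp

theorem smul_ext {n : ℕ} (u : Fin n → k) (a t : k) : a • ext u t = ext (a • u) (a * t) := by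
  funext i
  refine Fin.lastCases ?_ (fun i => ?_) i <;> simp

theorem wk_eq_mat (n : ℕ) :
    wk (k := k) n = mat (n := n + 1) fun i : Fin n => (Pi.single i.castSucc 1 : Fin (n + 1) → k) := by
  rw [wk, ← id_tensorHom, ← mat_one, mat, ← tuple_tensor_delete]
  unfold mat
  congr
  funext i
  rw [row_snoc_zero _ (by simp [Fin.ext_iff, i.2.ne'])]
  congr
  funext j
  simp [Pi.single_apply, Fin.ext_iff]

theorem append_block_eq_snoc {n p : ℕ} (S : Fin p → Fin n → k) (b : Fin 1 → Fin 1 → k) :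
    (Fin.append (fun i => Fin.append (S i) 0) (fun i => Fin.append 0 (b i)) :
      Fin (p + 1) → Fin (n + 1) → k) =
    Fin.snoc (α := fun _ => Fin (n + 1) → k) (fun i => ext (S i) 0) (ext 0 (b 0 0)) := by
  have h : ∀ i : Fin (p + 1), i = Fin.last p ∨ ∃ j : Fin p, i = j.castSucc := fun i =>
    Fin.lastCases (.inl rfl) (fun j => .inr ⟨j, rfl⟩) i
  have h1 : Fin.last p = Fin.natAdd p (0 : Fin 1) := rfl
  have h2 : ∀ i : Fin p, i.castSucc = Fin.castAdd 1 i := fun _ => rfl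
  have h3 : Fin.last n = Fin.natAdd n (0 : Fin 1) := rfl
  have h4 : ∀ i : Fin n, i.castSucc = Fin.castAdd 1 i := fun _ => rfl
  funext i j
  obtain rfl | ⟨i, rfl⟩ := h i
  · rw [Fin.snoc_last, h1, Fin.append_right]
    refine Fin.lastCases ?_ (fun j => ?_) j
    · rw [ext_last, h3, Fin.append_right]
    · rw [ext_castSucc, h4, Fin.append_left]
  · rw [Fin.snoc_castSucc, h2, Fin.append_left]
    refine Fin.lastCases ?_ (fun j => ?_) j
    · rw [ext_last, h3, Fin.append_right]
      rfl
    · rw [ext_castSucc, h4, Fin.append_left]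

theorem whiskerRight_mat {n p : ℕ} (S : Fin p → Fin n → k) :
    (mat S ▷ W k : (⟨n⟩ : Ob k) ⊗ W k ⟶ ⟨p⟩ ⊗ W k) =
      mat (n := n + 1) (p := p + 1) (Fin.snoc (α := fun _ => Fin (n + 1) → k)
        (fun i => ext (S i) 0) (ext 0 1)) := by
  rw [← tensorHom_id]
  have h := mat_tensor_mat S (fun i : Fin 1 => (Pi.single i 1 : Fin 1 → k))
  rw [mat_one] at h
  refine h.trans (congrArg mat ?_)
  rw [append_block_eq_snoc, Pi.single_eq_same]

variable [IsStrictOrderedRing k]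

theorem wk_comp_Phi {n : ℕ} (L : List (Fin n → k)) : wk n ≫ Phi L = Phi (L.map (ext · 0)) := by
  rw [wk_eq_mat]
  refine (mat_comp_Phi _ L).trans ?_
  congr 1
  refine List.map_congr_left fun r _ => ?_
  funext i
  refine Fin.lastCases ?_ (fun i => ?_) i
  · rw [sum_smul_single_of_ne _ _ _ fun i => (Fin.castSucc_lt_last i).ne, ext_last]
  · rw [sum_smul_single _ _ (Fin.castSucc_injective n), ext_castSucc]

theorem whiskerRight_comp_Phi {n p : ℕ} (S : Fin p → Fin n → k) (L : List (Fin (p + 1) → k)) :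
    mat S ▷ W k ≫ Phi L =
      Phi (L.map fun r => ext (∑ j, r j.castSucc • S j) (r (Fin.last p))) := by
  rw [whiskerRight_mat]
  refine (mat_comp_Phi _ L).trans ?_
  congr 1
  refine List.map_congr_left fun r _ => ?_
  rw [Fin.sum_univ_castSucc]
  funext i
  refine Fin.lastCases ?_ (fun i => ?_) i <;> simp

/-- The sums of an element of each list. -/
def sums {n : ℕ} (U V : List (Fin n → k)) : List (Fin n → k) := U.flatMap fun u => V.map (u + ·)

theorem mem_sums {n : ℕ} {U V : List (Fin n → k)} {r : Fin n → k} :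
    r ∈ sums U V ↔ ∃ u ∈ U, ∃ v ∈ V, u + v = r := by
  simp [sums]

/-- The inequalities `u ≥ x` for `u` in `U` and `v + x ≥ 0` for `v` in `V`, in a last
variable `x`. -/
def bounds {n : ℕ} (U V : List (Fin n → k)) : List (Fin (n + 1) → k) :=
  U.map (ext · (-1)) ++ V.map (ext · 1)

theorem mem_bounds {n : ℕ} {U V : List (Fin n → k)} {r : Fin (n + 1) → k} :
    r ∈ bounds U V ↔ (∃ u ∈ U, ext u (-1) = r) ∨ ∃ v ∈ V, ext v 1 = r := by
  simp [bounds]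

/-- Interpolation: a value between the given bounds exists if all pairs of bounds are compatible. -/
def Interpolates {n : ℕ} (U V : List (Fin n → k)) : Prop := Phi (sums U V) ≤ ex (Phi (bounds U V))

theorem ex_flip {n : ℕ} (f : (⟨n⟩ : Ob k) ⊗ W k ⟶ 𝟙_ (Ob k)) :
    ex ((⟨n⟩ : Ob k) ◁ gscalar (-1 : k) ≫ f) = ex f := by
  rw [ex, ex, ← MonoidalCategory.whiskerLeft_comp_assoc, gcodelete_scalar (by simp)]

theorem gscalar_eq_mat (a : k) : gscalar a = mat (fun _ _ : Fin 1 => a) := by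
  rw [mat_fin_one, row_succ, MonoidalCategory.tensorHom_def']
  change gscalar a = (𝟙_ (Ob k) ◁ gscalar a ≫ gzero ▷ W k) ≫ gadd
  rw [Category.assoc, gzero_add, leftUnitor_naturality]
  exact (Category.id_comp _).symm

theorem flip_eq_mat (n : ℕ) : (⟨n⟩ : Ob k) ◁ gscalar (-1 : k) =
    mat (n := n + 1) (p := n + 1) (Fin.snoc (α := fun _ => Fin (n + 1) → k)
        (fun i => ext (Pi.single i 1) 0) (ext 0 (-1))) := by
  have h := mat_tensor_mat (fun i : Fin n => (Pi.single i 1 : Fin n → k))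
    (fun _ _ : Fin 1 => (-1 : k))
  rw [mat_one, ← gscalar_eq_mat] at h
  rw [← id_tensorHom]
  refine h.trans (congrArg mat ?_)
  rw [append_block_eq_snoc]

theorem ex_bounds_swap {n : ℕ} (U V : List (Fin n → k)) :
    ex (Phi (bounds U V)) = ex (Phi (bounds V U)) := by
  rw [← ex_flip, flip_eq_mat]
  congr 1
  refine (mat_comp_Phi _ _).trans ?_
  refine Phi_congr fun r => ?_
  have e : ∀ (u : Fin n → k) (t : k), ∑ j, ext u t j • Fin.snoc (α := fun _ => Fin (n + 1) → k)
      (fun i => ext (Pi.single i 1) 0) (ext 0 (-1)) j = ext u (-t) := by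
    intro u t
    rw [Fin.sum_univ_castSucc]
    funext i
    refine Fin.lastCases ?_ (fun i => ?_) i <;> simp [Pi.single_apply]
  simp only [bounds, List.map_append, List.map_map, List.mem_append, List.mem_map,
    Function.comp_apply, e, neg_neg]
  exact or_comm

/-- Negating the quantified variable exchanges upper and lower bounds. -/
theorem Interpolates.swap {n : ℕ} {U V : List (Fin n → k)} (h : Interpolates U V) :
    Interpolates V U := by
  unfold Interpolates at *
  rw [ex_bounds_swap, Phi_congr (L' := sums U V)]
  · exact h
  · intro r
    simp only [mem_sums]
    constructor <;> rintro ⟨u, hu, v, hv, rfl⟩ <;> exact ⟨v, hv, u, hu, add_comm _ _⟩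

/-- Let `t` lie between the bounds `U` and `V`. Interpolating between the two upper bounds `a`, `t`
and the lower bounds from `V` gives `s` with `s ≤ a` and `s ≤ t ≤ u` for all `u` in `U`. Here `t` is
one more coordinate, namely the form `ext 0 1`, which is why `h2` is about rows of length `n + 1`.
-/
theorem Interpolates.cons {n : ℕ} {U V : List (Fin n → k)} {a : Fin n → k}
    (h2 : ∀ a b : Fin (n + 1) → k, Interpolates [a, b] (V.map (ext · 0)))
    (h : Interpolates U V) : Interpolates (a :: U) V := by
  unfold Interpolates at *
  have e : Phi (sums (a :: U) V) = conj (Phi (sums [a] V)) (Phi (sums U V)) := by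
    rw [conj_Phi]
    exact Phi_congr fun r => by simp [sums]
  -- The variable `t` is free on the left and ignored on the right, so quantifying over it leaves
  -- the right side unchanged by `ex_wk`.
  have key : Phi ((sums [a] V).map (ext · 0) ++ bounds U V) ≤
      wk n ≫ ex (Phi (bounds (a :: U) V)) := by
    have hr : wk n ≫ ex (Phi (bounds (a :: U) V)) =
        ex (Phi ((bounds (a :: U) V).map fun r =>
          ext (ext (fun i => r i.castSucc) 0) (r (Fin.last n)))) := by
      rw [wk_eq_mat]
      refine (comp_ex _ _).trans ?_
      refine congrArg ex ((whiskerRight_comp_Phi _ _).trans ?_)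
      congr 2
      funext r
      congr 1
      funext i
      refine Fin.lastCases ?_ (fun i => ?_) i <;> simp [Pi.single_apply]
    rw [hr]
    calc _ ≤ conj (Phi (U.map (ext · (-1))))
          (Phi (sums [ext a 0, ext 0 1] (V.map (ext · 0)))) := by
          rw [conj_Phi]
          refine Phi_mono fun r h => .mem ?_
          simp only [List.mem_append, List.mem_map, mem_sums, mem_bounds, List.mem_cons,
            List.not_mem_nil, or_false, Set.mem_ofPred_eq] at h ⊢
          rcases h with ⟨u, hu, rfl⟩ | ⟨u, rfl | rfl, _, ⟨v, hv, rfl⟩, rfl⟩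
          · exact .inr (.inl ⟨u, hu, rfl⟩)
          · exact .inl ⟨a + v, ⟨a, rfl, v, hv, rfl⟩, by simp [ext_add]⟩
          · exact .inr (.inr ⟨v, hv, by simp [ext_add]⟩)
      _ ≤ _ := conj_mono le_rfl (h2 _ _)
      _ = ex (Phi ((U.map (ext · (-1))).map (ext · 0) ++
          bounds [ext a 0, ext 0 1] (V.map (ext · 0)))) := by
        rw [conj_ex, wk_comp_Phi]
        exact congrArg ex (conj_Phi _ _)
      _ ≤ _ := by
        refine ex_mono (Phi_mono fun r h => ?_)
        simp only [List.mem_map, mem_bounds, List.mem_cons] at h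
        have hv : ∀ v ∈ V, ext (ext v 0) 1 ∈ (U.map (ext · (-1))).map (ext · 0) ++
            bounds [ext a 0, ext 0 1] (V.map (ext · 0)) := fun v hv =>
          List.mem_append_right _ (mem_bounds.2 (.inr ⟨_, List.mem_map_of_mem hv, rfl⟩))
        have hb : ∀ b ∈ [ext a 0, ext 0 1], ext b (-1) ∈ (U.map (ext · (-1))).map (ext · 0) ++
            bounds [ext a 0, ext 0 1] (V.map (ext · 0)) := fun b hb =>
          List.mem_append_right _ (mem_bounds.2 (.inl ⟨_, hb, rfl⟩))
        rcases h with ⟨_, ⟨u, rfl | hu, rfl⟩ | ⟨v, hv', rfl⟩, rfl⟩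
        · simpa using InCone.of_mem (k := k) (hb (ext u 0) (by simp))
        -- `u - s` is the sum of the available rows `u - t` and `t - s`.
        · have h1 : ext (ext u (-1)) 0 ∈ (U.map (ext · (-1))).map (ext · 0) ++
              bounds [ext a 0, ext 0 1] (V.map (ext · 0)) :=
            List.mem_append_left _ (List.mem_map_of_mem (List.mem_map_of_mem hu))
          simpa [ext_add] using (InCone.of_mem (k := k) h1).add (.of_mem (hb (ext 0 1) (by simp)))
        · simpa using InCone.of_mem (k := k) (hv v hv')
  rw [e]
  calc _ ≤ conj (Phi (sums [a] V)) (ex (Phi (bounds U V))) := conj_mono le_rfl h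
    _ = ex (Phi ((sums [a] V).map (ext · 0) ++ bounds U V)) := by
      rw [conj_ex, wk_comp_Phi]
      exact congrArg ex (conj_Phi _ _)
    _ ≤ ex (wk n ≫ ex (Phi (bounds (a :: U) V))) := ex_mono key
    _ = _ := ex_wk _

end elimination

end CircGeq

/-! ### Bending wires; the order as a test on differences -/

namespace CircGeq

section coherence

variable {C : Type*} [Category* C] [MonoidalCategory C] [SymmetricCategory C]

/-- A crossing turns two interleaved pairings into nested ones, to which Frobenius and snake
equations apply. Cocommutativity of `copy` supplies the crossing for free. -/
theorem tensorμ_nested_left {X Y Z Z' : C} (f : X ⊗ Z ⟶ 𝟙_ C) (g : Y ⊗ Z' ⟶ 𝟙_ C) :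
    (β_ X Y).hom ▷ (Z' ⊗ Z) ≫ tensorμ Y X Z' Z ≫ (g ⊗ₘ f) ≫ (λ_ _).hom =
      (α_ X Y (Z' ⊗ Z)).hom ≫ X ◁ ((α_ Y Z' Z).inv ≫ g ▷ Z ≫ (λ_ Z).hom) ≫ f := by
  have h : (β_ X Y).hom ▷ (Z' ⊗ Z) ≫ tensorμ Y X Z' Z =
      (α_ X Y (Z' ⊗ Z)).hom ≫ X ◁ (α_ Y Z' Z).inv ≫ (α_ X (Y ⊗ Z') Z).inv ≫
        (β_ X (Y ⊗ Z')).hom ▷ Z ≫ (α_ (Y ⊗ Z') X Z).hom := by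
    rw [BraidedCategory.braiding_tensor_right_hom, tensorμ]
    monoidal
  have h2 : (β_ X (Y ⊗ Z')).hom ▷ Z ≫ (α_ (Y ⊗ Z') X Z).hom ≫ (g ⊗ₘ f) ≫ (λ_ _).hom =
      (X ◁ g) ▷ Z ≫ (ρ_ X).hom ▷ Z ≫ f := by
    have : (X ◁ g) ▷ Z ≫ (ρ_ X).hom ▷ Z ≫ f =
      ((X ◁ g) ≫ (β_ X (𝟙_ C)).hom ≫ (λ_ X).hom) ▷ Z ≫ f := by simp
    rw [this, BraidedCategory.braiding_naturality_right_assoc, MonoidalCategory.tensorHom_def]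
    monoidal
  rw [reassoc_of% h, h2]
  monoidal

theorem tensorμ_nested_right {X Y Z Z' : C} (f : X ⊗ Z ⟶ 𝟙_ C) (g : Y ⊗ Z' ⟶ 𝟙_ C) :
    (X ⊗ Y) ◁ (β_ Z' Z).hom ≫ tensorμ X Y Z Z' ≫ (f ⊗ₘ g) ≫ (λ_ _).hom =
      (α_ X Y (Z' ⊗ Z)).hom ≫ X ◁ ((α_ Y Z' Z).inv ≫ g ▷ Z ≫ (λ_ Z).hom) ≫ f := by
  have h : (X ⊗ Y) ◁ (β_ Z' Z).hom ≫ tensorμ X Y Z Z' =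
      (α_ X Y (Z' ⊗ Z)).hom ≫ X ◁ (α_ Y Z' Z).inv ≫ 
        X ◁ (β_ (Y ⊗ Z') Z).hom ≫ (α_ X Z (Y ⊗ Z')).inv := by
    rw [BraidedCategory.braiding_tensor_left_hom, tensorμ]
    monoidal
  have h2 : X ◁ (β_ (Y ⊗ Z') Z).hom ≫ (α_ X Z (Y ⊗ Z')).inv ≫ (f ⊗ₘ g) ≫ (λ_ _).hom =
      X ◁ (g ▷ Z) ≫ X ◁ (λ_ Z).hom ≫ f := by
    have : X ◁ (g ▷ Z) ≫ X ◁ (λ_ Z).hom ≫ f =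
      X ◁ (g ▷ Z ≫ (β_ (𝟙_ C) Z).hom ≫ (ρ_ Z).hom) ≫ f := by simp
    rw [this, BraidedCategory.braiding_naturality_left_assoc, MonoidalCategory.tensorHom_def']
    monoidal
  rw [reassoc_of% h, h2]
  monoidal
theorem whiskerRight_states_left {X Y : C} (c : 𝟙_ C ⟶ Y) (f : X ⟶ Y) (e : Y ⊗ Y ⟶ 𝟙_ C)
    (d : Y ⟶ 𝟙_ C) (h : Y ◁ c ≫ e = (ρ_ Y).hom ≫ d) :
    (ρ_ X).inv ≫ X ◁ c ≫ f ▷ Y ≫ e = f ≫ d := by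
  rw [whisker_exchange_assoc, h]
  simp

/-- The snake equation `h`: bending an output into an input loses nothing. -/
theorem bend_unbend {X Y : C} (f : X ⟶ Y) (c : 𝟙_ C ⟶ Y ⊗ Y) (e : Y ⊗ Y ⟶ 𝟙_ C)
    (h : Y ◁ c ≫ (α_ Y Y Y).inv ≫ e ▷ Y = (ρ_ Y).hom ≫ (λ_ Y).inv) :
    (ρ_ X).inv ≫ X ◁ c ≫ (α_ X Y Y).inv ≫ (f ▷ Y ≫ e) ▷ Y ≫ (λ_ Y).hom = f := by
  have h1 : (ρ_ X).inv ≫ X ◁ c ≫ (α_ X Y Y).inv ≫ (f ▷ Y ≫ e) ▷ Y ≫ (λ_ Y).hom =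
    (ρ_ X).inv ≫ (X ◁ c ≫ f ▷ (Y ⊗ Y)) ≫ (α_ Y Y Y).inv ≫ e ▷ Y ≫ (λ_ Y).hom := by monoidal
  rw [h1, whisker_exchange, Category.assoc, reassoc_of% h]
  simp

theorem unbend_bent {X Y : C} (f : Y ⟶ X) (c : 𝟙_ C ⟶ Y ⊗ Y) (e : X ⊗ X ⟶ 𝟙_ C)
    (e' : Y ⊗ Y ⟶ 𝟙_ C) (h : c ▷ Y ≫ (α_ Y Y Y).hom ≫ Y ◁ e' = (λ_ Y).hom ≫ (ρ_ Y).inv) :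
    ((ρ_ X).inv ≫ X ◁ c ≫ X ◁ (f ▷ Y) ≫ (α_ X X Y).inv ≫ e ▷ Y ≫ (λ_ Y).hom) ▷ Y ≫ e' =
      X ◁ f ≫ e := by
  have h1 : ((ρ_ X).inv ≫ X ◁ c ≫ X ◁ (f ▷ Y) ≫ (α_ X X Y).inv ≫ e ▷ Y ≫ (λ_ Y).hom) ▷ Y ≫ e' =
    𝟙 _ ⊗≫ X ◁ (c ▷ Y) ⊗≫ ((X ◁ f ≫ e) ▷ (Y ⊗ Y) ≫ 𝟙_ C ◁ e') ⊗≫ 𝟙 _ := by monoidal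
  rw [h1, ← whisker_exchange]
  have h2 : 𝟙 (X ⊗ Y) ⊗≫ X ◁ (c ▷ Y) ⊗≫ ((X ⊗ Y) ◁ e' ≫ (X ◁ f ≫ e) ▷ 𝟙_ C) ⊗≫ 𝟙 _ =
    𝟙 _ ⊗≫ X ◁ (c ▷ Y ≫ (α_ Y Y Y).hom ≫ Y ◁ e') ⊗≫ X ◁ f ≫ e := by monoidal
  rw [h2, h]
  monoidal

end coherence

section duality

variable {k : Type u} [Field k] [LinearOrder k]

theorem gadd_comm : (β_ (W k) (W k)).hom ≫ gadd = gadd := mk_ih (k := k) .add_comm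

theorem gcocopy_comm : (β_ (W k) (W k)).hom ≫ gcocopy = gcocopy := mk_ih_op (k := k) .copy_cocomm

theorem gcap_comm : (β_ (W k) (W k)).hom ≫ gcap = gcap := by
  rw [gcap, reassoc_of% gcocopy_comm]

theorem gcocopy_assoc : gcocopy ▷ W k ≫ gcocopy =
    (α_ (W k) (W k) (W k)).hom ≫ W k ◁ gcocopy ≫ gcocopy :=
  (mk_ih_op .copy_coassoc).trans (Category.id_comp _).symm

theorem copy_frobenius' : W k ◁ gcopy ≫ (α_ (W k) (W k) (W k)).inv ≫ gcocopy ▷ W k =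
    gcocopy ≫ gcopy := by
  refine Eq.trans ?_ (mk_ih (k := k) .copy_frobenius_right).symm
  exact congrArg (W k ◁ gcopy ≫ ·) (Category.id_comp _)

theorem copy_cap' : W k ◁ gcopy ≫ (α_ (W k) (W k) (W k)).inv ≫ gcap ▷ W k =
    gcocopy ≫ (λ_ _).inv := by
  rw [gcap, comp_whiskerRight, reassoc_of% copy_frobenius', gcopy_counit]

theorem gcocopy_codelete : W k ◁ gcodelete ≫ gcocopy = (ρ_ (W k)).hom := by
  rw [← gcocopy_comm, BraidedCategory.braiding_naturality_right_assoc, gcodelete_cocopy]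
  simp

theorem gcup_cap : W k ◁ gcup ≫ (α_ (W k) (W k) (W k)).inv ≫ gcap ▷ W k =
    (ρ_ _).hom ≫ (λ_ _).inv := by
  rw [gcup, whiskerLeft_comp, Category.assoc, copy_cap', ← Category.assoc, gcocopy_codelete]

theorem gcup_cap' : gcup ▷ W k ≫ (α_ (W k) (W k) (W k)).hom ≫ W k ◁ gcap =
    (λ_ _).hom ≫ (ρ_ _).inv := by
  rw [gcup, comp_whiskerRight, Category.assoc, copy_cap, ← Category.assoc, gcodelete_cocopy]

/-- Unbending is monotone and undoes the bending, so arrows into one wire may be compared as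
predicates. -/
theorem le_of_hat_le {X : Ob k} {f g : X ⟶ W k} (h : f ▷ W k ≫ gcap ≤ g ▷ W k ≫ gcap) :
    f ≤ g := by
  rw [← bend_unbend f gcup gcap gcup_cap, ← bend_unbend g gcup gcap gcup_cap]
  exact comp_mono le_rfl (comp_mono le_rfl (comp_mono le_rfl
    (comp_mono (whiskerRight_mono _ h) le_rfl)))

theorem ex_hat {X : Ob k} (f : X ⟶ W k) :
    (ρ_ X).inv ≫ X ◁ gcodelete ≫ f ▷ W k ≫ gcap = f ≫ gdelete :=
  whiskerRight_states_left _ _ _ _ (by rw [gcap, ← Category.assoc, gcocopy_codelete])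

/-- Comparing two inputs with a third amounts to comparing each with its own copy of the third. -/
theorem gcocopy_cap : gcocopy ▷ W k ≫ gcap = (W k ⊗ W k) ◁ gcopy ≫
    tensorμ (W k) (W k) (W k) (W k) ≫ (gcap ⊗ₘ gcap) ≫ (λ_ _).hom := by
  conv_rhs => rw [← gcopy_braid, whiskerLeft_comp, Category.assoc, tensorμ_nested_right,
    associator_naturality_right_assoc, ← MonoidalCategory.whiskerLeft_comp_assoc,
    reassoc_of% copy_cap', Iso.inv_hom_id, Category.comp_id]
  rw [gcap, reassoc_of% gcocopy_assoc]

theorem copy_cap_cap : gcopy ▷ (W k ⊗ W k) ≫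
    tensorμ (W k) (W k) (W k) (W k) ≫ (gcap ⊗ₘ gcap) ≫ (λ_ _).hom = W k ◁ gcocopy ≫ gcap := by
  conv_lhs => rw [← gcopy_braid, comp_whiskerRight, Category.assoc, tensorμ_nested_left]
  have h : gcopy ▷ (W k ⊗ W k) ≫ (α_ (W k) (W k) (W k ⊗ W k)).hom ≫
      W k ◁ ((α_ (W k) (W k) (W k)).inv ≫ gcap ▷ W k ≫ (λ_ (W k)).hom) ≫ gcap =
      (α_ _ _ _).inv ≫ (gcopy ▷ W k ≫ (α_ (W k) (W k) (W k)).hom ≫ W k ◁ gcap) ▷ W k ≫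
        (ρ_ (W k)).hom ▷ W k ≫ gcap := by monoidal
  rw [h, copy_cap, comp_whiskerRight, Category.assoc, ← comp_whiskerRight_assoc (ρ_ _).inv,
    Iso.inv_hom_id, id_whiskerRight, Category.id_comp, gcap, reassoc_of% gcocopy_assoc,
    Iso.inv_hom_id_assoc]

theorem hat_cocopy {X Y : Ob k} (f : X ⟶ W k) (g : Y ⟶ W k) :
    ((f ⊗ₘ g) ≫ gcocopy) ▷ W k ≫ gcap = (X ⊗ Y) ◁ gcopy ≫ tensorμ X Y (W k) (W k) ≫
      ((f ▷ W k ≫ gcap) ⊗ₘ (g ▷ W k ≫ gcap)) ≫ (λ_ _).hom := by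
  rw [comp_whiskerRight, Category.assoc, gcocopy_cap, ← whisker_exchange_assoc,
    tensorμ_natural_left_assoc, tensorHom_comp_tensorHom_assoc]

theorem gcap_eq : gcap = gscalar (-1 : k) ▷ W k ≫ gadd ≫ gcozero := by
  rw [← gscalar_cap, ← comp_whiskerRight_assoc, gscalar_gscalar, neg_mul_neg, one_mul, gscalar_one,
    id_whiskerRight, Category.id_comp]

theorem gcap_eq' : gcap = W k ◁ gscalar (-1 : k) ≫ gadd ≫ gcozero := by
  rw [← gcap_comm, gcap_eq, ← BraidedCategory.braiding_naturality_right_assoc,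
    reassoc_of% gadd_comm]

theorem gcap_le : gcap (k := k) ≤ (gdelete ⊗ₘ gdelete) ≫ (λ_ _).hom := by
  rw [gcap_eq]
  refine (comp_mono le_rfl (comp_mono le_rfl gcozero_le_delete)).trans_eq ?_
  rw [gadd_delete, ← tensorHom_id, tensorHom_comp_tensorHom_assoc, gscalar_delete,
    Category.id_comp]

theorem gleq_eq : gleq (k := k) = (ρ_ _).inv ≫ W k ◁ gcup ≫ W k ◁ (ggeq ▷ W k) ≫
    (α_ (W k) (W k) (W k)).inv ≫ gcap ▷ W k ≫ (λ_ _).hom := by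
  have h : gcap ▷ W k ≫ (λ_ (W k)).hom = gcap ▷ W k := Category.comp_id _
  rw [h]
  symm
  refine (Category.id_comp _).trans ?_
  refine Eq.trans ?_ (Category.assoc (W k ◁ gcup) (W k ◁ (ggeq ▷ W k))
    (gcap ▷ W k : (W k ⊗ W k) ⊗ W k ⟶ 𝟙_ (Ob k) ⊗ W k)).symm
  exact congrArg (fun f => W k ◁ gcup ≫ W k ◁ (ggeq ▷ W k) ≫ f)
    (Category.id_comp (gcap ▷ W k : (W k ⊗ W k) ⊗ W k ⟶ 𝟙_ (Ob k) ⊗ W k))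

/-- `leq` is `geq` turned round by a cup and a cap; the additional cap straightens the cup. -/
theorem hat_leq : gleq ▷ W k ≫ gcap = W k ◁ ggeq (k := k) ≫ gcap := by
  rw [gleq_eq]
  exact unbend_bent _ _ _ _ gcup_cap'

theorem hat_geq : ggeq (k := k) ▷ W k ≫ gcap = W k ◁ gleq ≫ gcap := by
  rw [← gcap_comm, BraidedCategory.braiding_naturality_left_assoc, ← hat_leq,
    ← BraidedCategory.braiding_naturality_right_assoc, gcap_comm]

/-- Bent, the left side is `cap`, a test that a difference vanishes, and such a test may be weakened
to `delete`. -/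
theorem id_le_delete_codelete : 𝟙 (W k) ≤ gdelete ≫ gcodelete := by
  refine le_of_hat_le ?_
  rw [id_whiskerRight, Category.id_comp]
  refine gcap_le.trans_eq ?_
  rw [comp_whiskerRight, gcap, Category.assoc, reassoc_of% gcodelete_cocopy,
    MonoidalCategory.tensorHom_def, Category.assoc, leftUnitor_naturality]

theorem gcocopy_le : gcocopy (k := k) ≤ gdelete ▷ W k ≫ (λ_ _).hom := by
  rw [← gcodelete_cocopy, ← comp_whiskerRight_assoc]
  conv_lhs => rw [← Category.id_comp gcocopy, ← id_whiskerRight]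
  exact comp_mono (whiskerRight_mono _ id_le_delete_codelete) le_rfl

/-- One inclusion forgets a copy, using `geq ; delete = delete`; the other is lax naturality of
copying. -/
theorem geq_inter_geq : gcopy ≫ (ggeq ⊗ₘ ggeq) ≫ gcocopy = ggeq (k := k) := by
  apply le_antisymm
  · have h : ggeq (k := k) ≫ gdelete = gdelete := mk_geq .geq_delete
    refine (comp_mono le_rfl (comp_mono le_rfl gcocopy_le)).trans_eq ?_
    rw [← tensorHom_id, tensorHom_comp_tensorHom_assoc, h, Category.comp_id,
      MonoidalCategory.tensorHom_def, Category.assoc, leftUnitor_naturality,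
      reassoc_of% gcopy_counit, Iso.inv_hom_id_assoc]
  · have h : ggeq (k := k) ≫ gcopy ≤ gcopy ≫ (ggeq ⊗ₘ ggeq) := IHPLe.geq_ineq .geq_copy
    calc ggeq (k := k) = (ggeq ≫ gcopy) ≫ gcocopy := by
          rw [Category.assoc, gcopy_cocopy, Category.comp_id]
      _ ≤ _ := (comp_mono h le_rfl).trans_eq (Category.assoc _ _ _)

theorem spider : (ggeq ⊗ₘ ggeq) ≫ gcocopy ≫ gcopy ≫ (ggeq (k := k) ⊗ₘ ggeq) =
    (gcopy ⊗ₘ gcopy) ≫ ((ggeq ⊗ₘ ggeq) ⊗ₘ (ggeq ⊗ₘ ggeq)) ≫ tensorμ (W k) (W k) (W k) (W k) ≫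
      (gcocopy ⊗ₘ gcocopy) := by
  rw [tensorμ_W]
  simp only [← Category.assoc]
  exact mk_geq .spider

/-- The monoid structure given by the mirror image of `copy`. -/
@[reducible]
def cocopyMon : MonObj (W k) where
  one := gcodelete
  mul := gcocopy
  one_mul := gcodelete_cocopy
  mul_one := gcocopy_codelete
  mul_assoc := gcocopy_assoc

theorem tensorμ_gcocopy : tensorμ (W k) (W k) (W k) (W k) ≫ (gcocopy ⊗ₘ gcocopy) ≫ gcocopy =
    (gcocopy ⊗ₘ gcocopy) ≫ gcocopy :=
  @MonObj.mul_mul_mul_comm (Ob k) _ _ (W k) cocopyMon _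
    (@IsCommMonObj.mk (Ob k) _ _ _ (W k) cocopyMon gcocopy_comm)

/-- Transitivity is not an axiom. It results from closing both ends of the spider axiom with `copy`
and `cocopy`: all parallel pairs of `geq` collapse by `geq_inter_geq`. -/
theorem geq_geq : ggeq ≫ ggeq = ggeq (k := k) := by
  have h := congrArg (fun f => gcopy ≫ f ≫ gcocopy) (spider (k := k))
  simp only [Category.assoc] at h
  rw [reassoc_of% geq_inter_geq, geq_inter_geq, tensorμ_gcocopy, tensorHom_comp_tensorHom_assoc,
    tensorHom_comp_tensorHom_assoc, Category.assoc, geq_inter_geq, geq_inter_geq] at h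
  exact h

variable [IsStrictOrderedRing k]

/-- Pushing `geq` through the addition in `x - y ≥ 0` puts one `geq` on each summand, and the sign
moves the second onto `x` as well. So two of them appear, and `geq_geq` is needed to reach a single
one. -/
theorem hat_geq_geq : (ggeq ≫ ggeq) ▷ W k ≫ gcap = W k ◁ gscalar (-1 : k) ≫ gadd ≫ gpos := by
  have h : gscalar (-1 : k) ≫ ggeq = gleq ≫ gscalar (-1) :=
    mk_geq (.neg_scalar (-1) (by simp))
  rw [comp_whiskerRight, Category.assoc, hat_geq, gcap_eq', ← MonoidalCategory.whiskerLeft_comp_assoc, ← h,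
    gpos, reassoc_of% gadd_geq, MonoidalCategory.tensorHom_def, whiskerLeft_comp, Category.assoc,
    Category.assoc, whisker_exchange_assoc]

theorem hat_geq_eq_sub : ggeq ▷ W k ≫ gcap = (W k ◁ gscalar (-1 : k) ≫ gadd) ≫ gpos := by
  rw [← geq_geq, hat_geq_geq, Category.assoc]

theorem hat_leq_eq_sub : gleq ▷ W k ≫ gcap = (gscalar (-1 : k) ▷ W k ≫ gadd) ≫ gpos := by
  rw [hat_leq, ← gcap_comm, BraidedCategory.braiding_naturality_right_assoc,
    hat_geq_eq_sub, Category.assoc, ← BraidedCategory.braiding_naturality_left_assoc, reassoc_of% gadd_comm,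
    Category.assoc]

theorem posN_one : posN 1 = gpos (k := k) := by
  change (𝟙 _ ⊗ₘ gpos) ≫ (λ_ (𝟙_ (Ob k))).hom = gpos
  rw [id_tensorHom, leftUnitor_naturality]
  exact Category.id_comp _

theorem posN_two : posN 2 = (gpos (k := k) ⊗ₘ gpos) ≫ (λ_ _).hom := by
  rw [posN_succ, posN_one]

theorem del_two : del (⟨2⟩ : Ob k) = gdelete ▷ W k ≫ (λ_ _).hom ≫ gdelete := by
  have h : del (W k) = gdelete := by
    change (𝟙 _ ⊗ₘ gdelete) ≫ (λ_ (𝟙_ (Ob k))).hom = gdelete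
    rw [id_tensorHom, leftUnitor_naturality]
    exact Category.id_comp _
  refine (del_succ (W k)).trans ?_
  rw [h, MonoidalCategory.tensorHom_def, Category.assoc, leftUnitor_naturality]

/-- The circuit `(x, y) ↦ y - x`. -/
def subCirc : CircRight k 2 1 :=
  .seq (.tensor (.gen (RightGen.scalar (-1))) (.id 1)) (.gen RightGen.add)

/-- The circuit `(x, y) ↦ x - y`. -/
def subCirc' : CircRight k 2 1 :=
  .seq (.tensor (.id 1) (.gen (RightGen.scalar (-1)))) (.gen RightGen.add)

/-- The circuit `(x, y, z) ↦ (z - x, z - y)`. -/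
def boundsCirc : CircRight k 3 2 :=
  (Term.id 2 ⊞ .gen RightGen.copy) ⨾ (Term.id 1 ⊞ (Term.sym 1 1 ⊞ Term.id 1) :) ⨾
    (subCirc ⊞ subCirc)

theorem mk_circ_comp_posN {n p : ℕ} (c : CircRight k n p) :
    mk c.incl ≫ posN p = Phi (List.ofFn (eval c fun i : Fin n => (Pi.single i 1 : Fin n → k))) := by
  rw [mk_incl_eq_mat]
  exact phi_eq_Phi fun r => by rw [List.mem_ofFn]

/-- The axiom `direction` with its output bent: any two values have a common upper bound. -/
theorem del_le_ex :
    del (⟨2⟩ : Ob k) = ex (Phi [ext ![-1, 0] 1, ext ![0, -1] 1]) := by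
  have h0 : gleq (k := k) ≫ ggeq = gdelete ≫ gcodelete := mk_geq .direction
  have h := congrArg (fun f => f ▷ W k ≫ gcap) h0
  simp only [comp_whiskerRight, Category.assoc] at h
  have h1 : gcodelete ▷ W k ≫ gcap = (λ_ _).hom ≫ gdelete (k := k) := by
    rw [gcap, reassoc_of% gcodelete_cocopy]
  have h2 : gleq ▷ W k ≫ W k ◁ gleq ≫ gcap = ((gleq ⊗ₘ gleq) ≫ gcocopy) ≫ gdelete (k := k) := by
    rw [gcap, MonoidalCategory.tensorHom_def]
    simp only [Category.assoc]
  rw [h1, hat_geq, h2, ← ex_hat, hat_cocopy, hat_leq_eq_sub, ← tensorHom_comp_tensorHom,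
    Category.assoc, ← posN_two, ← del_two, tensorμ_W] at h
  rw [← h]
  -- The wiring is a right circuit, so its rows are found by evaluating it.
  refine congrArg ex (Eq.trans (b := mk boundsCirc.incl ≫ posN 2) ?_ ?_)
  · simp only [← Category.assoc]
    rfl
  · rw [mk_circ_comp_posN]
    congr 1
    simp only [List.ofFn_succ, List.ofFn_zero]
    congr 1
    · funext i
      fin_cases i <;> simp [boundsCirc, subCirc, eval, genEval, Fin.append, Fin.addCases, ext, Fin.snoc]
    · congr 1
      funext i
      fin_cases i <;> simp [boundsCirc, subCirc, eval, genEval, Fin.append, Fin.addCases, ext, Fin.snoc]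

end duality

end CircGeq

/-! ### Interpolation for finite lists and Fourier–Motzkin elimination -/

namespace CircGeq

section interpolation

variable {k : Type u} [Field k] [LinearOrder k]

theorem tensorμ_WW : tensorμ (W k ⊗ W k) (W k ⊗ W k) (W k) (W k) =
    ((W k ⊗ W k) ◁ (β_ (W k ⊗ W k) (W k)).hom ▷ W k :
      ((W k ⊗ W k) ⊗ (W k ⊗ W k)) ⊗ (W k ⊗ W k) ⟶ ((W k ⊗ W k) ⊗ W k) ⊗ ((W k ⊗ W k) ⊗ W k)) := by
  have e1 : (W k ⊗ W k) ◁ (α_ (W k ⊗ W k) (W k) (W k)).inv =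
      𝟙 ((W k ⊗ W k) ⊗ ((W k ⊗ W k) ⊗ (W k ⊗ W k))) := whiskerLeft_id _ _
  have e2 : (W k ⊗ W k) ◁ (α_ (W k) (W k ⊗ W k) (W k)).hom =
      𝟙 ((W k ⊗ W k) ⊗ ((W k ⊗ (W k ⊗ W k)) ⊗ W k)) := whiskerLeft_id _ _
  unfold tensorμ
  rw [e1, e2]
  refine (Category.id_comp _).trans ((Category.id_comp _).trans ?_)
  rw [Category.id_comp]
  exact Category.comp_id _

theorem hat_copy_geq : (gcopy ≫ (ggeq (k := k) ⊗ₘ ggeq)) ▷ (W k ⊗ W k) ≫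
    tensorμ (W k) (W k) (W k) (W k) ≫ (gcap ⊗ₘ gcap) ≫ (λ_ _).hom =
      W k ◁ ((gleq ⊗ₘ gleq) ≫ gcocopy) ≫ gcap := by
  rw [comp_whiskerRight, Category.assoc, tensorμ_natural_left_assoc,
    tensorHom_comp_tensorHom_assoc, hat_geq, ← tensorHom_comp_tensorHom_assoc,
    ← tensorμ_natural_right_assoc, ← whisker_exchange_assoc, copy_cap_cap, whiskerLeft_comp,
    Category.assoc]

variable [IsStrictOrderedRing k]

variable {V : Type*} [AddCommGroup V] [Module k V]

/-- The circuit `(x, y, z) ↦ (x - z, y - z)`. -/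
def boundsCirc' : CircRight k 3 2 :=
  (Term.id 2 ⊞ .gen RightGen.copy) ⨾ (Term.id 1 ⊞ (Term.sym 1 1 ⊞ Term.id 1) :) ⨾
    (subCirc' ⊞ subCirc')

theorem hat_geq_cocopy : ((ggeq ⊗ₘ ggeq) ≫ gcocopy) ▷ W k ≫ gcap =
    (mk boundsCirc'.incl : (W k ⊗ W k) ⊗ W k ⟶ W k ⊗ W k) ≫ posN (k := k) 2 := by
  rw [hat_cocopy, hat_geq_eq_sub, ← tensorHom_comp_tensorHom, Category.assoc, ← posN_two, tensorμ_W]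
  simp only [← Category.assoc]
  rfl

theorem hat_leq_cocopy : ((gleq ⊗ₘ gleq) ≫ gcocopy) ▷ W k ≫ gcap =
    (mk boundsCirc.incl : (W k ⊗ W k) ⊗ W k ⟶ W k ⊗ W k) ≫ posN (k := k) 2 := by
  rw [hat_cocopy, hat_leq_eq_sub, ← tensorHom_comp_tensorHom, Category.assoc, ← posN_two, tensorμ_W]
  simp only [← Category.assoc]
  rfl

/-- The circuit `(x, y, z, w, v) ↦ (x - v, y - v, v - z, v - w)`. -/
def betweenCirc : CircRight k 5 4 :=
  (Term.id 4 ⊞ .gen RightGen.copy) ⨾ (Term.id 2 ⊞ (Term.sym 2 1 ⊞ Term.id 1) :) ⨾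
    (boundsCirc' ⊞ boundsCirc)

/-- The circuit `(x, y, z, w) ↦ (x - z, y - z, x - w, y - w)`. -/
def pairsCirc : CircRight k 4 4 :=
  ((.gen RightGen.copy ⊞ .gen RightGen.copy) ⊞ Term.id 2 :) ⨾
    ((Term.id 1 ⊞ (Term.sym 1 1 ⊞ Term.id 1)) ⊞ Term.id 2 :) ⨾
      (Term.id 2 ⊞ (Term.sym 2 1 ⊞ Term.id 1) :) ⨾ (boundsCirc' ⊞ boundsCirc')

/-- The spider axiom with both outputs bent. One side has a hidden middle wire `v` with `x, y ≥ v ≥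
z, w`; the other consists of the four direct comparisons. -/
theorem pairs_eq_ex_between :
    (mk pairsCirc.incl : (⟨4⟩ : Ob k) ⟶ ⟨4⟩) ≫ posN 4 =
      ex ((mk betweenCirc.incl : (⟨4⟩ : Ob k) ⊗ W k ⟶ ⟨4⟩) ≫ posN 4) := by
  have h := congrArg (fun f => f ▷ (W k ⊗ W k) ≫
    tensorμ (W k) (W k) (W k) (W k) ≫ (gcap ⊗ₘ gcap) ≫ (λ_ _).hom) (spider (k := k))
  have e1 : ((ggeq ⊗ₘ ggeq) ≫ gcocopy ≫ gcopy ≫ (ggeq (k := k) ⊗ₘ ggeq)) ▷ (W k ⊗ W k) ≫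
      tensorμ (W k) (W k) (W k) (W k) ≫ (gcap ⊗ₘ gcap) ≫ (λ_ _).hom =
      ex ((mk betweenCirc.incl : (⟨4⟩ : Ob k) ⊗ W k ⟶ ⟨4⟩) ≫ posN 4) := by
    rw [← Category.assoc (ggeq ⊗ₘ ggeq), comp_whiskerRight, Category.assoc, hat_copy_geq,
      ← MonoidalCategory.tensorHom_def_assoc]
    conv_lhs => rw [gcap, ← Category.assoc, ← ex_hat, hat_cocopy, hat_geq_cocopy, hat_leq_cocopy,
      ← tensorHom_comp_tensorHom, Category.assoc, ← posN_add, tensorμ_WW]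
    refine congrArg ex ?_
    simp only [← Category.assoc]
    rfl
  have e2 : ((gcopy ⊗ₘ gcopy) ≫ ((ggeq (k := k) ⊗ₘ ggeq) ⊗ₘ (ggeq ⊗ₘ ggeq)) ≫
      tensorμ (W k) (W k) (W k) (W k) ≫ (gcocopy ⊗ₘ gcocopy)) ▷ (W k ⊗ W k) ≫
      tensorμ (W k) (W k) (W k) (W k) ≫ (gcap ⊗ₘ gcap) ≫ (λ_ _).hom =
      (mk pairsCirc.incl : (⟨4⟩ : Ob k) ⟶ ⟨4⟩) ≫ posN 4 := by
    rw [tensorμ_natural_assoc, tensorHom_comp_tensorHom, comp_whiskerRight, comp_whiskerRight,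
      Category.assoc, Category.assoc, tensorμ_natural_left_assoc, tensorHom_comp_tensorHom_assoc,
      hat_geq_cocopy, ← tensorHom_comp_tensorHom, Category.assoc, ← posN_add, tensorμ_WW, tensorμ_W]
    simp only [← Category.assoc]
    rfl
  exact e2.symm.trans (h.symm.trans e1)

theorem eval_pairsCirc (v : Fin 4 → V) :
    eval (pairsCirc (k := k)) v = ![v 0 + (-1 : k) • v 2, v 1 + (-1 : k) • v 2,
      v 0 + (-1 : k) • v 3, v 1 + (-1 : k) • v 3] := by
  funext i
  fin_cases i <;> rfl

theorem eval_betweenCirc (v : Fin 5 → V) :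
    eval (betweenCirc (k := k)) v = ![v 0 + (-1 : k) • v 4, v 1 + (-1 : k) • v 4,
      (-1 : k) • v 2 + v 4, (-1 : k) • v 3 + v 4] := by
  funext i
  fin_cases i <;> rfl

/-- This is the generic instance, on four coordinates; substituting linear forms for them gives
every case of two bounds against two. -/
theorem Phi_pairs : Phi (k := k) [![1, 0, -1, 0], ![0, 1, -1, 0], ![1, 0, 0, -1], ![0, 1, 0, -1]] =
    ex (n := 4) (Phi [ext ![1, 0, 0, 0] (-1), ext ![0, 1, 0, 0] (-1), ext ![0, 0, -1, 0] 1,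
      ext ![0, 0, 0, -1] 1]) := by
  refine Eq.trans ?_ (pairs_eq_ex_between.trans (congrArg ex ?_))
  · rw [mk_circ_comp_posN, eval_pairsCirc]
    congr 1
    simp only [List.ofFn_succ, List.ofFn_zero, List.cons.injEq, and_true]
    refine ⟨?_, ?_, ?_, ?_⟩ <;> funext i <;> fin_cases i <;> simp
  · rw [mk_circ_comp_posN, eval_betweenCirc]
    congr 1
    simp only [List.ofFn_succ, List.ofFn_zero, List.cons.injEq, and_true]
    refine ⟨?_, ?_, ?_, ?_⟩ <;> funext i <;> fin_cases i <;> simp [ext, Fin.snoc] <;> rfl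

theorem mat_comp_ex_Phi {n p : ℕ} (S : Fin p → Fin n → k) (L : List (Fin (p + 1) → k)) :
    mat S ≫ ex (Phi L) =
      ex (Phi (L.map fun r => ext (∑ j, r j.castSucc • S j) (r (Fin.last p)))) := by
  rw [comp_ex, whiskerRight_comp_Phi]

theorem interpolates_nil_pair {n : ℕ} (c d : Fin n → k) : Interpolates [] [c, d] := by
  -- The signs arise because `bounds` writes a lower bound as `c + t ≥ 0`, so that `t ≥ -c`.
  have h := congrArg (mat ![-c, -d] ≫ ·) (del_le_ex (k := k))
  simp only [mat_comp_ex_Phi, mat_comp_del] at h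
  unfold Interpolates
  refine le_of_eq (Eq.trans (b := del ⟨n⟩) (Category.comp_id _) (h.trans (congrArg ex ?_)))
  congr 1
  simp only [bounds, List.map, ext_castSucc, ext_last, Fin.sum_univ_two]
  simp

theorem interpolates_pair_pair {n : ℕ} (a b c d : Fin n → k) : Interpolates [a, b] [c, d] := by
  have h := congrArg (mat ![a, b, -c, -d] ≫ ·) (Phi_pairs (k := k))
  simp only [mat_comp_ex_Phi, mat_comp_Phi] at h
  unfold Interpolates
  refine le_of_eq (Eq.trans (Phi_congr ?_) (h.trans (congrArg ex ?_)))
  · simp [sums, Fin.sum_univ_four]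
    grind
  · congr 1
    simp only [bounds, List.map, ext_castSucc, ext_last, Fin.sum_univ_four]
    simp

theorem interpolates_nil_nil {n : ℕ} : Interpolates (k := k) (n := n) [] [] := by
  refine le_of_eq ((ex_wk _).symm.trans (congrArg ex (wk_comp_Phi _)))

theorem interpolates_pair_nil {n : ℕ} (a b : Fin n → k) : Interpolates [a, b] [] :=
  (interpolates_nil_pair a b).swap

/-- Lower bounds are adjoined one by one. After exchanging the two sides, `Interpolates.cons` only
asks for pairs against the fixed pair. -/
theorem interpolates_pair {n : ℕ} (a b : Fin n → k) (V : List (Fin n → k)) :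
    Interpolates [a, b] V := by
  induction V with
  | nil => exact interpolates_pair_nil a b
  | cons c V ih =>
    have h2 : ∀ x y : Fin (n + 1) → k, Interpolates [x, y] ([a, b].map (ext · 0)) := fun x y =>
      interpolates_pair_pair x y (ext a 0) (ext b 0)
    exact (Interpolates.cons h2 ih.swap).swap

theorem interpolates_nil {n : ℕ} (V : List (Fin n → k)) : Interpolates [] V := by
  induction V with
  | nil => exact interpolates_nil_nil
  | cons c V ih =>
    have h2 : ∀ x y : Fin (n + 1) → k, Interpolates [x, y] (([] : List (Fin n → k)).map (ext · 0)) :=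
      interpolates_pair_nil
    exact (Interpolates.cons h2 ih.swap).swap

theorem interpolates {n : ℕ} (U V : List (Fin n → k)) : Interpolates U V := by
  induction U with
  | nil => exact interpolates_nil V
  | cons a U ih => exact ih.cons fun x y => interpolates_pair x y _

/-- Fourier–Motzkin elimination of the last variable, on systems of homogeneous inequalities. -/
theorem exists_ex_Phi_eq {n : ℕ} (L : List (Fin (n + 1) → k)) : ∃ L' : List (Fin n → k),
    ex (Phi L) = Phi L' ∧ ∀ r ∈ L', InCone (k := k) {r | r ∈ L} (ext r 0) := by
  classical
  -- Rows not involving the last variable are kept. The others are scaled by a positive factor so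
  -- that its coefficient becomes `-1` in an upper bound and `1` in a lower bound.
  let hd : (Fin (n + 1) → k) → Fin n → k := fun r i => r i.castSucc
  let sc : (Fin (n + 1) → k) → Fin n → k := fun r => |r (Fin.last n)|⁻¹ • hd r
  let L0 := (L.filter fun r => r (Fin.last n) = 0).map hd
  let U := (L.filter fun r => r (Fin.last n) < 0).map sc
  let V := (L.filter fun r => 0 < r (Fin.last n)).map sc
  have hL0 : ∀ r, r ∈ L0 ↔ ext r 0 ∈ L := by
    intro r
    constructor
    · intro hr
      obtain ⟨s, hs, rfl⟩ := List.mem_map.1 hr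
      obtain ⟨hs, h0⟩ := List.mem_filter.1 hs
      rw [← of_decide_eq_true h0]
      exact (ext_self s).symm ▸ hs
    · intro hr
      refine List.mem_map.2 ⟨_, List.mem_filter.2 ⟨hr, by simp⟩, ?_⟩
      funext i
      simp [hd]
  have hsc : ∀ r : Fin (n + 1) → k,
      ext (sc r) (|r (Fin.last n)|⁻¹ * r (Fin.last n)) = |r (Fin.last n)|⁻¹ • r := by
    intro r
    have h := smul_ext (fun i => r i.castSucc) |r (Fin.last n)|⁻¹ (r (Fin.last n))
    rw [ext_self] at h
    exact h.symm
  have hneg : ∀ r : Fin (n + 1) → k, r (Fin.last n) < 0 →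
      |r (Fin.last n)|⁻¹ * r (Fin.last n) = -1 := by
    intro r h
    rw [abs_of_neg h]
    rw [inv_neg, neg_mul, inv_mul_cancel₀ h.ne]
  have hpos : ∀ r : Fin (n + 1) → k, 0 < r (Fin.last n) →
      |r (Fin.last n)|⁻¹ * r (Fin.last n) = 1 := by
    intro r h
    rw [abs_of_pos h, inv_mul_cancel₀ h.ne']
  have hU : ∀ u ∈ U, InCone (k := k) {r | r ∈ L} (ext u (-1)) := by
    intro u hu
    obtain ⟨s, hs, rfl⟩ := List.mem_map.1 hu
    obtain ⟨hs, h0⟩ := List.mem_filter.1 hs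
    rw [← hneg s (of_decide_eq_true h0), hsc]
    exact .smul (by positivity) (.of_mem hs)
  have hV : ∀ u ∈ V, InCone (k := k) {r | r ∈ L} (ext u 1) := by
    intro u hu
    obtain ⟨s, hs, rfl⟩ := List.mem_map.1 hu
    obtain ⟨hs, h0⟩ := List.mem_filter.1 hs
    rw [← hpos s (of_decide_eq_true h0), hsc]
    exact .smul (by positivity) (.of_mem hs)
  -- The last variable cancels in `u + v`. This certificate gives the easy inclusion and is returned
  -- for use in Farkas' lemma.
  have hc : ∀ r ∈ L0 ++ sums U V, InCone (k := k) {r | r ∈ L} (ext r 0) := by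
    intro r hr
    rcases List.mem_append.1 hr with hr | hr
    · exact .of_mem ((hL0 r).1 hr)
    · obtain ⟨u, hu, v, hv, rfl⟩ := mem_sums.1 hr
      simpa [ext_add] using (hU u hu).add (hV v hv)
  refine ⟨L0 ++ sums U V, le_antisymm ?_ ?_, hc⟩
  · rw [← ex_wk (Phi (L0 ++ sums U V)), wk_comp_Phi]
    refine ex_mono (Phi_mono fun r hr => ?_)
    obtain ⟨r, hr', rfl⟩ := List.mem_map.1 hr
    exact hc r hr'
  -- Interpolation gives the scaled bounds, and each original row is a nonnegative multiple of one
  -- of them or has last coefficient zero.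
  · rw [← conj_Phi]
    refine (conj_mono le_rfl (interpolates U V)).trans ?_
    rw [conj_ex, wk_comp_Phi]
    refine (congrArg ex (conj_Phi _ _)).le.trans (ex_mono (Phi_mono fun r hr => ?_))
    have hr' : r = |r (Fin.last n)| • |r (Fin.last n)|⁻¹ • r ∨ r (Fin.last n) = 0 := by
      by_cases h : r (Fin.last n) = 0
      · exact .inr h
      · exact .inl (by rw [smul_inv_smul₀ (abs_ne_zero.2 h)])
    rcases lt_trichotomy (r (Fin.last n)) 0 with h | h | h
    · rw [hr'.resolve_right h.ne, ← hsc, hneg r h]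
      refine .smul (abs_nonneg _) (.of_mem (List.mem_append_right _ (mem_bounds.2 (.inl
        ⟨_, List.mem_map_of_mem (List.mem_filter.2 ⟨hr, decide_eq_true h⟩), rfl⟩))))
    · refine .of_mem (List.mem_append_left _ (List.mem_map.2 ⟨hd r, (hL0 _).2 ?_, ?_⟩)) <;>
        rw [← h, ext_self]
      exact hr
    · rw [hr'.resolve_right h.ne', ← hsc, hpos r h]
      refine .smul (abs_nonneg _) (.of_mem (List.mem_append_right _ (mem_bounds.2 (.inr
        ⟨_, List.mem_map_of_mem (List.mem_filter.2 ⟨hr, decide_eq_true h⟩), rfl⟩))))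

end interpolation

end CircGeq

/-! ### Bundled cups and caps, and the bent form of a predicate -/

namespace CircGeq

section coherence

variable {C : Type*} [Category* C] [MonoidalCategory C] [SymmetricCategory C]

theorem whisker_state_move {A B X : C} (c : 𝟙_ C ⟶ X) :
    (ρ_ (A ⊗ B)).inv ≫ (A ⊗ B) ◁ c ≫ (α_ A B X).hom ≫ A ◁ (β_ B X).hom ≫ (α_ A X B).inv =
      (ρ_ A).inv ▷ B ≫ (A ◁ c) ▷ B := by
  have h : (ρ_ (A ⊗ B)).inv ≫ (A ⊗ B) ◁ c ≫ (α_ A B X).hom ≫ A ◁ (β_ B X).hom ≫ (α_ A X B).inv =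
    (ρ_ (A ⊗ B)).inv ≫ (α_ A B (𝟙_ C)).hom ≫ A ◁ (B ◁ c ≫ (β_ B X).hom) ≫ (α_ A X B).inv := by
    monoidal
  rw [h, BraidedCategory.braiding_naturality_right, braiding_tensorUnit_right]
  monoidal

theorem whisker_effect_move {A B X : C} (f : X ⟶ 𝟙_ C) (P : A ⊗ B ⟶ 𝟙_ C) :
    (A ◁ f) ▷ B ≫ (ρ_ A).hom ▷ B ≫ P =
      (α_ A X B).hom ≫ A ◁ (β_ X B).hom ≫ (α_ A B X).inv ≫ (P ⊗ₘ f) ≫ (λ_ _).hom := by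
  have h : (α_ A X B).hom ≫ A ◁ (β_ X B).hom ≫ (α_ A B X).inv ≫ (P ⊗ₘ f) ≫ (λ_ _).hom =
    (α_ A X B).hom ≫ A ◁ ((β_ X B).hom ≫ B ◁ f) ≫ (α_ A B (𝟙_ C)).inv ≫ (ρ_ _).hom ≫ P := by
    rw [MonoidalCategory.tensorHom_def']
    monoidal
  rw [h, ← BraidedCategory.braiding_naturality_left, braiding_tensorUnit_left]
  monoidal

theorem tensorμ_tensorμ (X Y X' Y' : C) : tensorμ X Y X' Y' ≫ tensorμ X X' Y Y' = 𝟙 _ := by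
  unfold tensorμ
  simp only [Category.assoc, Iso.inv_hom_id_assoc]
  simp only [← MonoidalCategory.whiskerLeft_comp_assoc,
    Iso.hom_inv_id_assoc, ← comp_whiskerRight_assoc, SymmetricCategory.symmetry, id_whiskerRight,
    Category.id_comp]
  simp

theorem snake_unit : 𝟙_ C ◁ (λ_ (𝟙_ C)).inv ≫ (α_ (𝟙_ C) (𝟙_ C) (𝟙_ C)).inv ≫
    (λ_ (𝟙_ C)).hom ▷ 𝟙_ C = (ρ_ (𝟙_ C)).hom ≫ (λ_ (𝟙_ C)).inv := by monoidal

/-- Coherence for `tensorμ` separates the interleaved cups and caps into the two given snakes, one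
for each factor. -/
theorem snake_tensor {Y Z : C} {c : 𝟙_ C ⟶ Y ⊗ Y} {e : Y ⊗ Y ⟶ 𝟙_ C} {d : 𝟙_ C ⟶ Z ⊗ Z}
    {e' : Z ⊗ Z ⟶ 𝟙_ C} (h : Y ◁ c ≫ (α_ Y Y Y).inv ≫ e ▷ Y = (ρ_ Y).hom ≫ (λ_ Y).inv)
    (h' : Z ◁ d ≫ (α_ Z Z Z).inv ≫ e' ▷ Z = (ρ_ Z).hom ≫ (λ_ Z).inv) :
    (Y ⊗ Z) ◁ ((λ_ (𝟙_ C)).inv ≫ (c ⊗ₘ d) ≫ tensorμ Y Y Z Z) ≫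
      (α_ (Y ⊗ Z) (Y ⊗ Z) (Y ⊗ Z)).inv ≫ (tensorμ Y Z Y Z ≫ (e ⊗ₘ e') ≫ (λ_ _).hom) ▷ (Y ⊗ Z) =
      (ρ_ (Y ⊗ Z)).hom ≫ (λ_ (Y ⊗ Z)).inv := by
  have h1 : (Y ⊗ Z) ◁ tensorμ Y Y Z Z ≫ (α_ (Y ⊗ Z) (Y ⊗ Z) (Y ⊗ Z)).inv ≫
      tensorμ Y Z Y Z ▷ (Y ⊗ Z) = tensorμ Y Z (Y ⊗ Y) (Z ⊗ Z) ≫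
        ((α_ Y Y Y).inv ⊗ₘ (α_ Z Z Z).inv) ≫ tensorμ (Y ⊗ Y) Y (Z ⊗ Z) Z := by
    have a := tensor_associativity Y Z Y Z Y Z
    have b : (Y ⊗ Z) ◁ tensorμ Y Y Z Z ≫ (Y ⊗ Z) ◁ tensorμ Y Z Y Z = 𝟙 _ := by
      rw [← MonoidalCategory.whiskerLeft_comp, tensorμ_tensorμ, MonoidalCategory.whiskerLeft_id]
    have a' := congrArg (fun f => (Y ⊗ Z) ◁ tensorμ Y Y Z Z ≫ (α_ (Y ⊗ Z) (Y ⊗ Z) (Y ⊗ Z)).inv ≫ f ≫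
      ((α_ Y Y Y).inv ⊗ₘ (α_ Z Z Z).inv) ≫ tensorμ (Y ⊗ Y) Y (Z ⊗ Z) Z) a
    simp only [Category.assoc, tensorHom_comp_tensorHom_assoc, Iso.hom_inv_id, id_tensorHom_id,
      Category.id_comp, Iso.inv_hom_id_assoc, reassoc_of% b, tensorμ_tensorμ, Category.comp_id] at a'
    exact a'
  have h2 : tensorμ (Y ⊗ Y) Y (Z ⊗ Z) Z ≫ (e ⊗ₘ e') ▷ (Y ⊗ Z) =
      (e ▷ Y ⊗ₘ e' ▷ Z) ≫ tensorμ (𝟙_ C) Y (𝟙_ C) Z := by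
    have h := tensorμ_natural e (𝟙 Y) e' (𝟙 Z)
    rw [tensorHom_id, tensorHom_id, id_tensorHom_id, tensorHom_id] at h
    exact h.symm
  simp only [MonoidalCategory.whiskerLeft_comp, comp_whiskerRight, Category.assoc]
  rw [reassoc_of% h1, reassoc_of% h2, tensorμ_natural_right_assoc,
    tensorHom_comp_tensorHom_assoc, tensorHom_comp_tensorHom_assoc, Category.assoc, Category.assoc,
    h, h', ← tensorHom_comp_tensorHom, Category.assoc]
  have h3 : ((λ_ Y).inv ⊗ₘ (λ_ Z).inv) ≫ tensorμ (𝟙_ C) Y (𝟙_ C) Z ≫ (λ_ (𝟙_ C)).hom ▷ (Y ⊗ Z) =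
      (λ_ (Y ⊗ Z)).inv := by
    rw [← cancel_mono (λ_ (Y ⊗ Z)).hom, Category.assoc, Category.assoc, ← leftUnitor_monoidal,
      tensorHom_comp_tensorHom, Iso.inv_hom_id, Iso.inv_hom_id, id_tensorHom_id, Iso.inv_hom_id]
  rw [h3, tensor_right_unitality Y Z]
  simp only [Category.assoc]

end coherence

theorem comp_eqToHom_comp {C : Type*} [Category* C] {X Y Z U V A B D : C} (f : X ⟶ Y) (g : Z ⟶ V)
    (h0 : X = X) (h1 : Y = A) (h2 : A = Z) (h3 : V = U) (h4 : Y = B) (h5 : B = Z) (h6 : V = D)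
    (h7 : D = U) : (eqToHom h0 ≫ f ≫ eqToHom h1) ≫ eqToHom h2 ≫ g ≫ eqToHom h3 =
      f ≫ eqToHom h4 ≫ eqToHom h5 ≫ g ≫ eqToHom h6 ≫ eqToHom h7 := by
  simp

section normalForm

variable {k : Type u} [Field k] [LinearOrder k]

/-- The cap on a bundle of wires. -/
def capN : ∀ n : ℕ, (⟨n⟩ : Ob k) ⊗ ⟨n⟩ ⟶ 𝟙_ (Ob k)
  | 0 => (λ_ (𝟙_ (Ob k))).hom
  | n + 1 => (tensorμ (⟨n⟩ : Ob k) (W k) ⟨n⟩ (W k) ≫ (capN n ⊗ₘ gcap) ≫ (λ_ _).hom :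
      ((⟨n⟩ : Ob k) ⊗ W k) ⊗ ((⟨n⟩ : Ob k) ⊗ W k) ⟶ 𝟙_ (Ob k))

theorem mk_copyN (n : ℕ) : (mk (copyN n) : (⟨n⟩ : Ob k) ⟶ ⟨n⟩ ⊗ ⟨n⟩) = dup ⟨n⟩ := by
  induction n with
  | zero => rfl
  | succ n ih =>
    refine Eq.trans ?_ (dup_succ ⟨n⟩).symm
    rw [← ih]
    have e : tensorμ (⟨n⟩ : Ob k) ⟨n⟩ (W k) (W k) =
        eqToHom (tensor_assoc_eq (⟨n⟩ : Ob k) ⟨n⟩ (W k ⊗ W k)) ≫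
        (𝟙 (⟨n⟩ : Ob k) ⊗ₘ eqToHom (tensor_assoc_eq (⟨n⟩ : Ob k) (W k) (W k)).symm) ≫
        (mk (Term.id n ⊞ (Term.sym n 1 ⊞ Term.id 1)) :
          (⟨n⟩ : Ob k) ⊗ ((⟨n⟩ ⊗ W k) ⊗ W k) ⟶ ⟨n⟩ ⊗ ((W k ⊗ ⟨n⟩) ⊗ W k)) ≫
        (𝟙 (⟨n⟩ : Ob k) ⊗ₘ eqToHom (tensor_assoc_eq (W k) (⟨n⟩ : Ob k) (W k))) ≫
        eqToHom (tensor_assoc_eq (⟨n⟩ : Ob k) (W k) (⟨n⟩ ⊗ W k)).symm := by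
      rfl
    rw [tensorHom_eqToHom, tensorHom_eqToHom] at e
    rw [e, copyN, mk_seq, mk_cast, mk_cast]
    exact comp_eqToHom_comp (mk (copyN n) ⊗ₘ gcopy) _ _ _ _ _ _ _ _ _

theorem mk_cupN_succ (n : ℕ) : (mk (cupN (n + 1)) : 𝟙_ (Ob k) ⟶ ⟨n + 1⟩ ⊗ ⟨n + 1⟩) =
    ((λ_ (𝟙_ (Ob k))).inv ≫ ((mk (cupN n) : 𝟙_ (Ob k) ⟶ ⟨n⟩ ⊗ ⟨n⟩) ⊗ₘ gcup) ≫
      tensorμ (⟨n⟩ : Ob k) ⟨n⟩ (W k) (W k) :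
        𝟙_ (Ob k) ⟶ ((⟨n⟩ : Ob k) ⊗ W k) ⊗ ((⟨n⟩ : Ob k) ⊗ W k)) := by
  have h : ∀ n, (mk (cupN n) : 𝟙_ (Ob k) ⟶ ⟨n⟩ ⊗ ⟨n⟩) = mk (codeleteN n) ≫ dup ⟨n⟩ := fun n => by
    rw [← mk_copyN]
    rfl
  have h' : (mk (codeleteN (n + 1)) : 𝟙_ (Ob k) ⟶ ⟨n + 1⟩) =
      ((λ_ (𝟙_ (Ob k))).inv ≫ (mk (codeleteN n) ⊗ₘ gcodelete) :
        𝟙_ (Ob k) ⟶ (⟨n⟩ : Ob k) ⊗ W k) := (Category.id_comp _).symm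
  rw [h, h, h', gcup, ← tensorHom_comp_tensorHom, Category.assoc, Category.assoc]
  exact congrArg (fun f => (λ_ (𝟙_ (Ob k))).inv ≫
    ((mk (codeleteN n) : 𝟙_ (Ob k) ⟶ ⟨n⟩) ⊗ₘ gcodelete) ≫ f) (dup_succ ⟨n⟩)

theorem cupN_capN (n : ℕ) : (⟨n⟩ : Ob k) ◁ (mk (cupN n) : 𝟙_ (Ob k) ⟶ ⟨n⟩ ⊗ ⟨n⟩) ≫
    (α_ (⟨n⟩ : Ob k) ⟨n⟩ ⟨n⟩).inv ≫ capN n ▷ (⟨n⟩ : Ob k) = (ρ_ (⟨n⟩ : Ob k)).hom ≫ (λ_ _).inv := by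
  induction n with
  | zero =>
    have h : (mk (cupN 0) : 𝟙_ (Ob k) ⟶ 𝟙_ (Ob k) ⊗ 𝟙_ (Ob k)) = (λ_ (𝟙_ (Ob k))).inv :=
      Category.id_comp (𝟙 (𝟙_ (Ob k)))
    exact (congrArg (fun f => 𝟙_ (Ob k) ◁ f ≫ (α_ (𝟙_ (Ob k)) (𝟙_ (Ob k)) (𝟙_ (Ob k))).inv ≫
      (λ_ (𝟙_ (Ob k))).hom ▷ 𝟙_ (Ob k)) h).trans snake_unit
  | succ n ih =>
    rw [mk_cupN_succ]
    exact snake_tensor ih gcup_cap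

theorem mk_geqN_cozeroN (p : ℕ) : (mk (geqN p ⨾ cozeroN p) : (⟨p⟩ : Ob k) ⟶ 𝟙_ (Ob k)) = posN p := by
  induction p with
  | zero => exact Category.id_comp (𝟙 (𝟙_ (Ob k)))
  | succ p ih =>
    rw [posN_succ, ← ih, gpos]
    refine (tensorHom_comp_tensorHom (mk (geqN p) : (⟨p⟩ : Ob k) ⟶ ⟨p⟩) ggeq
      (mk (cozeroN p) : (⟨p⟩ : Ob k) ⟶ 𝟙_ (Ob k)) gcozero).trans ?_
    exact (Category.comp_id _).symm

/-- Turning the last `m` inputs of a predicate into outputs. -/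
def bend {n m : ℕ} (P : (⟨n⟩ : Ob k) ⊗ ⟨m⟩ ⟶ 𝟙_ (Ob k)) : (⟨n⟩ : Ob k) ⟶ ⟨m⟩ :=
  (ρ_ (⟨n⟩ : Ob k)).inv ≫ (⟨n⟩ : Ob k) ◁ (mk (cupN m) : 𝟙_ (Ob k) ⟶ ⟨m⟩ ⊗ ⟨m⟩) ≫
    (α_ (⟨n⟩ : Ob k) ⟨m⟩ ⟨m⟩).inv ≫ P ▷ (⟨m⟩ : Ob k) ≫ (λ_ (⟨m⟩ : Ob k)).hom

theorem bend_mono {n m : ℕ} {P Q : (⟨n⟩ : Ob k) ⊗ ⟨m⟩ ⟶ 𝟙_ (Ob k)} (h : P ≤ Q) :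
    bend P ≤ bend Q :=
  comp_mono le_rfl (comp_mono le_rfl (comp_mono le_rfl
    (comp_mono (whiskerRight_mono _ h) le_rfl)))

theorem bend_capN {n m : ℕ} (f : (⟨n⟩ : Ob k) ⟶ ⟨m⟩) : bend (f ▷ (⟨m⟩ : Ob k) ≫ capN m) = f :=
  bend_unbend f _ _ (cupN_capN m)

theorem mk_conic {n m p : ℕ} (t : CircGeq k (n + m) p) :
    mk (conic t) = bend (mk t ≫ posN p) := by
  rw [conic, mk_seq, mk_cast, mk_cast, bend, ← mk_geqN_cozeroN]
  have h : mk t ≫ mk (geqN p ⨾ cozeroN p) = mk (t ⨾ geqN p ⨾ cozeroN p) :=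
    (Category.assoc (mk t) (mk (geqN p)) (mk (cozeroN p))).symm
  rw [h]
  simp only [Category.assoc, eqToHom_refl, Category.id_comp]
  exact (Category.id_comp _).symm

end normalForm

end CircGeq

/-! ### Polyhedral normal form by pulling systems back along generators -/

namespace CircGeq

section normalForm

variable {k : Type u} [Field k] [LinearOrder k]

theorem isRight_leftUnitor_inv (X : Ob k) : IsRight (λ_ X).inv :=
  isRight_eqToHom (unit_tensor_eq X).symm

theorem isRight_rightUnitor (X : Ob k) : IsRight (ρ_ X).hom := isRight_id X

theorem isRight_rightUnitor_inv (X : Ob k) : IsRight (ρ_ X).inv := isRight_id X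

theorem isRight_gcopy : IsRight (gcopy (k := k)) := ⟨.gen .copy, rfl⟩

theorem isRight_gscalar (a : k) : IsRight (gscalar a) := ⟨.gen (.scalar a), rfl⟩

theorem isRight_gadd : IsRight (gadd (k := k)) := ⟨.gen .add, rfl⟩

variable [IsStrictOrderedRing k]

/-- The predicate is given by a system of homogeneous linear inequalities. -/
def IsPoly {X : Ob k} (P : X ⟶ 𝟙_ (Ob k)) : Prop := ∃ L : List (Fin X.len → k), P = Phi L

theorem IsRight.isPoly {X : Ob k} {p : ℕ} {f : X ⟶ ⟨p⟩} (hf : IsRight f) :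
    IsPoly (f ≫ posN p) := by
  obtain ⟨c, rfl⟩ := hf
  exact ⟨_, mk_circ_comp_posN c⟩

theorem IsPoly.exists_right {X : Ob k} {P : X ⟶ 𝟙_ (Ob k)} (hP : IsPoly P) :
    ∃ (p : ℕ) (f : X ⟶ ⟨p⟩), IsRight f ∧ P = f ≫ posN p := by
  obtain ⟨L, rfl⟩ := hP
  exact ⟨_, mat L.get, isRight_mat _, rfl⟩

theorem IsPoly.comp {X Y : Ob k} {f : X ⟶ Y} {P : Y ⟶ 𝟙_ (Ob k)} (hf : IsRight f)
    (hP : IsPoly P) : IsPoly (f ≫ P) := by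
  obtain ⟨p, g, hg, rfl⟩ := hP.exists_right
  rw [← Category.assoc]
  exact (hf.comp hg).isPoly

theorem IsPoly.ex {X : Ob k} {P : X ⊗ W k ⟶ 𝟙_ (Ob k)} (hP : IsPoly P) : IsPoly (ex P) := by
  obtain ⟨L, rfl⟩ := hP
  obtain ⟨L', h, -⟩ := exists_ex_Phi_eq L
  exact ⟨L', h⟩

theorem IsPoly.tensor_gpos {X : Ob k} {P : X ⟶ 𝟙_ (Ob k)} (hP : IsPoly P) :
    IsPoly ((P ⊗ₘ gpos) ≫ (λ_ _).hom) := by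
  obtain ⟨p, f, hf, rfl⟩ := hP.exists_right
  have h : ((f ≫ posN p) ⊗ₘ gpos) ≫ (λ_ _).hom = f ▷ W k ≫ posN (p + 1) := by
    rw [posN_succ, ← tensorHom_id, tensorHom_comp_tensorHom_assoc, Category.id_comp]
  rw [h]
  exact IsRight.isPoly (p := p + 1) (hf.whiskerRight (W k))

/-- Weakest preconditions along the arrow preserve systems of inequalities. -/
def PullsBack {X Y : Ob k} (f : X ⟶ Y) : Prop :=
  ∀ (A B : Ob k) (P : (A ⊗ Y) ⊗ B ⟶ 𝟙_ (Ob k)), IsPoly P → IsPoly ((A ◁ f) ▷ B ≫ P)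

theorem IsRight.pullsBack {X Y : Ob k} {f : X ⟶ Y} (hf : IsRight f) : PullsBack f :=
  fun A B _ hP => hP.comp ((hf.whiskerLeft A).whiskerRight B)

theorem PullsBack.comp {X Y Z : Ob k} {f : X ⟶ Y} {g : Y ⟶ Z} (hf : PullsBack f)
    (hg : PullsBack g) : PullsBack (f ≫ g) := by
  intro A B P hP
  rw [whiskerLeft_comp, comp_whiskerRight, Category.assoc]
  exact hf A B _ (hg A B P hP)

theorem PullsBack.whiskerRight {X Y : Ob k} {f : X ⟶ Y} (hf : PullsBack f) (Z : Ob k) :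
    PullsBack (f ▷ Z) := by
  intro A B P hP
  have h : (A ◁ f ▷ Z) ▷ B ≫ P = ((α_ A X Z).inv ▷ B ≫ (α_ (A ⊗ X) Z B).hom) ≫
      (A ◁ f) ▷ (Z ⊗ B) ≫ ((α_ (A ⊗ Y) Z B).inv ≫ (α_ A Y Z).hom ▷ B) ≫ P := by
    simp
  rw [h]
  exact (hf _ _ _ (hP.comp ((isRight_assoc_inv _ _ _).comp
    ((isRight_assoc _ _ _).whiskerRight _)))).comp
      (((isRight_assoc_inv _ _ _).whiskerRight _).comp (isRight_assoc _ _ _))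

theorem PullsBack.whiskerLeft {X Y : Ob k} {f : X ⟶ Y} (hf : PullsBack f) (Z : Ob k) :
    PullsBack (Z ◁ f) := by
  intro A B P hP
  have h : (A ◁ Z ◁ f) ▷ B ≫ P = (α_ A Z X).inv ▷ B ≫
      ((A ⊗ Z) ◁ f) ▷ B ≫ (α_ A Z Y).hom ▷ B ≫ P := by
    simp
  rw [h]
  exact (hf _ _ _ (hP.comp ((isRight_assoc _ _ _).whiskerRight _))).comp
      ((isRight_assoc_inv _ _ _).whiskerRight _)

/-- The contexts `A` and `B` in `PullsBack` absorb the wires running alongside each factor; this is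
the reason for quantifying over them. -/
theorem PullsBack.tensor {X Y X' Y' : Ob k} {f : X ⟶ Y} {g : X' ⟶ Y'} (hf : PullsBack f)
    (hg : PullsBack g) : PullsBack (f ⊗ₘ g) := by
  rw [MonoidalCategory.tensorHom_def]
  exact (hf.whiskerRight _).comp (hg.whiskerLeft _)

/-- The new wire is moved past `B` to the last place, where it is a quantified variable and can be
eliminated. -/
theorem pullsBack_gcodelete : PullsBack (gcodelete (k := k)) := by
  intro A B P hP
  have h : (A ◁ gcodelete) ▷ B ≫ P = (ρ_ A).hom ▷ B ≫
      ex (((α_ A B (W k)).hom ≫ A ◁ (β_ B (W k)).hom ≫ (α_ A (W k) B).inv) ≫ P) := by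
    have h1 := whisker_state_move (A := A) (B := B) (gcodelete (k := k))
    have h2 : ex (((α_ A B (W k)).hom ≫ A ◁ (β_ B (W k)).hom ≫ (α_ A (W k) B).inv) ≫ P) =
        (ρ_ A).inv ▷ B ≫ (A ◁ gcodelete) ▷ B ≫ P := by
      rw [← Category.assoc ((ρ_ A).inv ▷ B), ← h1]
      simp only [Category.assoc]
      rfl
    rw [h2, ← comp_whiskerRight_assoc (ρ_ A).hom, Iso.hom_inv_id, id_whiskerRight, Category.id_comp]
  rw [h]
  exact (IsPoly.ex (X := A ⊗ B) (hP.comp ((isRight_assoc _ _ _).comp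
    (((isRight_braid _ _).whiskerLeft _).comp (isRight_assoc_inv _ _ _))))).comp
      ((isRight_rightUnitor _).whiskerRight _)

theorem pullsBack_gpos : PullsBack (gpos (k := k)) := by
  intro A B P hP
  have h : (A ◁ gpos) ▷ B ≫ P = (A ◁ gpos) ▷ B ≫ (ρ_ A).hom ▷ B ≫ (ρ_ A).inv ▷ B ≫ P := by
    rw [← comp_whiskerRight_assoc (ρ_ A).hom, Iso.hom_inv_id, id_whiskerRight, Category.id_comp]
  rw [h, whisker_effect_move]
  exact ((((hP.comp ((isRight_rightUnitor_inv _).whiskerRight _)).tensor_gpos).comp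
    (isRight_assoc_inv _ _ _)).comp ((isRight_braid _ _).whiskerLeft _)).comp (isRight_assoc _ _ _)

/-- Antisymmetry: `x = 0` is the conjunction of `x ≥ 0` and `-x ≥ 0`. -/
theorem gcozero_eq : gcozero (k := k) = gcopy ≫ (gpos ⊗ₘ gscalar (-1 : k) ≫ gpos) ≫ (λ_ _).hom := by
  have hs : gscalar (-1 : k) ≫ gcozero = gcozero := gscalar_cozero (by simp)
  apply le_antisymm
  · conv_lhs => rw [gcozero_copy]
    refine comp_mono le_rfl (comp_mono (tensor_mono gcozero_le_gpos ?_) le_rfl)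
    conv_lhs => rw [← hs]
    exact comp_mono le_rfl gcozero_le_gpos
  · have h : gcopy ≫ (ggeq ⊗ₘ gleq) ≫ gcocopy ≤ 𝟙 (W k) :=
      (congrArg mk rfl).le.trans' (Category.assoc _ _ _).ge |>.trans (IHPLe.geq_ineq .antisymm)
    have e : gscalar (-1 : k) ≫ ggeq = gleq ≫ gscalar (-1) := mk_geq (.neg_scalar (-1) (by simp))
    have e2 : gcopy ≫ (gpos ⊗ₘ gscalar (-1 : k) ≫ gpos) ≫ (λ_ _).hom =
        (gcopy ≫ (ggeq ⊗ₘ gleq) ≫ gcocopy) ≫ gcozero := by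
      rw [Category.assoc, Category.assoc, gcocopy_cozero, tensorHom_comp_tensorHom_assoc, gpos,
        reassoc_of% e, hs]
    rw [e2]
    exact (comp_mono h le_rfl).trans_eq (Category.id_comp _)

theorem pullsBack_gcozero : PullsBack (gcozero (k := k)) := by
  rw [gcozero_eq]
  exact isRight_gcopy.pullsBack.comp ((pullsBack_gpos.tensor
    ((isRight_gscalar _).pullsBack.comp pullsBack_gpos)).comp (isRight_leftUnitor _).pullsBack)

theorem pullsBack_gcap : PullsBack (gcap (k := k)) := by
  rw [gcap_eq]
  exact ((isRight_gscalar _).whiskerRight _).pullsBack.comp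
    (isRight_gadd.pullsBack.comp pullsBack_gcozero)

theorem pullsBack_gcup : PullsBack (gcup (k := k)) :=
  pullsBack_gcodelete.comp isRight_gcopy.pullsBack

/-- Unbending costs only a cup, that is, the elimination of one variable. -/
theorem pullsBack_of_hat {X : Ob k} {f : X ⟶ W k} (h : PullsBack (f ▷ W k ≫ gcap)) :
    PullsBack f := by
  rw [← bend_unbend f gcup gcap gcup_cap]
  exact (isRight_rightUnitor_inv _).pullsBack.comp ((pullsBack_gcup.whiskerLeft _).comp
    ((isRight_assoc_inv _ _ _).pullsBack.comp ((h.whiskerRight _).comp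
      (isRight_leftUnitor _).pullsBack)))

theorem pullsBack_gcocopy : PullsBack (gcocopy (k := k)) := by
  refine pullsBack_of_hat ?_
  rw [gcocopy_cap]
  exact (isRight_gcopy.whiskerLeft _).pullsBack.comp ((isRight_tensorμ _ _ _ _).pullsBack.comp
    ((pullsBack_gcap.tensor pullsBack_gcap).comp (isRight_leftUnitor _).pullsBack))

theorem pullsBack_ggeq : PullsBack (ggeq (k := k)) := by
  refine pullsBack_of_hat ?_
  rw [hat_geq_eq_sub]
  exact (((isRight_gscalar _).whiskerLeft _).comp isRight_gadd).pullsBack.comp pullsBack_gpos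

theorem gcoscalar_eq {a : k} (h : a ≠ 0) : gcoscalar a = gscalar a⁻¹ := by
  calc gcoscalar a = gcoscalar a ≫ gscalar a ≫ gscalar a⁻¹ := by
        rw [gscalar_gscalar, mul_inv_cancel₀ h, gscalar_one, Category.comp_id]
    _ = _ := by rw [← Category.assoc, gcoscalar_gscalar h, Category.id_comp]

theorem gcoscalar_zero : gcoscalar (0 : k) = gcozero ≫ gcodelete := mk_ih_op .zero_scalar

theorem pullsBack_gcoscalar (a : k) : PullsBack (gcoscalar a) := by
  by_cases h : a = 0
  · rw [h, gcoscalar_zero]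
    exact pullsBack_gcozero.comp pullsBack_gcodelete
  · rw [gcoscalar_eq h]
    exact (isRight_gscalar _).pullsBack

/-- By the Frobenius law for addition, the ways of splitting `x` are `(-t, t + x)` with `t`
arbitrary. -/
theorem gcoadd_eq : gcoadd = (λ_ (W k)).inv ≫ (gcup ≫ gscalar (-1) ▷ W k) ▷ W k ≫
    (α_ (W k) (W k) (W k)).hom ≫ W k ◁ gadd := by
  have h : gcoadd ▷ W k ≫ (α_ (W k) (W k) (W k)).hom ≫ W k ◁ gadd = gadd ≫ gcoadd := by
    refine Eq.trans ?_ (mk_ih (k := k) .add_frobenius_left)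
    exact congrArg (gcoadd (k := k) ▷ W k ≫ ·) (Category.id_comp _)
  have h' : gzero ≫ gcoadd = gcup ≫ gscalar (-1 : k) ▷ W k := mk_ih .cup_eq
  rw [← h', comp_whiskerRight, Category.assoc, h, reassoc_of% gzero_add, Iso.inv_hom_id_assoc]

theorem pullsBack_gcoadd : PullsBack (gcoadd (k := k)) := by
  rw [gcoadd_eq]
  exact (isRight_leftUnitor_inv _).pullsBack.comp (((pullsBack_gcup.comp
    ((isRight_gscalar _).whiskerRight _).pullsBack).whiskerRight _).comp
      ((isRight_assoc _ _ _).comp (isRight_gadd.whiskerLeft _)).pullsBack)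

theorem pullsBack_mk {n m : ℕ} (c : CircGeq k n m) : PullsBack (mk c) := by
  induction c with
  | gen g =>
    cases g with
    | right g => exact IsRight.pullsBack ⟨.gen g, rfl⟩
    | left g =>
      cases g with
      | cocopy => exact pullsBack_gcocopy
      | codelete => exact pullsBack_gcodelete
      | coscalar a => exact pullsBack_gcoscalar a
      | coadd => exact pullsBack_gcoadd
      | cozero => exact pullsBack_gcozero
    | geq => exact pullsBack_ggeq
  | id n => exact (isRight_id _).pullsBack
  | sym n m => exact (isRight_braid ⟨n⟩ ⟨m⟩).pullsBack
  | seq c d ihc ihd => exact ihc.comp ihd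
  | tensor c d ihc ihd => exact ihc.tensor ihd

theorem pullsBack_capN (n : ℕ) : PullsBack (capN (k := k) n) := by
  induction n with
  | zero => exact (isRight_leftUnitor _).pullsBack
  | succ n ih =>
    exact (isRight_tensorμ (⟨n⟩ : Ob k) (W k) ⟨n⟩ (W k)).pullsBack.comp
      ((ih.tensor pullsBack_gcap).comp (isRight_leftUnitor _).pullsBack)

/-- A predicate is its own pullback of the empty system. -/
theorem PullsBack.isPoly {X : Ob k} {P : X ⟶ 𝟙_ (Ob k)} (h : PullsBack P) : IsPoly P := by
  have h1 : IsPoly ((ρ_ (𝟙_ (Ob k) ⊗ 𝟙_ (Ob k))).hom ≫ (λ_ (𝟙_ (Ob k))).hom) :=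
    ⟨[], (Category.id_comp _).trans (Category.comp_id (𝟙 (𝟙_ (Ob k)))).symm⟩
  have h2 := h (𝟙_ (Ob k)) (𝟙_ (Ob k)) _ h1
  have h3 := h2.comp ((isRight_leftUnitor_inv X).comp (isRight_rightUnitor_inv _))
  simpa using h3

/-- Every circuit is a system of inequalities with some of its variables turned into outputs. -/
theorem exists_eq_bend {n m : ℕ} (c : CircGeq k n m) :
    ∃ L : List (Fin (n + m) → k), mk c = bend (Phi L) := by
  -- The system is the graph of `c`: its outputs are compared with `m` fresh inputs by `capN`.
  obtain ⟨L, h⟩ := (((pullsBack_mk c).whiskerRight ⟨m⟩).comp (pullsBack_capN m)).isPoly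
  exact ⟨L, by rw [← h]; exact (bend_capN _).symm⟩

/-- Every circuit is provably equal to one in polyhedral normal form. -/
theorem exists_ihpEq_conic {n m : ℕ} (c : CircGeq k n m) :
    ∃ (p : ℕ) (A : CircRight k (n + m) p), IHPEq c (conic A.incl) := by
  obtain ⟨L, h⟩ := exists_eq_bend c
  obtain ⟨A, hA⟩ := isRight_mat L.get
  refine ⟨_, A, mk_eq.1 ?_⟩
  rw [h, mk_conic, hA]
  rfl

end normalForm

end CircGeq

/-! ### Soundness of the theory for relations -/

namespace CircGeq

section soundness

variable {k : Type u} [Field k] [LinearOrder k]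

theorem sem_cast {n n' m m' : ℕ} (hn : n = n') (hm : m = m') (c : CircGeq k n m)
    (x : Fin n' → k) (y : Fin m' → k) :
    sem (c.cast hn hm) x y ↔ sem c (fun i => x (i.cast hn)) (fun i => y (i.cast hm)) := by
  subst hn hm
  rfl

theorem eq_append_iff {α : Type*} {n m : ℕ} {x : Fin (n + m) → α} {u : Fin n → α} {v : Fin m → α} :
    x = Fin.append u v ↔ (fun i => x (Fin.castAdd m i)) = u ∧ (fun i => x (Fin.natAdd n i)) = v := by
  constructor
  · rintro rfl
    constructor <;> funext i <;> simp
  · rintro ⟨rfl, rfl⟩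
    exact (append_castAdd_natAdd x).symm

theorem comp_cast_natAdd_zero {α : Type*} {l : ℕ} (z : Fin l → α) :
    (fun i => z ((Fin.natAdd 0 i).cast (Nat.zero_add l))) = z :=
  funext fun i => congrArg z (Fin.ext (by simp))

theorem sem_ssm {n m : ℕ} {c d : CircGeq k n m} (h : Term.SSMEq c d) (x : Fin n → k)
    (y : Fin m → k) : sem c x y ↔ sem d x y := by
  induction h with
  | refl t => rfl
  | symm _ ih => exact (ih x y).symm
  | trans _ _ ih ih' => exact (ih x y).trans (ih' x y)
  | seq_congr _ _ ih ih' => exact exists_congr fun z => and_congr (ih x z) (ih' z y)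
  | tensor_congr _ _ ih ih' => exact and_congr (ih _ _) (ih' _ _)
  | id_seq t => simp [sem]
  | seq_id t => simp [sem]
  | seq_assoc r s t =>
    simp only [sem]
    constructor
    · rintro ⟨z, ⟨w, h1, h2⟩, h3⟩
      exact ⟨w, h1, z, h2, h3⟩
    · rintro ⟨w, h1, z, h2, h3⟩
      exact ⟨z, ⟨w, h1, h2⟩, h3⟩
  | id_tensor t =>
    rw [sem_cast]
    exact (and_iff_right (Subsingleton.elim (α := Fin 0 → k) _ _)).trans
      (Iff.of_eq (congrArg₂ (sem _) (comp_cast_natAdd_zero x) (comp_cast_natAdd_zero y)))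
  | tensor_id t =>
    rw [sem_cast]
    exact and_iff_left (Subsingleton.elim (α := Fin 0 → k) _ _)
  | @tensor_assoc n m n' m' n'' m'' r s t =>
    rw [sem_cast]
    simp only [sem, and_assoc]
    have h1 : ∀ {a b c : ℕ} (z : Fin (a + (b + c)) → k) (i : Fin c),
        z ((Fin.natAdd (a + b) i).cast (Nat.add_assoc a b c)) = z (Fin.natAdd a (Fin.natAdd b i)) :=
      fun z i => congrArg z (Fin.ext (by simp [Nat.add_assoc]))
    simp only [h1]
    rfl
  | id_tensor_id n m =>
    simp only [sem]
    rw [← append_castAdd_natAdd x, eq_comm (b := y), eq_append_iff]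
    simp [eq_comm]
  | interchange s t s' t' =>
    simp only [sem]
    constructor
    · rintro ⟨⟨z, h1, h2⟩, w, h3, h4⟩
      exact ⟨Fin.append z w, by simpa using ⟨h1, h3⟩, by simpa using ⟨h2, h4⟩⟩
    · rintro ⟨z, ⟨h1, h3⟩, h2, h4⟩
      exact ⟨⟨_, h1, h2⟩, _, h3, h4⟩
  | sym_natural s t =>
    simp only [sem]
    constructor
    · rintro ⟨z, ⟨h1, h2⟩, rfl⟩
      exact ⟨_, rfl, by simpa using h2, by simpa using h1⟩
    · rintro ⟨z, rfl, h2, h1⟩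
      simp only [Fin.append_left, Fin.append_right] at h1 h2
      exact ⟨Fin.append _ _, ⟨by simpa using h1, by simpa using h2⟩, by simp [append_castAdd_natAdd]⟩
  | sym_sym n m =>
    simp only [sem, exists_eq_left]
    simp [append_castAdd_natAdd, eq_comm]
  | sym_zero n =>
    rw [sem_cast]
    simp only [sem]
    rw [eq_append_iff, comp_cast_natAdd_zero]
    exact (and_iff_right (Subsingleton.elim (α := Fin 0 → k) _ _)).trans eq_comm
  | sym_add n m l =>
    simp only [sem, sem_cast]
    have hx : ∀ i : Fin l, x ((Fin.natAdd (n + m) i).cast (Nat.add_assoc n m l)) =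
        x (Fin.natAdd n (Fin.natAdd m i)) :=
      fun i => congrArg x (Fin.ext (by simp [Nat.add_assoc]))
    have hx' : ∀ i : Fin m, x (((Fin.natAdd n i).castAdd l).cast (Nat.add_assoc n m l)) =
        x (Fin.natAdd n (Fin.castAdd l i)) := fun i => rfl
    have hx2 : ∀ i : Fin n, x (((Fin.castAdd m i).castAdd l).cast (Nat.add_assoc n m l)) =
        x (Fin.castAdd (m + l) i) := fun i => rfl
    have hy : ∀ i : Fin n, y ((Fin.natAdd m (Fin.natAdd l i)).cast (Nat.add_assoc m l n).symm) =
        y (Fin.natAdd (m + l) i) :=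
      fun i => congrArg y (Fin.ext (by simp [Nat.add_assoc]))
    have hy' : ∀ i : Fin m, y (((Fin.castAdd (l + n) i)).cast (Nat.add_assoc m l n).symm) =
        y (Fin.castAdd n (Fin.castAdd l i)) := fun i => rfl
    have hy2 : ∀ i : Fin l, y ((Fin.natAdd m (Fin.castAdd n i)).cast (Nat.add_assoc m l n).symm) =
        y (Fin.castAdd n (Fin.natAdd m i)) := fun i => rfl
    have hz : ∀ (z : Fin (m + (n + l)) → k) (i : Fin l),
        z ((Fin.natAdd (m + n) i).cast (Nat.add_assoc m n l)) =
        z (Fin.natAdd m (Fin.natAdd n i)) :=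
      fun z i => congrArg z (Fin.ext (by simp [Nat.add_assoc]))
    have hz' : ∀ (z : Fin (m + (n + l)) → k) (i : Fin m),
        z (((Fin.castAdd n i).castAdd l).cast (Nat.add_assoc m n l)) =
        z (Fin.castAdd (n + l) i) := fun z i => rfl
    have hz2 : ∀ (z : Fin (m + (n + l)) → k) (i : Fin n),
        z (((Fin.natAdd m i).castAdd l).cast (Nat.add_assoc m n l)) =
        z (Fin.natAdd m (Fin.castAdd l i)) := fun z i => rfl
    simp only [eq_append_iff, hx, hx', hx2, hy, hy', hy2, hz, hz', hz2]
    simp only [funext_iff]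
    constructor
    · rintro ⟨h1, h2⟩
      refine ⟨Fin.append (fun i => x (Fin.natAdd n (Fin.castAdd l i)))
        (Fin.append (fun i => x (Fin.castAdd (m + l) i))
          (fun i => x (Fin.natAdd n (Fin.natAdd m i)))), ?_⟩
      simp [h1, h2]
    · rintro ⟨z, ⟨⟨h1, h2⟩, h3⟩, h4, h5, h6⟩
      refine ⟨fun i => Fin.addCases (fun i => ?_) (fun i => ?_) i, fun i => ?_⟩
      · exact (h6 i).trans (h2 i)
      · exact (h4 i).symm.trans (h1 i)
      · exact (h5 i).trans (h3 i).symm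

theorem fin_one_eq_iff {x y : Fin 1 → k} : x = y ↔ x 0 = y 0 := by
  rw [funext_iff, Fin.forall_fin_one]

theorem exists_fin_succ {n : ℕ} {p : (Fin (n + 1) → k) → Prop} :
    (∃ x, p x) ↔ ∃ (a : k) (v : Fin n → k), p (Matrix.vecCons a v) :=
  ⟨fun ⟨x, h⟩ => ⟨x 0, fun i => x i.succ, by
    rwa [show Matrix.vecCons (x 0) (fun i => x i.succ) = x from Fin.cons_self_tail x]⟩,
    fun ⟨_, _, h⟩ => ⟨_, h⟩⟩

theorem exists_fin_zero {p : (Fin 0 → k) → Prop} : (∃ x, p x) ↔ p ![] :=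
  ⟨fun ⟨x, h⟩ => by rwa [Subsingleton.elim ![] x], fun h => ⟨_, h⟩⟩

theorem natAdd_mk' (m : ℕ) {n i : ℕ} (h : i < n) : Fin.natAdd m (⟨i, h⟩ : Fin n) = ⟨m + i, by omega⟩ := rfl
theorem castAdd_mk' (m : ℕ) {n i : ℕ} (h : i < n) : Fin.castAdd m (⟨i, h⟩ : Fin n) = ⟨i, by omega⟩ := rfl
theorem zero_mk (n : ℕ) : (0 : Fin (n + 1)) = ⟨0, by omega⟩ := rfl
theorem one_mk (n : ℕ) : (1 : Fin (n + 2)) = ⟨1, by omega⟩ := rfl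
theorem vecCons_mk_zero (n : ℕ) (a : k) (v : Fin n → k) (h : 0 < n + 1) : Matrix.vecCons a v ⟨0, h⟩ = a := rfl
theorem vecCons_mk_succ (n i : ℕ) (a : k) (v : Fin n → k) (h : i + 1 < n + 1) :
  Matrix.vecCons a v ⟨i + 1, h⟩ = v ⟨i, by omega⟩ := rfl

theorem sem_copy (x : Fin 1 → k) (y : Fin 2 → k) : sem copy x y ↔ y 0 = x 0 ∧ y 1 = x 0 := by
  change y = ![x 0, x 0] ↔ _
  rw [funext_iff, Fin.forall_fin_two]
  rfl
theorem sem_cocopy (x : Fin 2 → k) (y : Fin 1 → k) : sem cocopy x y ↔ x 0 = y 0 ∧ x 1 = y 0 := by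
  change x = ![y 0, y 0] ↔ _
  rw [funext_iff, Fin.forall_fin_two]
  rfl
theorem sem_delete (x : Fin 1 → k) (y : Fin 0 → k) : sem delete x y ↔ True := Iff.rfl
theorem sem_codelete (x : Fin 0 → k) (y : Fin 1 → k) : sem codelete x y ↔ True := Iff.rfl
theorem sem_scalar (a : k) (x y : Fin 1 → k) : sem (scalar a) x y ↔ y 0 = a * x 0 := Iff.rfl
theorem sem_coscalar (a : k) (x y : Fin 1 → k) : sem (coscalar a) x y ↔ x 0 = a * y 0 := Iff.rfl
theorem sem_add (x : Fin 2 → k) (y : Fin 1 → k) : sem add x y ↔ y 0 = x 0 + x 1 := Iff.rfl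
theorem sem_coadd (x : Fin 1 → k) (y : Fin 2 → k) : sem coadd x y ↔ x 0 = y 0 + y 1 := Iff.rfl
theorem sem_zero (x : Fin 0 → k) (y : Fin 1 → k) : sem zero x y ↔ y 0 = 0 := Iff.rfl
theorem sem_cozero (x : Fin 1 → k) (y : Fin 0 → k) : sem cozero x y ↔ x 0 = 0 := Iff.rfl
theorem sem_geq (x y : Fin 1 → k) : sem geq x y ↔ y 0 ≤ x 0 := Iff.rfl
theorem sem_wire (x y : Fin 1 → k) : sem wire x y ↔ x 0 = y 0 := fin_one_eq_iff
theorem sem_empty (x y : Fin 0 → k) : sem empty x y ↔ True :=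
  iff_true_intro (Subsingleton.elim (α := Fin 0 → k) x y)
theorem sem_swap (x y : Fin 2 → k) : sem swap x y ↔ y 0 = x 1 ∧ y 1 = x 0 := by
  change y = Fin.append (n := 1) (m := 1) _ _ ↔ _
  rw [funext_iff, Fin.forall_fin_two]
  rfl
theorem sem_seq {n m l : ℕ} (c : CircGeq k n m) (d : CircGeq k m l) (x : Fin n → k)
    (y : Fin l → k) : sem (c ⨾ d) x y ↔ ∃ z, sem c x z ∧ sem d z y := Iff.rfl
theorem sem_tensor {n m n' m' : ℕ} (c : CircGeq k n m) (d : CircGeq k n' m') (x : Fin (n + n') → k)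
    (y : Fin (m + m') → k) : sem (c ⊞ d) x y ↔
      sem c (fun i => x (Fin.castAdd n' i)) (fun i => y (Fin.castAdd m' i)) ∧
      sem d (fun i => x (Fin.natAdd n i)) (fun i => y (Fin.natAdd m i)) := Iff.rfl

theorem sem_leq (x y : Fin 1 → k) : sem leq x y ↔ x 0 ≤ y 0 := by
  simp only [leq, cap, cup, sem_seq, sem_tensor, sem_geq, sem_wire, sem_copy, sem_cocopy,
    sem_delete, sem_codelete, exists_fin_succ, exists_fin_zero, zero_mk, one_mk, natAdd_mk',
    castAdd_mk', vecCons_mk_succ, vecCons_mk_zero]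
  simp

theorem sem_op {n m : ℕ} (c : CircGeq k n m) (x : Fin n → k) (y : Fin m → k) :
    sem (op c) y x ↔ sem c x y := by
  induction c with
  | gen g =>
    cases g with
    | right g => cases g <;> rfl
    | left g => cases g <;> rfl
    | geq => exact sem_leq y x
  | id n => exact eq_comm
  | sym n m =>
    simp only [op, sem, eq_append_iff]
    exact ⟨fun h => ⟨h.2.symm, h.1.symm⟩, fun h => ⟨h.2.symm, h.1.symm⟩⟩
  | seq c d ihc ihd => exact exists_congr fun z => (and_congr (ihd z y) (ihc x z)).trans and_comm
  | tensor c d ihc ihd => exact and_congr (ihc _ _) (ihd _ _)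

variable [IsStrictOrderedRing k]

theorem sem_ihEquation {n m : ℕ} {c d : CircGeq k n m} (h : IHEquation c d) (x : Fin n → k)
    (y : Fin m → k) : sem c x y ↔ sem d x y := by
  cases h <;>
  simp only [cap, cup, sem_seq, sem_tensor, sem_wire, sem_copy, sem_cocopy, sem_empty,
    sem_delete, sem_codelete, sem_zero, sem_cozero, sem_swap, sem_add, sem_coadd, sem_scalar,
    sem_coscalar, exists_fin_succ, exists_fin_zero, zero_mk, one_mk, natAdd_mk', castAdd_mk',
    vecCons_mk_succ, vecCons_mk_zero] <;> try simp
  case coscalar_scalar a ha =>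
    exact ⟨fun h => ⟨a⁻¹ * y 0, by rw [h, mul_inv_cancel_left₀ ha], by rw [mul_inv_cancel_left₀ ha]⟩,
      fun ⟨b, h, h'⟩ => h.trans h'.symm⟩
  case add_frobenius_left => exact ⟨by grind, fun h => ⟨x 0 - y 0, by grind⟩⟩
  case add_frobenius_right => exact ⟨fun h => ⟨y 0 - x 0, by grind⟩, by grind⟩
  case add_special => exact ⟨by grind, fun h => ⟨x 0, 0, by grind⟩⟩
  all_goals grind

theorem sem_of_ihAxiom {n m : ℕ} {c d : CircGeq k n m} (h : IHAxiom c d) {x : Fin n → k}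
    {y : Fin m → k} (hc : sem c x y) : sem d x y := by
  cases h with
  | eq h => exact (sem_ihEquation h x y).1 hc
  | eq_symm h => exact (sem_ihEquation h x y).2 hc
  | cozero_le_delete => trivial

theorem sem_geqEquation {n m : ℕ} {c d : CircGeq k n m} (h : GeqEquation c d) (x : Fin n → k)
    (y : Fin m → k) : sem c x y ↔ sem d x y := by
  cases h <;>
  simp only [sem_seq, sem_tensor, sem_wire, sem_copy, sem_cocopy, sem_geq, sem_leq,
    sem_delete, sem_codelete, sem_swap, sem_add, sem_scalar, exists_fin_succ, exists_fin_zero, zero_mk, one_mk, natAdd_mk', castAdd_mk',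
    vecCons_mk_succ, vecCons_mk_zero] <;> try simp
  case add_geq =>
    exact ⟨fun h => ⟨x 0, y 0 - x 0, ⟨le_rfl, by linarith⟩, by ring⟩, by grind⟩
  case geq_delete => exact ⟨x 0, le_rfl⟩
  case pos_scalar a ha =>
    refine ⟨fun h => ⟨a⁻¹ * y 0, ?_, (mul_inv_cancel_left₀ ha.ne' _).symm⟩, ?_⟩
    · exact (inv_mul_le_iff₀ ha).2 h
    · rintro ⟨b, hb, h⟩
      exact h.trans_le (mul_le_mul_of_nonneg_left hb ha.le)
  case neg_scalar a ha =>
    refine ⟨fun h => ⟨a⁻¹ * y 0, ?_, (mul_inv_cancel_left₀ ha.ne _).symm⟩, ?_⟩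
    · rw [← mul_le_mul_left_of_neg ha, mul_inv_cancel_left₀ ha.ne]
      exact h
    · rintro ⟨b, hb, h⟩
      exact h.trans_le (mul_le_mul_of_nonpos_left hb ha.le)
  -- The smaller of the two upper bounds serves as the middle value.
  case spider => exact ⟨by grind, fun h => ⟨min (x 0) (x 1), by grind⟩⟩
  case direction => exact ⟨max (x 0) (y 0), le_max_left _ _, le_max_right _ _⟩

theorem sem_of_geqInequation {n m : ℕ} {c d : CircGeq k n m} (h : GeqInequation c d)
    {x : Fin n → k} {y : Fin m → k} : sem c x y → sem d x y := by
  cases h <;>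
  simp only [sem_seq, sem_tensor, sem_wire, sem_copy, sem_cocopy, sem_geq, sem_leq,
    sem_cozero, exists_fin_succ, exists_fin_zero, zero_mk, one_mk, natAdd_mk', castAdd_mk',
    vecCons_mk_succ, vecCons_mk_zero] <;> try simp
  all_goals grind

theorem sem_of_ihpLe {n m : ℕ} {c d : CircGeq k n m} (h : IHPLe c d) {x : Fin n → k}
    {y : Fin m → k} (hc : sem c x y) : sem d x y := by
  induction h with
  | ssm h => exact (sem_ssm h x y).1 hc
  | trans _ _ ih ih' => exact ih' (ih hc)
  | seq _ _ ih ih' =>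
    obtain ⟨z, h, h'⟩ := hc
    exact ⟨z, ih h, ih' h'⟩
  | tensor _ _ ih ih' => exact ⟨ih hc.1, ih' hc.2⟩
  | ih h => exact sem_of_ihAxiom h hc
  | ih_op h => exact (sem_op _ _ _).2 (sem_of_ihAxiom h ((sem_op _ _ _).1 hc))
  | geq_eq h => exact (sem_geqEquation h x y).1 hc
  | geq_eq_symm h => exact (sem_geqEquation h x y).2 hc
  | geq_ineq h => exact sem_of_geqInequation h hc

end soundness

end CircGeq

/-! ### Relations denoted by matrices, systems and normal forms -/

namespace CircGeq

section denotation

variable {k : Type u} [Field k] [LinearOrder k] [IsStrictOrderedRing k]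

/-- The relation denoted by a circuit modulo provable equality. -/
def denote {X Y : Ob k} (f : X ⟶ Y) : (Fin X.len → k) → (Fin Y.len → k) → Prop :=
  Quotient.lift (fun c : CircGeq k X.len Y.len => sem c) (fun _ _ (h : IHPEq _ _) =>
    funext fun _ => funext fun _ => propext ⟨sem_of_ihpLe h.1, sem_of_ihpLe h.2⟩) f

theorem denote_mk {n m : ℕ} (c : CircGeq k n m) (x : Fin n → k) (y : Fin m → k) :
    denote (mk c) x y ↔ sem c x y := Iff.rfl

theorem denote_comp {X Y Z : Ob k} (f : X ⟶ Y) (g : Y ⟶ Z) (x : Fin X.len → k)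
    (z : Fin Z.len → k) : denote (f ≫ g) x z ↔ ∃ y, denote f x y ∧ denote g y z := by
  obtain ⟨c, rfl⟩ := mk_surj f
  obtain ⟨d, rfl⟩ := mk_surj g
  rfl

theorem denote_tensor {X Y X' Y' : Ob k} (f : X ⟶ Y) (g : X' ⟶ Y') (x : Fin (X ⊗ X').len → k)
    (y : Fin (Y ⊗ Y').len → k) : denote (f ⊗ₘ g) x y ↔
      denote f (fun i => x (Fin.castAdd X'.len i)) (fun i => y (Fin.castAdd Y'.len i)) ∧
      denote g (fun i => x (Fin.natAdd X.len i)) (fun i => y (Fin.natAdd Y.len i)) := by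
  obtain ⟨c, rfl⟩ := mk_surj f
  obtain ⟨d, rfl⟩ := mk_surj g
  rfl

theorem denote_id (X : Ob k) (x y : Fin X.len → k) : denote (𝟙 X) x y ↔ x = y := Iff.rfl

theorem denote_eqToHom {n m : ℕ} (h : n = m) (x : Fin n → k) (y : Fin m → k) :
    denote (eqToHom (congrArg (Ob.mk (k := k)) h)) x y ↔ x = fun i => y (i.cast h) := by
  subst h
  rfl

theorem denote_leftUnitor_inv (X : Ob k) (x : Fin X.len → k) (y : Fin (0 + X.len) → k) :
    denote (λ_ X).inv x y ↔ x = fun i => y (Fin.natAdd 0 i) := by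
  refine (denote_eqToHom (Nat.zero_add X.len).symm x y).trans ?_
  rw [iff_iff_eq]
  congr 1
  funext i
  exact congrArg y (Fin.ext (by simp))

theorem denote_del (X : Ob k) (x : Fin X.len → k) (y : Fin 0 → k) : denote (del X) x y := by
  obtain ⟨n⟩ := X
  induction n with
  | zero => exact Subsingleton.elim (α := Fin 0 → k) x y
  | succ n ih =>
    have h : del (⟨n + 1⟩ : Ob k) = (del (⟨n⟩ : Ob k) ⊗ₘ gdelete) :=
      (del_succ ⟨n⟩).trans (Category.comp_id _)
    rw [h]
    exact (denote_tensor (X := ⟨n⟩) (X' := W k) (Y := 𝟙_ (Ob k)) (Y' := 𝟙_ (Ob k)) _ _ x y).2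
      ⟨ih _, trivial⟩

/-- The counit laws recover each half of the output, so the interleaving inside `dup` never has to
be unfolded. -/
theorem denote_dup (X : Ob k) (x : Fin X.len → k) (y : Fin (X.len + X.len) → k) :
    denote (dup X) x y ↔ y = Fin.append x x := by
  have h : ∀ y : Fin (X.len + X.len) → k, denote (dup X) x y → y = Fin.append x x := by
    intro y hy
    rw [eq_append_iff]
    constructor
    · have h : denote (dup X ≫ X ◁ del X) x fun i => y (Fin.castAdd X.len i) := by
        rw [denote_comp, ← id_tensorHom]
        exact ⟨y, hy, (denote_tensor (𝟙 X) (del X) y _).2 ⟨rfl, denote_del _ _ _⟩⟩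
      rw [dup_del] at h
      exact Eq.symm h
    · have e : ∀ i, y (Fin.natAdd X.len i) =
          y (Fin.natAdd X.len ((Fin.natAdd 0 i).cast (Nat.zero_add X.len))) :=
        fun i => congrArg y (Fin.ext (by simp))
      have h : denote (dup X ≫ del X ▷ X) x
          fun i => y (Fin.natAdd X.len (i.cast (Nat.zero_add X.len))) := by
        rw [denote_comp, ← tensorHom_id]
        exact ⟨y, hy, (denote_tensor (del X) (𝟙 X) y _).2 ⟨denote_del _ _ _, funext e⟩⟩
      rw [del_dup, denote_leftUnitor_inv] at h
      exact (funext e).trans h.symm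
  refine ⟨h y, ?_⟩
  rintro rfl
  -- Some output exists because copying and then deleting is the identity; by `h` it must be the
  -- expected one.
  have h1 : denote (dup X ≫ X ◁ del X) x x := by
    rw [dup_del]
    exact (denote_id X x x).2 rfl
  rw [denote_comp] at h1
  obtain ⟨z, hz, -⟩ := h1
  rwa [← h z hz]

theorem denote_tuple {X : Ob k} {n : ℕ} (r : Fin n → (X ⟶ W k)) (x : Fin X.len → k)
    (y : Fin n → k) : denote (tuple r) x y ↔ ∀ i, denote (r i) x fun _ => y i := by
  induction n with
  | zero => exact iff_of_true (denote_del X x y) fun i => i.elim0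
  | succ n ih =>
    rw [tuple_succ, denote_comp, Fin.forall_fin_succ']
    simp only [denote_dup, exists_eq_left]
    refine (denote_tensor (Y := ⟨n⟩) (Y' := W k) _ _ _ _).trans (and_congr ?_ ?_)
    · simp only [Fin.append_left]
      exact ih _ _
    · simp only [Fin.append_right]
      rw [iff_iff_eq]
      congr 1
      funext i
      rw [Subsingleton.elim i 0]
      rfl

theorem denote_row {n : ℕ} (v x : Fin n → k) (y : Fin 1 → k) :
    denote (row v) x y ↔ y 0 = v ⬝ᵥ x := by
  induction n generalizing y with
  | zero =>
    rw [Matrix.dotProduct_of_isEmpty]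
    exact Iff.rfl
  | succ n ih =>
    rw [row_succ, denote_comp, dotProduct, Fin.sum_univ_castSucc]
    constructor
    · rintro ⟨z, h, h'⟩
      rw [denote_tensor, ih] at h
      exact h'.trans (congrArg₂ (· + ·) h.1 h.2)
    · intro h
      refine ⟨![_, _], ?_, h⟩
      exact (denote_tensor (X := ⟨n⟩) (X' := W k) _ _ _ _).2 ⟨(ih _ _ _).2 rfl, rfl⟩

theorem denote_mat {n p : ℕ} (A : Fin p → Fin n → k) (x : Fin n → k) (y : Fin p → k) :
    denote (mat A) x y ↔ ∀ i, y i = A i ⬝ᵥ x := by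
  rw [mat, denote_tuple]
  exact forall_congr' fun i => denote_row _ _ _

theorem denote_posN (n : ℕ) (x : Fin n → k) (y : Fin 0 → k) :
    denote (posN n) x y ↔ ∀ i, 0 ≤ x i := by
  induction n with
  | zero => exact iff_of_true (Subsingleton.elim (α := Fin 0 → k) x y) fun i => i.elim0
  | succ n ih =>
    have h : posN (k := k) (n + 1) = (posN n ⊗ₘ gpos) :=
      (posN_succ n).trans (Category.comp_id _)
    rw [h, Fin.forall_fin_succ']
    refine (denote_tensor (X := ⟨n⟩) (X' := W k) (Y := 𝟙_ (Ob k)) (Y' := 𝟙_ (Ob k)) _ _ x y).trans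
      (and_congr (ih _) ?_)
    rw [gpos, denote_comp]
    exact ⟨fun ⟨z, h, h'⟩ => Eq.trans_le (Eq.symm h') h, fun h => ⟨fun _ => 0, h, rfl⟩⟩

theorem denote_Phi {n : ℕ} (L : List (Fin n → k)) (x : Fin n → k) (y : Fin 0 → k) :
    denote (Phi L) x y ↔ ∀ r ∈ L, 0 ≤ r ⬝ᵥ x := by
  rw [Phi, phi, denote_comp, List.forall_mem_iff_get]
  simp only [denote_mat, denote_posN]
  exact ⟨fun ⟨z, h, h'⟩ i => (h' i).trans_eq (h i), fun h => ⟨_, fun i => rfl, h⟩⟩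

theorem denote_ex_Phi {n : ℕ} (L : List (Fin (n + 1) → k)) (x : Fin n → k) (y : Fin 0 → k) :
    denote (ex (Phi L)) x y ↔ ∃ t, ∀ r ∈ L, 0 ≤ r ⬝ᵥ ext x t := by
  rw [ex, denote_comp]
  constructor
  · rintro ⟨x', hx, h⟩
    rw [denote_comp, ← id_tensorHom] at h
    obtain ⟨z, hz, h⟩ := h
    rw [denote_tensor] at hz
    refine ⟨z (Fin.last n), ?_⟩
    have e : ext x (z (Fin.last n)) = z := by
      rw [← ext_self z, show x = _ from Eq.trans hx hz.1, ext_last]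
      rfl
    rw [e]
    exact (denote_Phi L z y).1 h
  · rintro ⟨t, h⟩
    refine ⟨x, rfl, ?_⟩
    rw [denote_comp, ← id_tensorHom]
    refine ⟨ext x t, ?_, (denote_Phi L _ y).2 h⟩
    refine (denote_tensor (X := ⟨n⟩) (X' := 𝟙_ (Ob k)) (Y' := W k) _ _ _ _).2 ⟨?_, trivial⟩
    exact (denote_id ⟨n⟩ _ _).2 (funext fun i => (ext_castSucc x t i).symm)

theorem sem_copyN (n : ℕ) (x : Fin n → k) (y : Fin (n + n) → k) :
    sem (copyN n) x y ↔ y = Fin.append x x := by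
  rw [← denote_dup ⟨n⟩, ← mk_copyN]
  rfl

theorem sem_codeleteN (n : ℕ) (x : Fin 0 → k) (y : Fin n → k) : sem (codeleteN n) x y := by
  induction n with
  | zero => exact Subsingleton.elim (α := Fin 0 → k) x y
  | succ n ih => exact ⟨ih _, trivial⟩

theorem sem_cupN (n : ℕ) (x : Fin 0 → k) (y : Fin (n + n) → k) :
    sem (cupN n) x y ↔ ∀ i, y (Fin.castAdd n i) = y (Fin.natAdd n i) := by
  rw [cupN, sem_seq]
  simp only [sem_codeleteN, sem_copyN, true_and, eq_append_iff]
  exact ⟨fun ⟨w, h, h'⟩ i => congrFun (h.trans h'.symm) i, fun h => ⟨_, rfl, (funext h).symm⟩⟩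

theorem sem_nonneg {n p : ℕ} (t : CircGeq k n p) (x : Fin n → k) (y : Fin 0 → k) :
    sem (t ⨾ geqN p ⨾ cozeroN p) x y ↔ ∃ z, sem t x z ∧ ∀ i, 0 ≤ z i := by
  have h : mk (t ⨾ geqN p ⨾ cozeroN p) = mk t ≫ posN p := by
    rw [← mk_geqN_cozeroN]
    exact Category.assoc (mk t) (mk (geqN p)) (mk (cozeroN p))
  rw [← denote_mk, h, denote_comp]
  simp only [denote_posN]
  rfl

theorem sem_conic {n m p : ℕ} (t : CircGeq k (n + m) p) (x : Fin n → k) (y : Fin m → k) :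
    sem (conic t) x y ↔ ∃ z, sem t (Fin.append x y) z ∧ ∀ i, 0 ≤ z i := by
  rw [conic, sem_seq, ← sem_nonneg t _ ![]]
  simp only [sem_cast, sem_tensor, sem_cupN]
  have e : ∀ (v : Fin (n + m + m) → k) (i : Fin m),
      v ((Fin.natAdd n (Fin.natAdd m i)).cast (Nat.add_assoc n m m).symm) =
        v (Fin.natAdd (n + m) i) := fun v i => congrArg v (Fin.ext (Nat.add_assoc n m i).symm)
  have e' : ∀ i : Fin m, y ((Fin.natAdd 0 i).cast (Nat.zero_add m)) = y i :=
    fun i => congrFun (comp_cast_natAdd_zero y) i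
  constructor
  · rintro ⟨v, ⟨h1, h2⟩, h3, h4⟩
    have h : (fun i => v (Fin.castAdd m i)) = Fin.append x y := by
      refine eq_append_iff.2 ⟨Eq.symm h1, funext fun i => ?_⟩
      exact (h2 i).trans ((e v i).trans ((congrFun h4 i).trans (e' i)))
    rw [← h]
    convert h3 using 1
    rfl
  · intro h
    refine ⟨Fin.append (Fin.append x y) y, ⟨funext fun i => ?_, fun i => ?_⟩, ?_, funext fun i => ?_⟩
    · exact ((Fin.append_left (Fin.append x y) y (Fin.castAdd m i)).trans
        (Fin.append_left x y i)).symm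
    · refine Eq.trans ?_ (e (Fin.append (Fin.append x y) y) i).symm
      rw [Fin.append_right]
      exact (Fin.append_left (Fin.append x y) y (Fin.natAdd n i)).trans (Fin.append_right x y i)
    · have h' : (fun i : Fin (n + m) => Fin.append (Fin.append x y) y (Fin.castAdd m i)) =
        Fin.append x y := funext fun i => Fin.append_left _ _ i
      change sem _ (fun i : Fin (n + m) => Fin.append (Fin.append x y) y (Fin.castAdd m i)) _
      rw [h']
      convert h
    · rw [e']
      exact Fin.append_right _ _ i

end denotation

end CircGeq

/-! ### Farkas' lemma, completeness, and the Weyl–Minkowski theorem -/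

namespace CircGeq

section cones

variable {k : Type u} [Field k] [LinearOrder k]

theorem InCone.map {V W : Type*} [AddCommGroup V] [Module k V] [AddCommGroup W] [Module k W]
    {s : Set V} {t : Set W} (f : V →ₗ[k] W) (h : ∀ v ∈ s, InCone (k := k) t (f v)) {v : V}
    (hv : InCone (k := k) s v) : InCone (k := k) t (f v) := by
  induction hv with
  | zero => rw [map_zero]; exact .zero
  | mem hv => exact h _ hv
  | add _ _ ih ih' => rw [map_add]; exact ih.add ih'
  | smul ha _ ih => rw [map_smul]; exact ih.smul ha

theorem append_dotProduct_append {n m : ℕ} (u x : Fin n → k) (v y : Fin m → k) :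
    Fin.append u v ⬝ᵥ Fin.append x y = u ⬝ᵥ x + v ⬝ᵥ y := by
  simp [dotProduct, Fin.sum_univ_add]

variable [IsStrictOrderedRing k]

/-- Fourier–Motzkin elimination of one variable. -/
theorem exists_projection_succ {n : ℕ} (L : List (Fin (n + 1) → k)) :
    ∃ L' : List (Fin n → k),
      (∀ x, (∀ r ∈ L', 0 ≤ r ⬝ᵥ x) ↔ ∃ t, ∀ r ∈ L, 0 ≤ r ⬝ᵥ ext x t) ∧
      ∀ r ∈ L', InCone (k := k) {r | r ∈ L} (ext r 0) := by
  obtain ⟨L', h, h'⟩ := exists_ex_Phi_eq L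
  exact ⟨L', fun x => by rw [← denote_Phi L' x ![], ← h, denote_ex_Phi], h'⟩

/-- Fourier–Motzkin elimination. -/
theorem exists_projection {n m : ℕ} (L : List (Fin (n + m) → k)) :
    ∃ L' : List (Fin n → k),
      (∀ x, (∀ r ∈ L', 0 ≤ r ⬝ᵥ x) ↔ ∃ y, ∀ r ∈ L, 0 ≤ r ⬝ᵥ Fin.append x y) ∧
      ∀ r ∈ L', InCone (k := k) {r | r ∈ L} (Fin.append r 0) := by
  induction m with
  | zero =>
    have e : ∀ (x : Fin n → k) (y : Fin 0 → k), Fin.append x y = x := fun x y => by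
      rw [Subsingleton.elim y Fin.elim0, Fin.append_elim0]
      rfl
    exact ⟨L, fun x => ⟨fun h => ⟨![], by rwa [e]⟩, fun ⟨y, h⟩ => by rwa [e] at h⟩,
      fun r hr => .mem (by rwa [e])⟩
  | succ m ih =>
    obtain ⟨L₁, h₁, h₁'⟩ := exists_projection_succ (n := n + m) L
    obtain ⟨L₂, h₂, h₂'⟩ := ih L₁
    have e : ∀ (x : Fin n → k) (y : Fin m → k) (t : k),
        ext (Fin.append x y) t = Fin.append x (ext y t) := fun x y t => (Fin.append_snoc x y t).symm
    refine ⟨L₂, fun x => ?_, fun r hr => ?_⟩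
    · simp only [h₂, h₁, e]
      exact ⟨fun ⟨y, t, h⟩ => ⟨_, h⟩, fun ⟨y, h⟩ => ⟨_, y (Fin.last m), by rwa [ext_self]⟩⟩
    · have h0 : Fin.append r (0 : Fin (m + 1) → k) = ext (Fin.append r 0) 0 := by
        rw [e]
        congr 1
        rw [← ext_self 0]
        rfl
      rw [h0]
      let f : (Fin (n + m) → k) →ₗ[k] (Fin (n + m + 1) → k) :=
        { toFun := fun u => ext u 0
          map_add' := fun u v => by rw [ext_add, add_zero]
          map_smul' := fun a u => by rw [RingHom.id_apply, smul_ext, mul_zero] }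
      exact (h₂' r hr).map f h₁'

/-- Farkas' lemma. -/
theorem inCone_of_forall {n : ℕ} {L : List (Fin n → k)} {b : Fin n → k}
    (h : ∀ x, (∀ r ∈ L, 0 ≤ r ⬝ᵥ x) → 0 ≤ b ⬝ᵥ x) : InCone (k := k) {r | r ∈ L} b := by
  -- In the variables `(s, x)` the system says `s = b ⬝ᵥ x` together with the inequalities of `L`;
  -- eliminating `x` leaves conditions on `s` alone.
  obtain ⟨L', h1, h2⟩ := exists_projection (n := 1) (m := n)
    (Fin.append ![1] (-b) :: Fin.append ![-1] b :: L.map (Fin.append (m := 1) 0))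
  have h3 : ∃ r ∈ L', 0 < r 0 := by
    -- If no row has a positive coefficient, `s = -1` satisfies the projected system and lifts to a
    -- solution `x` of `L` with `b ⬝ᵥ x` negative.
    by_contra! h3
    obtain ⟨x, hx⟩ := (h1 ![-1]).1 fun r hr => by
      simpa [dotProduct] using h3 r hr
    simp only [List.forall_mem_cons, List.forall_mem_map, append_dotProduct_append] at hx
    have := h x fun r hr => by simpa using hx.2.2 r hr
    have h4 := hx.1
    simp at h4
    linarith
  obtain ⟨r, hr, hr0⟩ := h3
  -- The map `(s, w) ↦ w + s • b` kills the two rows expressing `s = b ⬝ᵥ x` and returns the rows of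
  -- `L`. It therefore carries the certificate for `r` to one for `r 0 • b`.
  let f : (Fin (1 + n) → k) →ₗ[k] (Fin n → k) :=
    { toFun := fun w => (fun i => w (Fin.natAdd 1 i)) + w 0 • b
      map_add' := fun v w => by
        funext i
        simp only [Pi.add_apply, Pi.smul_apply, smul_eq_mul]
        ring
      map_smul' := fun a w => by
        funext i
        simp only [Pi.add_apply, Pi.smul_apply, smul_eq_mul, RingHom.id_apply]
        ring }
  have e : ∀ (u : Fin 1 → k) v, f (Fin.append u v) = v + u 0 • b := fun u v => by
    have e1 : (fun i => Fin.append u v (Fin.natAdd 1 i)) = v := funext fun i => Fin.append_right _ _ _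
    have e2 : Fin.append u v 0 = u 0 := Fin.append_left u v 0
    change (fun i => Fin.append u v (Fin.natAdd 1 i)) + Fin.append u v 0 • b = _
    rw [e1, e2]
  have h4 : InCone (k := k) {r | r ∈ L} (f (Fin.append r 0)) := by
    refine (h2 r hr).map f fun v hv => ?_
    simp only [Set.mem_ofPred_eq, List.mem_cons, List.mem_map] at hv
    rcases hv with rfl | rfl | ⟨w, hw, rfl⟩
    · rw [e]
      simpa using InCone.zero
    · rw [e]
      simpa using InCone.zero
    · rw [e]
      simpa using InCone.mem (k := k) (s := {r | r ∈ L}) hw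
  rw [e, zero_add] at h4
  have := h4.smul (inv_nonneg.2 hr0.le)
  rwa [smul_smul, inv_mul_cancel₀ hr0.ne', one_smul] at this

theorem denote_bend_Phi {n m : ℕ} (L : List (Fin (n + m) → k)) (x : Fin n → k) (y : Fin m → k) :
    denote (bend (Phi L)) x y ↔ ∀ r ∈ L, 0 ≤ r ⬝ᵥ Fin.append x y := by
  obtain ⟨A, hA⟩ := isRight_mat L.get
  have h : bend (Phi L) = mk (conic A.incl) := by
    rw [mk_conic, hA]
    rfl
  rw [h, denote_mk, sem_conic, ← denote_Phi L _ ![], Phi, phi, denote_comp]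
  simp only [denote_posN, ← hA]
  rfl

/-- Provable inclusion is inclusion of the denoted relations. -/
theorem ihpLe_iff {n m : ℕ} {c d : CircGeq k n m} : IHPLe c d ↔ ∀ x y, sem c x y → sem d x y := by
  refine ⟨fun h _ _ => sem_of_ihpLe h, fun h => mk_le.1 ?_⟩
  obtain ⟨L, hL⟩ := exists_eq_bend c
  obtain ⟨L', hL'⟩ := exists_eq_bend d
  rw [hL, hL']
  -- Every row of `L'` is nonnegative on the solutions of `L`. Farkas' lemma makes it a nonnegative
  -- combination of rows of `L`, and `Phi_mono` turns this into a derivation.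
  refine bend_mono (Phi_mono fun r hr => inCone_of_forall fun w hw => ?_)
  rw [← append_castAdd_natAdd w] at hw ⊢
  have h' := h _ _ ((denote_mk c _ _).1 (hL ▸ (denote_bend_Phi L _ _).2 hw))
  rw [← denote_mk, hL', denote_bend_Phi] at h'
  exact h' r hr

theorem ihpEq_iff {n m : ℕ} {c d : CircGeq k n m} : IHPEq c d ↔ ∀ x y, sem c x y ↔ sem d x y := by
  simp only [IHPEq, ihpLe_iff]
  exact ⟨fun h x y => ⟨h.1 x y, h.2 x y⟩, fun h => ⟨fun x y => (h x y).1, fun x y => (h x y).2⟩⟩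

/-- Finitely generated cones are polyhedral. -/
theorem exists_finGenCone_eq_polyhedralCone {N p : ℕ} (V : Matrix (Fin N) (Fin p) k) :
    ∃ (q : ℕ) (A : Matrix (Fin q) (Fin N) k), finGenCone V = polyhedralCone A := by
  -- The rows express `x = V z`, as two inequalities per coordinate, and `z ≥ 0`; the variables `z`
  -- are projected away.
  obtain ⟨L, hL, -⟩ := exists_projection (n := N) (m := p)
    (List.ofFn (fun i => Fin.append (Pi.single i 1) (-V i)) ++
      List.ofFn (fun i => Fin.append (-Pi.single i 1) (V i)) ++
      List.ofFn (fun j => Fin.append 0 (Pi.single j 1)))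
  refine ⟨L.length, L.get, Set.ext fun x => ?_⟩
  have h : x ∈ polyhedralCone (k := k) L.get ↔ ∀ r ∈ L, 0 ≤ r ⬝ᵥ x := 
    (List.forall_mem_iff_get (p := fun r => 0 ≤ r ⬝ᵥ x)).symm
  rw [h, hL]
  refine exists_congr fun z => ?_
  simp only [List.forall_mem_append, List.forall_mem_ofFn_iff, append_dotProduct_append,
    neg_dotProduct, single_one_dotProduct, zero_dotProduct, zero_add]
  rw [and_comm, ← forall_and, funext_iff]
  refine and_congr (forall_congr' fun i => ?_) Iff.rfl
  change x i = V i ⬝ᵥ z ↔ _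
  constructor
  · intro h
    constructor <;> linarith
  · rintro ⟨h, h'⟩
    linarith

/-- Polyhedral cones are finitely generated. -/
theorem exists_polyhedralCone_eq_finGenCone {N p : ℕ} (A : Matrix (Fin p) (Fin N) k) :
    ∃ (q : ℕ) (V : Matrix (Fin N) (Fin q) k), polyhedralCone A = finGenCone V := by
  -- The cone generated by the rows of `A` is polyhedral, with some matrix `B`. By duality the rows
  -- of `B` generate the cone `A x ≥ 0`: Farkas' lemma gives one inclusion, and the other holds
  -- because the rows of `A` satisfy the inequalities of `B`.
  obtain ⟨q, B, h⟩ := exists_finGenCone_eq_polyhedralCone A.transpose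
  refine ⟨q, B.transpose, Set.ext fun x => ⟨fun hx => ?_, ?_⟩⟩
  · have hB : InCone (k := k) {r | r ∈ List.ofFn B} x := by
      refine inCone_of_forall fun y hy => ?_
      have hy' : y ∈ polyhedralCone B :=
        (List.forall_mem_ofFn_iff (P := fun r => 0 ≤ r ⬝ᵥ y)).1 hy
      rw [← h] at hy'
      obtain ⟨z, hz, rfl⟩ := hy'
      rw [Matrix.mulVec_transpose, dotProduct_comm, ← Matrix.dotProduct_mulVec]
      exact Finset.sum_nonneg fun i _ => mul_nonneg (hz i) (hx i)
    have e : {r | r ∈ List.ofFn B} = Set.range B := Set.ext fun r => List.mem_ofFn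
    rw [e] at hB
    obtain ⟨z, hz, hx⟩ := hB.exists_coeff
    refine ⟨z, hz, hx.trans ?_⟩
    rw [Matrix.mulVec_transpose]
    funext j
    simp [Matrix.vecMul, dotProduct]
  · rintro ⟨z, hz, rfl⟩ i
    have hA : A i ∈ polyhedralCone B := by
      rw [← h]
      refine ⟨Pi.single i 1, fun j => ?_, ?_⟩
      · rw [Pi.single_apply]
        split <;> simp
      · rw [Matrix.mulVec_single_one]
        rfl
    change 0 ≤ A i ⬝ᵥ _
    rw [Matrix.mulVec_transpose, dotProduct_comm, ← Matrix.dotProduct_mulVec]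
    exact Finset.sum_nonneg fun i _ => mul_nonneg (hz i) (hA i)

end cones

end CircGeq

/-- Reading a term backwards, given the mirror images of the generators. -/
def Term.mirror {S T : ℕ → ℕ → Type u} (f : ∀ {n m : ℕ}, S n m → T m n) :
    ∀ {n m : ℕ}, Term S n m → Term T m n
  | _, _, gen g => gen (f g)
  | _, _, id n => id n
  | _, _, sym n m => sym m n
  | _, _, seq s t => seq (mirror f t) (mirror f s)
  | _, _, tensor s t => tensor (mirror f s) (mirror f t)

/-- The mirror image of a generator. -/
def RightGen.mirror {k : Type u} : ∀ {n m : ℕ}, RightGen k n m → LeftGen k m n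
  | _, _, .copy => .cocopy
  | _, _, .delete => .codelete
  | _, _, .scalar a => .coscalar a
  | _, _, .add => .coadd
  | _, _, .zero => .cozero

/-- The mirror image of a mirrored generator. -/
def LeftGen.mirror {k : Type u} : ∀ {n m : ℕ}, LeftGen k n m → RightGen k m n
  | _, _, .cocopy => .copy
  | _, _, .codelete => .delete
  | _, _, .coscalar a => .scalar a
  | _, _, .coadd => .add
  | _, _, .cozero => .zero

/-! ### Left circuits as matrices read backwards; finitely generated normal form -/

namespace CircGeq

section mirror

variable {k : Type u} [Field k] [LinearOrder k]

theorem op_incl_right {n m : ℕ} (c : CircRight k n m) :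
    op c.incl = CircLeft.incl (Term.mirror RightGen.mirror c) := by
  induction c with
  | gen g => cases g <;> rfl
  | id n => rfl
  | sym n m => rfl
  | seq c d ihc ihd => exact congrArg₂ Term.seq ihd ihc
  | tensor c d ihc ihd => exact congrArg₂ Term.tensor ihc ihd

theorem op_incl_left {n m : ℕ} (c : CircLeft k n m) :
    op c.incl = CircRight.incl (Term.mirror LeftGen.mirror c) := by
  induction c with
  | gen g => cases g <;> rfl
  | id n => rfl
  | sym n m => rfl
  | seq c d ihc ihd => exact congrArg₂ Term.seq ihd ihc
  | tensor c d ihc ihd => exact congrArg₂ Term.tensor ihc ihd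

variable [IsStrictOrderedRing k]

theorem exists_matrix_of_right {n m : ℕ} (c : CircRight k n m) :
    ∃ M : Matrix (Fin m) (Fin n) k, ∀ x y, sem c.incl x y ↔ y = M.mulVec x :=
  ⟨eval c fun i => Pi.single i 1, fun x y => by
    rw [← denote_mk, mk_incl_eq_mat, denote_mat, funext_iff]
    rfl⟩

theorem exists_right_of_matrix {n m : ℕ} (M : Matrix (Fin m) (Fin n) k) :
    ∃ c : CircRight k n m, ∀ x y, sem c.incl x y ↔ y = M.mulVec x := by
  obtain ⟨c, hc⟩ := isRight_mat M
  exact ⟨c, fun x y => by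
    rw [← denote_mk]
    refine Iff.trans (Iff.of_eq (congrArg (denote · x y) hc)) ?_
    exact (denote_mat _ _ _).trans funext_iff.symm⟩

theorem exists_matrix_of_left {n m : ℕ} (c : CircLeft k n m) :
    ∃ M : Matrix (Fin n) (Fin m) k, ∀ x y, sem c.incl x y ↔ x = M.mulVec y := by
  obtain ⟨M, hM⟩ := exists_matrix_of_right (Term.mirror LeftGen.mirror c)
  exact ⟨M, fun x y => by rw [← hM, ← op_incl_left, sem_op]⟩

theorem exists_left_of_matrix {n m : ℕ} (M : Matrix (Fin n) (Fin m) k) :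
    ∃ c : CircLeft k n m, ∀ x y, sem c.incl x y ↔ x = M.mulVec y := by
  obtain ⟨c, hc⟩ := exists_right_of_matrix M
  exact ⟨Term.mirror RightGen.mirror c, fun x y => by rw [← hc, ← op_incl_right, sem_op]⟩

/-- A left circuit relates `u` to every `z` with `u = M z`, so the hidden wires constrained to be
nonnegative carry the coefficients of a conic combination. -/
theorem sem_conic_left {n m p : ℕ} {V : CircLeft k (n + m) p} {M : Matrix (Fin (n + m)) (Fin p) k}
    (h : ∀ u z, sem V.incl u z ↔ u = M.mulVec z) (x : Fin n → k) (y : Fin m → k) :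
    sem (conic V.incl) x y ↔ Fin.append x y ∈ finGenCone M := by
  rw [sem_conic]
  simp only [h]
  exact exists_congr fun z => and_comm

theorem IsPolyhedralNF.exists_matrix {n m : ℕ} {c : CircGeq k n m} (h : IsPolyhedralNF c) :
    ∃ (p : ℕ) (A : Matrix (Fin p) (Fin (n + m)) k), ∀ x y,
      sem c x y ↔ Fin.append x y ∈ polyhedralCone A := by
  obtain ⟨p, A, h⟩ := h
  obtain ⟨M, hM⟩ := exists_matrix_of_right A
  refine ⟨p, M, fun x y => ?_⟩
  rw [sem_ssm h, sem_conic]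
  simp only [hM, exists_eq_left]
  rfl

theorem exists_isPolyhedralNF {n m : ℕ} (c : CircGeq k n m) :
    ∃ d, IsPolyhedralNF d ∧ IHPEq c d := by
  obtain ⟨p, A, h⟩ := exists_ihpEq_conic c
  exact ⟨_, ⟨p, A, .refl _⟩, h⟩

/-- Every circuit is provably equal to one in finitely generated normal form. -/
theorem exists_isFinGenNF {n m : ℕ} (c : CircGeq k n m) : ∃ d, IsFinGenNF d ∧ IHPEq c d := by
  obtain ⟨P, hP, h⟩ := exists_isPolyhedralNF c
  obtain ⟨p, A, hA⟩ := hP.exists_matrix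
  -- Minkowski's theorem is applied to the denoted cone; completeness converts the resulting
  -- equality of relations into a provable one.
  obtain ⟨q, M, hM⟩ := exists_polyhedralCone_eq_finGenCone A
  obtain ⟨V, hV⟩ := exists_left_of_matrix M
  refine ⟨conic V.incl, ⟨q, V, .refl _⟩, ihpEq_iff.2 fun x y => ?_⟩
  rw [ihpEq_iff.1 h, hA, hM, sem_conic_left hV]

end mirror

/-! ### The polar operator is an antitone involution -/

section polar

variable {k : Type u} [Field k] [LinearOrder k]

theorem polar_cast {n n' m m' : ℕ} (hn : n = n') (hm : m = m') (c : CircGeq k n m) :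
    polar (c.cast hn hm) = (polar c).cast hn hm := by
  subst hn hm
  rfl

theorem polar_ssm {n m : ℕ} {c d : CircGeq k n m} (h : Term.SSMEq c d) :
    Term.SSMEq (polar c) (polar d) := by
  induction h with
  | refl t => exact .refl _
  | symm _ ih => exact ih.symm
  | trans _ _ ih ih' => exact ih.trans ih'
  | seq_congr _ _ ih ih' => exact .seq_congr ih ih'
  | tensor_congr _ _ ih ih' => exact .tensor_congr ih ih'
  | id_seq t => exact .id_seq _
  | seq_id t => exact .seq_id _
  | seq_assoc r s t => exact .seq_assoc _ _ _
  | id_tensor t => rw [polar_cast]; exact .id_tensor _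
  | tensor_id t => rw [polar_cast]; exact .tensor_id _
  | tensor_assoc r s t => rw [polar_cast]; exact .tensor_assoc _ _ _
  | id_tensor_id n m => exact .id_tensor_id n m
  | interchange s t s' t' => exact .interchange _ _ _ _
  | sym_natural s t => exact .sym_natural _ _
  | sym_sym n m => exact .sym_sym n m
  | sym_zero n => rw [polar_cast]; exact .sym_zero n
  | sym_add n m l =>
    have h : polar (k := k) ((Term.sym n m ⊞ Term.id l).cast (Nat.add_assoc n m l)
        (Nat.add_assoc m n l) ⨾ (Term.id m ⊞ Term.sym n l).cast rfl (Nat.add_assoc m l n).symm) =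
        (Term.sym n m ⊞ Term.id l).cast (Nat.add_assoc n m l) (Nat.add_assoc m n l) ⨾
          (Term.id m ⊞ Term.sym n l).cast rfl (Nat.add_assoc m l n).symm :=
      congrArg₂ Term.seq (polar_cast _ _ _) (polar_cast _ _ _)
    rw [h]
    exact .sym_add n m l

/-- These axioms do not contain `geq`, so polar and mirror image commute syntactically on them, and
the mirrored axioms need no separate check. -/
theorem polar_op_of_ihAxiom {n m : ℕ} {c d : CircGeq k n m} (h : IHAxiom c d) :
    polar (op c) = op (polar c) ∧ polar (op d) = op (polar d) := by
  cases h with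
  | eq h => cases h <;> exact ⟨rfl, rfl⟩
  | eq_symm h => cases h <;> exact ⟨rfl, rfl⟩
  | cozero_le_delete => exact ⟨rfl, rfl⟩

theorem polar_copy : polar (copy (k := k)) = coadd := rfl
theorem polar_delete : polar (delete (k := k)) = cozero := rfl
theorem polar_scalar (a : k) : polar (scalar a) = coscalar a := rfl
theorem polar_add : polar (add (k := k)) = cocopy := rfl
theorem polar_zero : polar (zero (k := k)) = codelete := rfl
theorem polar_cocopy : polar (cocopy (k := k)) = add := rfl
theorem polar_codelete : polar (codelete (k := k)) = zero := rfl
theorem polar_coscalar (a : k) : polar (coscalar a) = scalar a := rfl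
theorem polar_coadd : polar (coadd (k := k)) = copy := rfl
theorem polar_cozero : polar (cozero (k := k)) = delete := rfl
theorem polar_geq : polar (geq (k := k)) = copy ⨾ ((geq ⨾ cozero) ⊞ wire) := rfl
theorem polar_wire : polar (wire (k := k)) = wire := rfl
theorem polar_swap : polar (swap (k := k)) = swap := rfl
theorem polar_empty : polar (empty (k := k)) = empty := rfl
theorem polar_seq {n m l : ℕ} (c : CircGeq k n m) (d : CircGeq k m l) :
    polar (c ⨾ d) = polar c ⨾ polar d := rfl
theorem polar_tensor {n m n' m' : ℕ} (c : CircGeq k n m) (d : CircGeq k n' m') :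
    polar (c ⊞ d) = polar c ⊞ polar d := rfl

theorem sem_polar_geq (x y : Fin 1 → k) : sem (polar geq) x y ↔ x 0 = y 0 ∧ 0 ≤ x 0 := by
  simp only [polar_geq, sem_seq, sem_tensor, sem_geq, sem_wire, sem_copy, sem_cozero,
    exists_fin_succ, exists_fin_zero, zero_mk, one_mk, natAdd_mk',
    castAdd_mk', vecCons_mk_succ, vecCons_mk_zero]
  simp
  grind

variable [IsStrictOrderedRing k]

theorem sem_polar_leq (x y : Fin 1 → k) : sem (polar leq) x y ↔ x 0 = y 0 ∧ x 0 ≤ 0 := by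
  simp only [leq, cap, cup, polar_seq, polar_tensor, polar_wire, polar_cocopy, polar_codelete,
    polar_copy, polar_delete, sem_seq, sem_tensor, sem_polar_geq, sem_wire, sem_add, sem_coadd,
    sem_zero, sem_cozero, exists_fin_succ, exists_fin_zero, zero_mk, one_mk, natAdd_mk',
    castAdd_mk', vecCons_mk_succ, vecCons_mk_zero]
  simp
  exact ⟨by grind, fun h => ⟨-y 0, by grind⟩⟩

theorem sem_polar_ihEquation {n m : ℕ} {c d : CircGeq k n m} (h : IHEquation c d) (x : Fin n → k)
    (y : Fin m → k) : sem (polar c) x y ↔ sem (polar d) x y := by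
  cases h <;>
  simp only [cap, cup, polar_seq, polar_tensor, polar_wire, polar_swap, polar_empty, polar_copy,
    polar_delete, polar_scalar, polar_add, polar_zero, polar_cocopy, polar_codelete,
    polar_coscalar, polar_coadd, polar_cozero, sem_seq, sem_tensor, sem_wire, sem_copy,
    sem_cocopy, sem_empty,
    sem_delete, sem_codelete, sem_zero, sem_cozero, sem_swap, sem_add, sem_coadd, sem_scalar,
    sem_coscalar, exists_fin_succ, exists_fin_zero, zero_mk, one_mk, natAdd_mk', castAdd_mk',
    vecCons_mk_succ, vecCons_mk_zero] <;> try simp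
  case scalar_coscalar a ha =>
    refine ⟨fun ⟨b, h, h'⟩ => h.trans h'.symm, fun h => ⟨a⁻¹ * y 0, ?_, ?_⟩⟩
    · rw [h, mul_inv_cancel_left₀ ha]
    · rw [mul_inv_cancel_left₀ ha]
  case copy_frobenius_left => exact ⟨by grind, fun h => ⟨x 0 - y 0, by grind⟩⟩
  case copy_frobenius_right => exact ⟨fun h => ⟨y 0 - x 0, by grind⟩, by grind⟩
  case copy_special => exact ⟨by grind, fun h => ⟨x 0, 0, by grind⟩⟩
  case cap_eq => exact ⟨fun h => ⟨-x 0, by grind⟩, by grind⟩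
  all_goals grind

theorem sem_polar_ihAxiom {n m : ℕ} {c d : CircGeq k n m} (h : IHAxiom c d) {x : Fin n → k}
    {y : Fin m → k} (hd : sem (polar d) x y) : sem (polar c) x y := by
  cases h with
  | eq h => exact (sem_polar_ihEquation h x y).2 hd
  | eq_symm h => exact (sem_polar_ihEquation h x y).1 hd
  | cozero_le_delete => trivial

theorem sem_polar_geqEquation {n m : ℕ} {c d : CircGeq k n m} (h : GeqEquation c d)
    (x : Fin n → k) (y : Fin m → k) : sem (polar c) x y ↔ sem (polar d) x y := by
  cases h <;>
  simp only [polar_seq, polar_tensor, polar_wire, polar_swap, polar_copy,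
    polar_delete, polar_scalar, polar_add, polar_cocopy, polar_codelete,
    sem_seq, sem_tensor, sem_wire, sem_cocopy, sem_polar_geq, sem_polar_leq,
    sem_zero, sem_cozero, sem_swap, sem_add, sem_coadd,
    sem_coscalar, exists_fin_succ, exists_fin_zero, zero_mk, one_mk, natAdd_mk', castAdd_mk',
    vecCons_mk_succ, vecCons_mk_zero] <;> try simp
  case pos_scalar a ha =>
    rw [and_comm, and_congr_left_iff]
    intro h
    rw [h, mul_nonneg_iff_of_pos_left ha]
  case neg_scalar a ha =>
    rw [and_comm, and_congr_left_iff]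
    intro h
    rw [h, mul_nonpos_iff_pos_imp_nonpos]
    exact ⟨fun h' => ⟨fun h'' => absurd h'' ha.not_gt, fun h'' => absurd h'' h'.not_gt⟩,
      fun h' => not_lt.1 fun h'' => (h'.2 h'').not_gt ha⟩
  case spider =>
    -- The polar of the spider asks for a nonnegative `2 × 2` table with row sums `x` and column
    -- sums `y`. The corner rule fills it, starting from the largest admissible first entry.
    refine ⟨fun h => ⟨min (x 0) (y 0), x 0 - min (x 0) (y 0), y 0 - min (x 0) (y 0),
      y 1 - x 0 + min (x 0) (y 0), by grind⟩, ?_⟩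
    rintro ⟨a, b, c, d, h⟩
    grind
  all_goals grind

theorem sem_polar_of_geqInequation {n m : ℕ} {c d : CircGeq k n m} (h : GeqInequation c d)
    {x : Fin n → k} {y : Fin m → k} : sem (polar d) x y → sem (polar c) x y := by
  cases h <;>
  simp only [polar_seq, polar_tensor, polar_wire, polar_copy, polar_cocopy, polar_cozero,
    sem_seq, sem_tensor, sem_wire, sem_polar_geq, sem_polar_leq, sem_delete, sem_add, sem_coadd,
    exists_fin_succ, exists_fin_zero, zero_mk, one_mk, natAdd_mk', castAdd_mk',
    vecCons_mk_succ, vecCons_mk_zero] <;> try simp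
  case antisymm =>
    -- The polar of antisymmetry splits a value into its positive and negative parts.
    exact fun h => ⟨max (x 0) 0, min (x 0) 0, by grind⟩
  all_goals grind

/-- By completeness each axiom only has to be checked on denotations, with the inclusion reversed;
the congruence rules transfer because the polar is a prop morphism. -/
theorem polar_antitone {n m : ℕ} {c d : CircGeq k n m} (h : IHPLe c d) :
    IHPLe (polar d) (polar c) := by
  induction h with
  | ssm h => exact .ssm (polar_ssm h).symm
  | trans _ _ ih ih' => exact ih'.trans ih
  | seq _ _ ih ih' => exact .seq ih ih'
  | tensor _ _ ih ih' => exact .tensor ih ih'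
  | ih h => exact ihpLe_iff.2 fun _ _ => sem_polar_ihAxiom h
  | ih_op h =>
    refine ihpLe_iff.2 fun x y => ?_
    rw [(polar_op_of_ihAxiom h).1, (polar_op_of_ihAxiom h).2, sem_op, sem_op]
    exact sem_polar_ihAxiom h
  | geq_eq h => exact ihpLe_iff.2 fun x y => (sem_polar_geqEquation h x y).2
  | geq_eq_symm h => exact ihpLe_iff.2 fun x y => (sem_polar_geqEquation h x y).1
  | geq_ineq h => exact ihpLe_iff.2 fun x y => sem_polar_of_geqInequation h

theorem polar_congr {n m : ℕ} {c d : CircGeq k n m} (h : IHPEq c d) :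
    IHPEq (polar c) (polar d) :=
  ⟨polar_antitone h.2, polar_antitone h.1⟩

/-- The polar operator is an involution. -/
theorem polar_polar {n m : ℕ} (c : CircGeq k n m) : IHPEq (polar (polar c)) c := by
  induction c with
  | gen g =>
    cases g with
    | right g => cases g <;> exact .of_ssm (.refl _)
    | left g => cases g <;> exact .of_ssm (.refl _)
    | geq =>
      -- `geq` is the only generator not returned syntactically. Its double polar says `x = t + y`
      -- with `t ≥ 0`.
      refine ihpEq_iff.2 fun x y => ?_
      change sem (polar (copy ⨾ ((geq ⨾ cozero) ⊞ wire))) x y ↔ sem geq x y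
      simp only [polar_seq, polar_tensor, polar_wire, polar_copy, polar_cozero,
        sem_seq, sem_tensor, sem_wire, sem_polar_geq, sem_geq, sem_delete, sem_coadd,
        exists_fin_succ, exists_fin_zero, zero_mk, one_mk, natAdd_mk', castAdd_mk',
        vecCons_mk_succ, vecCons_mk_zero]
      simp
      exact ⟨by grind, fun h => ⟨x 0 - y 0, by grind⟩⟩
  | id n => exact .of_ssm (.refl _)
  | sym n m => exact .of_ssm (.refl _)
  | seq c d ihc ihd => exact ⟨.seq ihc.1 ihd.1, .seq ihc.2 ihd.2⟩
  | tensor c d ihc ihd => exact ⟨.tensor ihc.1 ihd.1, .tensor ihc.2 ihd.2⟩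

end polar

end CircGeq
theorem mainTheorem7 {k : Type*} [Field k] [LinearOrder k] [IsStrictOrderedRing k] :
    -- every circuit is provably equal to one in finitely generated normal form
    (∀ (n m : ℕ) (c : CircGeq k n m),
      ∃ d : CircGeq k n m, CircGeq.IsFinGenNF d ∧ CircGeq.IHPEq c d) ∧
    -- the left circuit `V` of such a form denotes a matrix `M`, and any circuit that is provably
    -- equal to the form denotes `cone(M)`
    (∀ (n m p : ℕ) (V : CircLeft k (n + m) p), ∃ M : Matrix (Fin (n + m)) (Fin p) k,
      (∀ u z, CircGeq.sem V.incl u z ↔ u = M.mulVec z) ∧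
      ∀ c : CircGeq k n m, CircGeq.IHPEq c (CircGeq.conic V.incl) →
        ∀ x y, CircGeq.sem c x y ↔ Fin.append x y ∈ finGenCone M) ∧
    -- the form is obtained from a first normal form of the polar circuit by taking the polar
    (∀ (n m : ℕ) (c : CircGeq k n m),
      (∃ P : CircGeq k n m, CircGeq.IsPolyhedralNF P ∧ CircGeq.IHPEq (CircGeq.polar c) P) ∧
      ∀ P : CircGeq k n m, CircGeq.IsPolyhedralNF P → CircGeq.IHPEq (CircGeq.polar c) P →
        ∃ d : CircGeq k n m, CircGeq.IsFinGenNF d ∧ CircGeq.IHPEq (CircGeq.polar P) d ∧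
          CircGeq.IHPEq c d) ∧
    -- Weyl–Minkowski, for circuits and for cones
    (∀ (n m : ℕ) (c : CircGeq k n m),
      (CircGeq.IsPolyhedralNF c → ∃ d, CircGeq.IsFinGenNF d ∧ CircGeq.IHPEq c d) ∧
      (CircGeq.IsFinGenNF c → ∃ d, CircGeq.IsPolyhedralNF d ∧ CircGeq.IHPEq c d)) ∧
    (∀ (N : ℕ) (S : Set (Fin N → k)),
      (∃ (p : ℕ) (A : Matrix (Fin p) (Fin N) k), S = polyhedralCone A) ↔
        ∃ (p : ℕ) (V : Matrix (Fin N) (Fin p) k), S = finGenCone V) := by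
  refine ⟨fun n m c => CircGeq.exists_isFinGenNF c, fun n m p V => ?_, fun n m c => ?_,
    fun n m c => ⟨fun _ => CircGeq.exists_isFinGenNF c,
      fun _ => CircGeq.exists_isPolyhedralNF c⟩, fun N S => ?_⟩
  · obtain ⟨M, hM⟩ := CircGeq.exists_matrix_of_left V
    refine ⟨M, hM, fun c hc x y => ?_⟩
    rw [CircGeq.ihpEq_iff.1 hc, CircGeq.sem_conic_left hM]
  · refine ⟨CircGeq.exists_isPolyhedralNF _, fun P _ hc => ?_⟩
    obtain ⟨d, hd, h⟩ := CircGeq.exists_isFinGenNF (CircGeq.polar P)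
    refine ⟨d, hd, h, ?_⟩
    -- The chain is `c = c°° = P° = d`.
    have h1 := CircGeq.polar_polar c
    have h2 := CircGeq.polar_congr hc
    exact ⟨h1.2.trans (h2.1.trans h.1), h.2.trans (h2.2.trans h1.1)⟩
  · constructor
    · rintro ⟨p, A, rfl⟩
      exact CircGeq.exists_polyhedralCone_eq_finGenCone A
    · rintro ⟨p, V, rfl⟩
      exact CircGeq.exists_finGenCone_eq_polyhedralCone V
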